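/- **Symmetric multicategories.** A symmetric multicategory $Q$ (with a category of objects) has a category $\mathbb{C}=o(Q)$ of objects, a set $Q(x_1,\dots,x_k;x)$ of arrows for all $k\ge 0$ and objects $x_i,x$, composition of arrows, an action $f\mapsto f\sigma$ of permutations, $Q(x_1,\dots,x_k;x)\to Q(x_{\sigma(1)},\dots,x_{\sigma(k)};x)$, and a map $\iota$ from the morphisms $a:x\to y$ of $\mathbb{C}$ to the unary arrows $Q(x;y)$, compatible with composition; the arrows $\iota(1_x)$ are units for composition, and composition is associative and equivariant. Its *slice* $Q^+$ is the following symmetric multicategory. Its category of objects is the category of elements of $Q$: the objects are the arrows of $Q$, and a morphism from $g\in Q(x_1,\dots,x_m;x)$ to $g'\in Q(y_1,\dots,y_m;y)$ consists of a permutation $\sigma$ and morphisms $f_1,\dots,f_m,f$ of $\mathbb{C}$ with $g'=(\iota(f)\circ g\circ(\iota(f_1),\dots,\iota(f_m)))\sigma$. An arrow in $Q^+(f_1,\dots,f_n;f)$ is a triple $(T,\rho,\tau)$ in which $T$ is a planar tree with $n$ nodes, each node being labelled by an arrow of $Q$ with as many sources as the node has inputs and each edge by a morphism of $\mathbb{C}$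 (the label of an input edge of a node ends at the corresponding source of the arrow at the node, the label of its output edge starts at the target of this arrow), $\tau$ is a bijection from the nodes of $T$ to $\{1,\dots,n\}$ such that the node $N$ is labelled by $f_{\tau(N)}$, and $\rho$ is a permutation of the leaves of $T$ such that composing the $f_i$ along $T$, with the edge labels $a$ acting as $\iota(a)$, and then applying $\rho$ yields $f$. Arrows of $Q^+$ are composed by replacing a node by a tree and composing edge labels; the symmetric action renumbers the nodes; $\iota$ of a morphism $g\to g'$ as above is the tree with one node, labelled by $g$, with edges labelled by the $f_i$ and $f$, and twisted by $\sigma$. Let $I$ be the symmetric multicategory with precisely one object, one object-morphism and one arrow (the identity). Put $I^{0+}=I$ and $I^{k+}=(I^{(k-1)+})^+$ for $k\ge 1$. A *$k$-opetope* is an object of $I^{k+}$, and $\mathbb{C}_k=o(I^{k+})$ is the category of $k$-opetopes. **Generalised multicategories.** A generalised multicategory $M$ has a set $o(M)$ of objects, a set $a(M)$ of arrows, each with a finite list $s(f)$ of sources and a target $t(f)$, identities $1_x:x\to x$, and for $t(g)=s(f)_p$ a composite $f\circ_p g$ with target $t(f)$, together with a specified source-preserving bijection ("amalgamating maps") from the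 disjoint union of the source positions of $f$ other than $p$ and the source positions of $g$ to the source positions of $f\circ_p g$. These satisfy the unit laws, associativity $(f\circ_p g)\circ_{\bar q}h=f\circ_p(g\circ_q h)$ and commutativity $(f\circ_p g)\circ_{\bar q}h=(f\circ_q h)\circ_{\bar p}g$ for $p\ne q$, in each case also for the (composite) amalgamating maps, a bar denoting the image of a position under the appropriate amalgamating map. The *slice* $M_+$ has the arrows of $M$ as objects. Its arrows are the planar trees $T$ with nodes labelled by arrows of $M$ and edges labelled by objects of $M$, such that the inputs of a node labelled by $f$ are labelled, from left to right, by $s(f)$ and its output by $t(f)$; for each $T$ an order on its nodes is chosen, the sources of $T$ are the labels of its nodes in this order, and the target of $T$ is the composite in $M$ of the labels along $T$. The identity of $f$ is the tree with one node labelled by $f$. The composite $T_1\circ_p T_2$ is obtained by replacing the $p$-th node of $T_1$ by $T_2$, the leaves of $T_2$ being joined to the inputs of this node as prescribed by the amalgamating maps of $M$; the amalgamating maps of $M_+$ are the evident bijections of nodes. A different choice of orders gives an isomorphic slice. Let $J$ be the generalised multicategory with precisely one object and precisely one arrow (the identity). Put $J_{0+}=J$ and $J_{k+}=(J_{(k-1)+})_+$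 for $k\ge 1$, with any choice of orders on the nodes of trees at each stage. A *$k$-multitope* is an object of $J_{k+}$, and $P_k=o(J_{k+})$ is the set of $k$-multitopes, regarded as a discrete category. **Corollary.** For every $k\ge 0$ (and for every choice of the orders on nodes made in the construction of $J_{k+}$) there is an equivalence of categories $$P_k\simeq\mathbb{C}_k .$$ Consequently this equivalence induces a bijection between the $k$-multitopes and the isomorphism classes of $k$-opetopes: opetopes and multitopes are the same up to isomorphism. -/

import Mathlib

open CategoryTheory

namespace Opetopic

/-! ### Labelled planar trees -/

/-- A signature over a category `C`: a collection of arrows, each with a finite list of sources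
and a target in `C`. -/
structure Sig (C : Type) where
  Arr : Type
  ar : Arr → ℕ
  src : ∀ f : Arr, Fin (ar f) → C
  tgt : Arr → C

/-- Planar trees over a signature with root edge ending at a given object of `C`.
Every edge of the tree carries exactly one label, a morphism of `C`.
Every node carries a name `i : I` and stands for the arrow `F i`; it has one input edge for each
source of `F i`, whose label ends at that source, and the label of its output edge starts at the
target of `F i`.
Every leaf carries a name `k : K`, and the label of its edge starts at the object `x k`.
The tree `leaf k a` is the tree without nodes. -/
inductive Tree {C : Type} [Category.{0} C] (S : Sig C) {I K : Type} (F : I → S.Arr) (x : K → C) :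
    C → Type
  | leaf {z : C} (k : K) (a : x k ⟶ z) : Tree S F x z
  | node {z : C} (i : I) (a : S.tgt (F i) ⟶ z)
      (ch : ∀ j : Fin (S.ar (F i)), Tree S F x (S.src (F i) j)) : Tree S F x z

namespace Tree

section

variable {C : Type} [Category.{0} C] {S : Sig C}

/-- The nodes of a tree. -/
def Nodes {I K : Type} {F : I → S.Arr} {x : K → C} : ∀ {z : C}, Tree S F x z → Type
  | _, leaf _ _ => Empty
  | _, node _ _ ch => PUnit ⊕ (Σ j, Nodes (ch j))

/-- The name of a node. -/
def nodeName {I K : Type} {F : I → S.Arr} {x : K → C} :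
    ∀ {z : C} (T : Tree S F x z), T.Nodes → I
  | _, leaf _ _ => Empty.elim
  | _, node i _ ch => Sum.elim (fun _ => i) (fun p => nodeName (ch p.1) p.2)

/-- Compose the label of the root edge with a morphism. -/
def post {I K : Type} {F : I → S.Arr} {x : K → C} {z w : C} :
    Tree S F x z → (z ⟶ w) → Tree S F x w
  | leaf k a, b => leaf k (a ≫ b)
  | node i a ch, b => node i (a ≫ b) ch

/-- Graft the tree `t k` on every leaf named `k`; the two labels of an edge arising in
this way are composed. -/
def graft {I K K' : Type} {F : I → S.Arr} {x : K → C} {x' : K' → C}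
    (t : ∀ k, Tree S F x' (x k)) : ∀ {z : C}, Tree S F x z → Tree S F x' z
  | _, leaf k a => (t k).post a
  | _, node i a ch => node i a (fun j => graft t (ch j))

/-- The tree with one node, all its edges being labelled by identities. -/
def corolla {I : Type} {F : I → S.Arr} (i : I) : Tree S F (S.src (F i)) (S.tgt (F i)) :=
  node i (𝟙 _) (fun j => leaf j (𝟙 _))

/-- Replace every node named `i` by the tree `U i`, whose leaves are named by the sources of
the arrow `F i`; the labels of an edge arising in this way are composed. -/
def subst {I J K : Type} {F : I → S.Arr} {G : J → S.Arr} {x : K → C}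
    (U : ∀ i, Tree S G (S.src (F i)) (S.tgt (F i))) :
    ∀ {z : C}, Tree S F x z → Tree S G x z
  | _, leaf k a => leaf k a
  | _, node i a ch => ((U i).graft (fun j => subst U (ch j))).post a

/-- Rename the nodes of a tree. -/
def rename {I J K : Type} {G : J → S.Arr} {x : K → C} (h : I → J) :
    ∀ {z : C}, Tree S (fun i => G (h i)) x z → Tree S G x z
  | _, leaf k a => leaf k a
  | _, node i a ch => node (h i) a (fun j => rename h (ch j))

/-- The sum of the weights of the leaves. -/
def leafSum {I K : Type} {F : I → S.Arr} {x : K → C} (w : K → ℕ) :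
    ∀ {z : C}, Tree S F x z → ℕ
  | _, leaf k _ => w k
  | _, node _ _ ch => ∑ j, leafSum w (ch j)

/-- The sum of the weights of the nodes. -/
def nodeSum {I K : Type} {F : I → S.Arr} {x : K → C} (w : I → ℕ) :
    ∀ {z : C}, Tree S F x z → ℕ
  | _, leaf _ _ => 0
  | _, node i _ ch => w i + ∑ j, nodeSum w (ch j)

theorem post_id {I K : Type} {F : I → S.Arr} {x : K → C} {z : C} (T : Tree S F x z) :
    T.post (𝟙 z) = T := by
  cases T <;> simp [post]

theorem post_post {I K : Type} {F : I → S.Arr} {x : K → C} {z w v : C} (T : Tree S F x z)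
    (a : z ⟶ w) (b : w ⟶ v) : (T.post a).post b = T.post (a ≫ b) := by
  cases T <;> simp [post]

theorem graft_post {I K K' : Type} {F : I → S.Arr} {x : K → C} {x' : K' → C}
    (t : ∀ k, Tree S F x' (x k)) {z w : C} (T : Tree S F x z) (a : z ⟶ w) :
    (T.post a).graft t = (T.graft t).post a := by
  cases T with
  | leaf k b => exact (post_post _ _ _).symm
  | node i b ch => rfl

theorem graft_leaf {I K : Type} {F : I → S.Arr} {x : K → C} {z : C} (T : Tree S F x z) :
    T.graft (fun k => leaf k (𝟙 (x k))) = T := by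
  induction T with
  | leaf k a => simp [graft, post]
  | node i a ch ih => simp [graft, ih]

theorem graft_graft {I K K' K'' : Type} {F : I → S.Arr} {x : K → C} {x' : K' → C} {x'' : K'' → C}
    (t : ∀ k, Tree S F x' (x k)) (u : ∀ k, Tree S F x'' (x' k)) {z : C} (T : Tree S F x z) :
    (T.graft t).graft u = T.graft (fun k => (t k).graft u) := by
  induction T with
  | leaf k a => simp [graft, graft_post]
  | node i a ch ih => simp [graft, ih]

theorem subst_post {I J K : Type} {F : I → S.Arr} {G : J → S.Arr} {x : K → C}
    (U : ∀ i, Tree S G (S.src (F i)) (S.tgt (F i))) {z w : C} (T : Tree S F x z) (a : z ⟶ w) :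
    (T.post a).subst U = (T.subst U).post a := by
  cases T with
  | leaf k b => rfl
  | node i b ch => exact (post_post _ _ _).symm

theorem subst_graft {I J K K' : Type} {F : I → S.Arr} {G : J → S.Arr} {x : K → C} {x' : K' → C}
    (U : ∀ i, Tree S G (S.src (F i)) (S.tgt (F i))) (t : ∀ k, Tree S F x' (x k)) {z : C}
    (T : Tree S F x z) :
    (T.graft t).subst U = (T.subst U).graft (fun k => (t k).subst U) := by
  induction T with
  | leaf k a => simp [graft, subst, subst_post]
  | node i a ch ih => simp [graft, subst, ih, graft_post, graft_graft]

theorem subst_subst {I J L K : Type} {F : I → S.Arr} {G : J → S.Arr} {H : L → S.Arr} {x : K → C}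
    (U : ∀ i, Tree S G (S.src (F i)) (S.tgt (F i)))
    (V : ∀ i, Tree S H (S.src (G i)) (S.tgt (G i))) {z : C} (T : Tree S F x z) :
    (T.subst U).subst V = T.subst (fun i => (U i).subst V) := by
  induction T with
  | leaf k a => simp [subst]
  | node i a ch ih => simp [subst, subst_post, subst_graft, ih]

theorem corolla_subst {I J : Type} {F : I → S.Arr} {G : J → S.Arr}
    (U : ∀ i, Tree S G (S.src (F i)) (S.tgt (F i))) (i : I) :
    (corolla (S := S) (F := F) i).subst U = U i := by
  simp [corolla, subst, graft_leaf, post_id]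

theorem rename_eq {I J K : Type} {G : J → S.Arr} {x : K → C} (h : I → J) {z : C}
    (T : Tree S (fun i => G (h i)) x z) :
    T.rename h = T.subst (fun i => corolla (F := G) (h i)) := by
  induction T with
  | leaf k a => rfl
  | node i a ch ih =>
    simp only [rename, ih, subst, corolla, graft, post_id]
    simp only [post, Category.id_comp]

theorem subst_corolla {I K : Type} {F : I → S.Arr} {x : K → C} {z : C} (T : Tree S F x z) :
    T.subst (fun i => corolla i) = T := by
  induction T with
  | leaf k a => rfl
  | node i a ch ih =>
    simp only [corolla] at ih
    simp only [subst, corolla, graft, post_id, ih]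
    simp only [post, Category.id_comp]

theorem rename_subst {I J L K : Type} {G : J → S.Arr} {H : L → S.Arr} {x : K → C} (h : I → J)
    (U : ∀ i, Tree S H (S.src (G i)) (S.tgt (G i))) {z : C}
    (T : Tree S (fun i => G (h i)) x z) :
    (T.rename h).subst U = T.subst (fun i => U (h i)) := by
  rw [rename_eq, subst_subst]; simp only [corolla_subst]

theorem subst_rename {I J L K : Type} {F : I → S.Arr} {H : L → S.Arr} {x : K → C} (h : J → L)
    (U : ∀ i, Tree S (fun j => H (h j)) (S.src (F i)) (S.tgt (F i))) {z : C}
    (T : Tree S F x z) :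
    (T.subst U).rename h = T.subst (fun i => (U i).rename h) := by
  rw [rename_eq, subst_subst]; simp only [rename_eq]

theorem rename_rename {I J L K : Type} {H : L → S.Arr} {x : K → C} (h : I → J) (h' : J → L)
    {z : C} (T : Tree S (fun i => H (h' (h i))) x z) :
    (rename (G := fun j => H (h' j)) h T).rename h' = rename (G := H) (fun i => h' (h i)) T := by
  induction T with
  | leaf k a => rfl
  | node i a ch ih => simp [rename, ih]

theorem rename_id {I K : Type} {F : I → S.Arr} {x : K → C} {z : C} (T : Tree S F x z) :
    rename (G := F) (fun i => i) T = T := by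
  induction T with
  | leaf k a => rfl
  | node i a ch ih => simp [rename, ih]

theorem rename_post {I J K : Type} {G : J → S.Arr} {x : K → C} (h : I → J) {z w : C}
    (T : Tree S (fun i => G (h i)) x z) (a : z ⟶ w) :
    (T.post a).rename h = (T.rename h).post a := by
  cases T <;> simp [post, rename]

theorem rename_graft {I J K K' : Type} {G : J → S.Arr} {x : K → C} {x' : K' → C} (h : I → J)
    (t : ∀ k, Tree S (fun i => G (h i)) x' (x k)) {z : C} (T : Tree S (fun i => G (h i)) x z) :
    (T.graft t).rename h = (T.rename h).graft (fun k => (t k).rename h) := by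
  induction T with
  | leaf k a => simp [graft, rename, rename_post]
  | node i a ch ih => simp [graft, rename, ih]

theorem leafSum_post {I K : Type} {F : I → S.Arr} {x : K → C} (w : K → ℕ) {z v : C}
    (T : Tree S F x z) (a : z ⟶ v) : (T.post a).leafSum w = T.leafSum w := by
  cases T <;> simp [post, leafSum]

theorem nodeSum_post {I K : Type} {F : I → S.Arr} {x : K → C} (w : I → ℕ) {z v : C}
    (T : Tree S F x z) (a : z ⟶ v) : (T.post a).nodeSum w = T.nodeSum w := by
  cases T <;> simp [post, nodeSum]

theorem nodeSum_graft {I K K' : Type} {F : I → S.Arr} {x : K → C} {x' : K' → C} (w : I → ℕ)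
    (t : ∀ k, Tree S F x' (x k)) {z : C} (T : Tree S F x z) :
    (T.graft t).nodeSum w = T.nodeSum w + T.leafSum (fun k => (t k).nodeSum w) := by
  induction T with
  | leaf k a => simp [graft, nodeSum, leafSum, nodeSum_post]
  | node i a ch ih => simp [graft, nodeSum, leafSum, ih, Finset.sum_add_distrib, add_assoc]

theorem nodeSum_subst {I J K : Type} {F : I → S.Arr} {G : J → S.Arr} {x : K → C}
    (U : ∀ i, Tree S G (S.src (F i)) (S.tgt (F i)))
    (hU : ∀ i (v : Fin (S.ar (F i)) → ℕ), (U i).leafSum v = ∑ j, v j)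
    (w : J → ℕ) {z : C} (T : Tree S F x z) :
    (T.subst U).nodeSum w = T.nodeSum (fun i => (U i).nodeSum w) := by
  induction T with
  | leaf k a => rfl
  | node i a ch ih => simp [subst, nodeSum, nodeSum_post, nodeSum_graft, hU, ih]

theorem nodeSum_rename {I J K : Type} {G : J → S.Arr} {x : K → C} (h : I → J) (w : J → ℕ) {z : C}
    (T : Tree S (fun i => G (h i)) x z) :
    (T.rename h).nodeSum w = T.nodeSum (fun i => w (h i)) := by
  induction T with
  | leaf k a => rfl
  | node i a ch ih => simp [rename, nodeSum, ih]

theorem leafSum_rename {I J K : Type} {G : J → S.Arr} {x : K → C} (h : I → J) (w : K → ℕ) {z : C}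
    (T : Tree S (fun i => G (h i)) x z) :
    (T.rename h).leafSum w = T.leafSum w := by
  induction T with
  | leaf k a => rfl
  | node i a ch ih => simp [rename, leafSum, ih]

noncomputable instance instFintypeNodes {I K : Type} {F : I → S.Arr} {x : K → C} {z : C}
    (T : Tree S F x z) : Fintype T.Nodes := by
  induction T with
  | leaf k a => exact inferInstanceAs (Fintype Empty)
  | node i a ch ih => exact inferInstanceAs (Fintype (PUnit ⊕ (Σ j, Nodes (ch j))))

theorem sum_nodes {I K : Type} {F : I → S.Arr} {x : K → C} (w : I → ℕ) {z : C}
    (T : Tree S F x z) : ∑ N : T.Nodes, w (T.nodeName N) = T.nodeSum w := by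
  induction T with
  | leaf k a => exact Fintype.sum_empty (ι := Empty) _
  | node i a ch ih =>
    refine (Fintype.sum_sum_type (α₁ := PUnit) (α₂ := Σ j, Nodes (ch j)) _).trans ?_
    rw [Fintype.sum_sigma]
    simp [nodeSum, ← ih, nodeName]

open Classical in
theorem bijective_iff_sum {A B : Type} [Fintype A] (f : A → B) :
    Function.Bijective f ↔
      ∀ b, ∑ a, (if f a = b then 1 else 0 : ℕ) = 1 := by
  simp only [Finset.sum_boole, Nat.cast_id, Finset.card_eq_one, Function.bijective_iff_existsUnique]
  refine forall_congr' fun b => ?_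
  constructor
  · rintro ⟨a, h, h'⟩
    exact ⟨a, by ext c; simpa using ⟨fun e => h' c e, fun e => e ▸ h⟩⟩
  · rintro ⟨a, h⟩
    simp only [Finset.ext_iff, Finset.mem_filter, Finset.mem_univ, true_and,
      Finset.mem_singleton] at h
    exact ⟨a, (h a).2 rfl, fun c hc => (h c).1 hc⟩

open Classical in
theorem nodeName_bijective_iff {I K : Type} {F : I → S.Arr} {x : K → C} {z : C}
    (T : Tree S F x z) :
    Function.Bijective T.nodeName ↔
      ∀ i, T.nodeSum (fun i' => (if i' = i then 1 else 0 : ℕ)) = 1 := by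
  rw [bijective_iff_sum]
  simp only [← sum_nodes]

end

end Tree

/-! ### Symmetric multicategories with a category of objects -/

/-- The bijection `Σ _ : PUnit, I ≃ I`. -/
def punitSigma (I : Type) : (Σ _ : PUnit.{1}, I) ≃ I where
  toFun p := p.2
  invFun i := ⟨⟨⟩, i⟩
  left_inv _ := rfl
  right_inv _ := rfl

/-- The bijection `Σ _ : I, PUnit ≃ I`. -/
def sigmaPUnit (I : Type) : (Σ _ : I, PUnit.{1}) ≃ I where
  toFun p := p.1
  invFun i := ⟨i, ⟨⟩⟩
  left_inv _ := rfl
  right_inv _ := rfl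

/-- A symmetric multicategory with a category of objects.

The sources of an arrow are indexed by an arbitrary finite set `I`; the arrows
`x₁, …, xₖ ⟶ y` are the elements of `Hom (Fin k) x y`. The sources of a composite
`f ∘ (g_i)_i` are indexed by the disjoint union of the index sets of the `g_i`.
The symmetric action is given by `perm`, the renaming of the sources
along a bijection `e`; for a permutation `σ` of `Fin k` the arrow `f σ`, with sources
`x_{σ(1)}, …, x_{σ(k)}`, is the renaming of `f` along `σ⁻¹`. -/
structure SymMulticat where
  /-- The objects. -/
  Obj : Type
  /-- The object-morphisms. -/
  [cat : Category.{0} Obj]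
  /-- The arrows with given sources and target. -/
  Hom : ∀ (I : Type) [Finite I], (I → Obj) → Obj → Type
  /-- The unary arrow given by an object-morphism. -/
  ι : ∀ {x y : Obj}, (x ⟶ y) → Hom PUnit (fun _ => x) y
  /-- Composition. -/
  comp : ∀ {I : Type} [Finite I] {J : I → Type} [∀ i, Finite (J i)] {x : I → Obj} {y : Obj}
    {w : ∀ i, J i → Obj}, Hom I x y → (∀ i, Hom (J i) (w i) (x i)) →
      Hom (Σ i, J i) (fun p => w p.1 p.2) y
  /-- Symmetric action. -/
  perm : ∀ {I J : Type} [Finite I] [Finite J] (e : I ≃ J) {x : J → Obj} {y : Obj},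
    Hom I (fun i => x (e i)) y → Hom J x y
  /-- Left unit law. -/
  id_comp : ∀ {I : Type} [Finite I] {x : I → Obj} {y : Obj} (f : Hom I x y),
    perm (punitSigma I) (comp (ι (𝟙 y)) (fun _ => f)) = f
  /-- Right unit law. -/
  comp_id : ∀ {I : Type} [Finite I] {x : I → Obj} {y : Obj} (f : Hom I x y),
    perm (sigmaPUnit I) (comp f (fun i => ι (𝟙 (x i)))) = f
  /-- Associativity. -/
  assoc : ∀ {I : Type} [Finite I] {J : I → Type} [∀ i, Finite (J i)] {K : ∀ i, J i → Type}
    [∀ i j, Finite (K i j)] {x : I → Obj} {y : Obj} {w : ∀ i, J i → Obj}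
    {v : ∀ i j, K i j → Obj} (f : Hom I x y) (g : ∀ i, Hom (J i) (w i) (x i))
    (h : ∀ i j, Hom (K i j) (v i j) (w i j)),
    perm (x := fun p => v p.1 p.2.1 p.2.2) (Equiv.sigmaAssoc K)
      (comp (comp f g) (fun p => h p.1 p.2)) = comp f (fun i => comp (g i) (h i))
  /-- The symmetric action is an action. -/
  perm_refl : ∀ {I : Type} [Finite I] {x : I → Obj} {y : Obj} (f : Hom I x y),
    perm (Equiv.refl I) f = f
  perm_perm : ∀ {I J K : Type} [Finite I] [Finite J] [Finite K] (e : I ≃ J) (e' : J ≃ K)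
    {x : K → Obj} {y : Obj} (f : Hom I (fun i => x (e' (e i))) y),
    perm e' (perm (x := fun j => x (e' j)) e f) = perm (e.trans e') f
  /-- Equivariance of composition in the outer arrow. -/
  perm_comp : ∀ {I I' : Type} [Finite I] [Finite I'] (e : I ≃ I') {J : I' → Type}
    [∀ i, Finite (J i)] {x : I' → Obj} {y : Obj} {w : ∀ i, J i → Obj}
    (f : Hom I (fun i => x (e i)) y) (g : ∀ i, Hom (J i) (w i) (x i)),
    comp (perm e f) g =
      perm (x := fun p => w p.1 p.2) (Equiv.sigmaCongrLeft e) (comp f (fun i => g (e i)))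
  /-- Equivariance of composition in the inner arrows. -/
  comp_perm : ∀ {I : Type} [Finite I] {J J' : I → Type} [∀ i, Finite (J i)] [∀ i, Finite (J' i)]
    (e : ∀ i, J i ≃ J' i) {x : I → Obj} {y : Obj} {w : ∀ i, J' i → Obj}
    (f : Hom I x y) (g : ∀ i, Hom (J i) (fun j => w i (e i j)) (x i)),
    comp f (fun i => perm (e i) (g i)) =
      perm (x := fun p => w p.1 p.2) (Equiv.sigmaCongrRight e) (comp f g)
  /-- Compatibility of `ι` with composition of object-morphisms. -/
  ι_comp : ∀ {x y z : Obj} (a : x ⟶ y) (b : y ⟶ z),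
    ι (a ≫ b) = perm (punitSigma PUnit) (comp (ι b) (fun _ => ι a))

attribute [instance] SymMulticat.cat

namespace SymMulticat

section

variable (Q : SymMulticat)

/-- The composite `ι(a) ∘ f`. -/
def post {I : Type} [Finite I] {x : I → Q.Obj} {y z : Q.Obj} (f : Q.Hom I x y) (a : y ⟶ z) :
    Q.Hom I x z :=
  Q.perm (punitSigma I) (Q.comp (Q.ι a) (fun _ => f))

/-- The composite `f ∘ (ι(a_i))_i`. -/
def pre {I : Type} [Finite I] {x' x : I → Q.Obj} {y : Q.Obj} (a : ∀ i, x' i ⟶ x i)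
    (f : Q.Hom I x y) : Q.Hom I x' y :=
  Q.perm (sigmaPUnit I) (Q.comp f (fun i => Q.ι (a i)))

variable {Q}

theorem post_id {I : Type} [Finite I] {x : I → Q.Obj} {y : Q.Obj} (f : Q.Hom I x y) :
    Q.post f (𝟙 y) = f := Q.id_comp f

theorem pre_id {I : Type} [Finite I] {x : I → Q.Obj} {y : Q.Obj} (f : Q.Hom I x y) :
    Q.pre (fun i => 𝟙 (x i)) f = f := Q.comp_id f

theorem post_perm {I J : Type} [Finite I] [Finite J] (e : I ≃ J) {x : J → Q.Obj} {y z : Q.Obj}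
    (f : Q.Hom I (fun i => x (e i)) y) (a : y ⟶ z) :
    Q.post (Q.perm e f) a = Q.perm e (Q.post f a) :=
  ((congrArg (Q.perm (punitSigma J))
    (Q.comp_perm (fun _ : PUnit => e) (w := fun _ => x) (Q.ι a) (fun _ => f))).trans
    (Q.perm_perm (x := x) _ (punitSigma J) _)).trans
    (Q.perm_perm (punitSigma I) e _).symm

theorem post_comp {I : Type} [Finite I] {J : I → Type} [∀ i, Finite (J i)] {x : I → Q.Obj}
    {y z : Q.Obj} {w : ∀ i, J i → Q.Obj} (f : Q.Hom I x y) (g : ∀ i, Q.Hom (J i) (w i) (x i))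
    (a : y ⟶ z) : Q.post (Q.comp f g) a = Q.comp (Q.post f a) g :=
  ((congrArg (Q.perm (x := fun p => w p.1 p.2) (punitSigma (Σ i, J i)))
    (Q.assoc (Q.ι a) (fun _ => f) (fun _ => g)).symm).trans
    (Q.perm_perm (x := fun p => w p.1 p.2) _ (punitSigma (Σ i, J i)) _)).trans
    (Q.perm_comp (punitSigma I) (Q.comp (Q.ι a) (fun _ => f)) g).symm

theorem post_post {I : Type} [Finite I] {x : I → Q.Obj} {y z v : Q.Obj} (f : Q.Hom I x y)
    (a : y ⟶ z) (b : z ⟶ v) : Q.post (Q.post f a) b = Q.post f (a ≫ b) := by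
  have h : Q.post f (a ≫ b) = Q.perm (punitSigma I) (Q.comp (Q.post (Q.ι a) b) (fun _ => f)) := by
    unfold post
    rw [Q.ι_comp]
  rw [h, ← post_comp]
  exact post_perm (punitSigma I) (Q.comp (Q.ι a) (fun _ => f)) b

theorem comp_pre {I : Type} [Finite I] {J : I → Type} [∀ i, Finite (J i)] {x x' : I → Q.Obj}
    {y : Q.Obj} {w : ∀ i, J i → Q.Obj} (a : ∀ i, x' i ⟶ x i) (f : Q.Hom I x y)
    (g : ∀ i, Q.Hom (J i) (w i) (x' i)) :
    Q.comp (Q.pre a f) g = Q.comp f (fun i => Q.post (g i) (a i)) :=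
  (Q.perm_comp (sigmaPUnit I) (Q.comp f (fun i => Q.ι (a i))) g).trans
    ((((congrArg (Q.perm (x := fun p => w p.1 p.2)
      (Equiv.sigmaCongrRight fun i => punitSigma (J i)))
      (Q.assoc f (fun i => Q.ι (a i)) (fun i _ => g i)).symm).trans
      (Q.perm_perm (x := fun p => w p.1 p.2) _
        (Equiv.sigmaCongrRight fun i => punitSigma (J i)) _))).symm.trans
      (Q.comp_perm (fun i => punitSigma (J i)) (w := w) f
        (fun i => Q.comp (Q.ι (a i)) (fun _ => g i))).symm)

theorem ι_post {x y z : Q.Obj} (a : x ⟶ y) (b : y ⟶ z) : Q.post (Q.ι a) b = Q.ι (a ≫ b) :=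
  (Q.ι_comp a b).symm

theorem pre_pre {I : Type} [Finite I] {x x' x'' : I → Q.Obj} {y : Q.Obj}
    (b : ∀ i, x'' i ⟶ x' i) (a : ∀ i, x' i ⟶ x i) (f : Q.Hom I x y) :
    Q.pre b (Q.pre a f) = Q.pre (fun i => b i ≫ a i) f := by
  have h := Q.comp_pre a f (fun i => Q.ι (b i))
  simp only [ι_post] at h
  exact congrArg (Q.perm (x := x'') (sigmaPUnit I)) h

theorem pre_perm {I J : Type} [Finite I] [Finite J] (e : I ≃ J) {x x' : J → Q.Obj} {y : Q.Obj}
    (a : ∀ j, x' j ⟶ x j) (f : Q.Hom I (fun i => x (e i)) y) :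
    Q.pre a (Q.perm e f) = Q.perm e (Q.pre (fun i => a (e i)) f) :=
  ((congrArg (Q.perm (x := x') (sigmaPUnit J)) (Q.perm_comp e f (fun j => Q.ι (a j)))).trans
    (Q.perm_perm (x := x') _ (sigmaPUnit J) _)).trans
    (Q.perm_perm (x := x') (sigmaPUnit I) e _).symm

theorem pre_post {I : Type} [Finite I] {x x' : I → Q.Obj} {y z : Q.Obj}
    (a : ∀ i, x' i ⟶ x i) (f : Q.Hom I x y) (b : y ⟶ z) :
    Q.pre a (Q.post f b) = Q.post (Q.pre a f) b :=
  ((post_perm (x := x') (sigmaPUnit I) (Q.comp f (fun i => Q.ι (a i))) b).trans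
    (congrArg (Q.perm (x := x') (sigmaPUnit I)) (post_comp f (fun i => Q.ι (a i)) b))).symm

variable (Q)

/-- The objects of the category of elements of `Q`, that is, the arrows of `Q` whose sources
form a list. -/
structure Elt where
  ar : ℕ
  src : Fin ar → Q.Obj
  tgt : Q.Obj
  hom : Q.Hom (Fin ar) src tgt

variable {Q}

/-- A morphism `g ⟶ g'` of the category of elements: a permutation `σ` and object-morphisms
`f_i : s(g')_{σ(i)} ⟶ s(g)_i` and `f : t(g) ⟶ t(g')` with
`g' = (ι(f) ∘ g ∘ (ι(f_1), …, ι(f_m))) σ`, in the sense of the symmetric action. -/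
@[ext]
structure EltHom (g g' : Q.Elt) where
  σ : Fin g.ar ≃ Fin g'.ar
  srcMap : ∀ i, g'.src (σ i) ⟶ g.src i
  tgtMap : g.tgt ⟶ g'.tgt
  eq : Q.perm σ (Q.post (Q.pre srcMap g.hom) tgtMap) = g'.hom

/-- The category of elements of `Q`. -/
instance instCategoryElt : Category.{0} Q.Elt where
  Hom := EltHom
  id g := ⟨Equiv.refl _, fun _ => 𝟙 _, 𝟙 _, by rw [post_id]; exact (Q.perm_refl _).trans (pre_id _)⟩
  comp {g g' g''} a b :=
    { σ := a.σ.trans b.σ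
      srcMap := fun i => b.srcMap (a.σ i) ≫ a.srcMap i
      tgtMap := a.tgtMap ≫ b.tgtMap
      eq := by
        rw [← b.eq, ← a.eq, pre_perm, post_perm, pre_post, pre_pre, post_post, Q.perm_perm]
        rfl }
  id_comp a := by
    apply EltHom.ext <;> simp
  comp_id a := by
    apply EltHom.ext <;> simp
  assoc a b c := by
    apply EltHom.ext
    · rfl
    · simp
    · simp

variable (Q)

/-- The signature formed by the arrows of `Q`. -/
abbrev sig : Sig Q.Obj where
  Arr := Q.Elt
  ar := Elt.ar
  src := Elt.src
  tgt := Elt.tgt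

/-- `Composes T lab f`: composing the arrows at the nodes of the tree `T`, according to their
positions in `T` and with the edge labels `a` acting as `ι(a)`, yields the arrow `f`, the source of
`f` with index `p` corresponding to a leaf named `lab p`. The order in which the leaves
are listed is arbitrary. -/
inductive Composes {I K : Type} {F : I → Q.Elt} {x : K → Q.Obj} :
    ∀ {z : Q.Obj} (_ : Tree Q.sig F x z) {L : Type} [Finite L] (lab : L → K)
      (_ : Q.Hom L (fun p => x (lab p)) z), Prop
  | leaf {z : Q.Obj} (k : K) (a : x k ⟶ z) :
      Composes (Tree.leaf k a) (fun _ : PUnit => k) (Q.ι a)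
  | node {z : Q.Obj} (i : I) (a : (F i).tgt ⟶ z)
      (ch : ∀ j : Fin (F i).ar, Tree Q.sig F x ((F i).src j))
      {L : Fin (F i).ar → Type} [∀ j, Finite (L j)] (lab : ∀ j, L j → K)
      (f : ∀ j, Q.Hom (L j) (fun p => x (lab j p)) ((F i).src j)) :
      (∀ j, Composes (ch j) (lab j) (f j)) →
      Composes (Tree.node i a ch) (fun p : Σ j, L j => lab p.1 p.2)
        (Q.post (Q.comp (F i).hom f) a)
  | perm {z : Q.Obj} (T : Tree Q.sig F x z) {L L' : Type} [Finite L] [Finite L'] (e : L ≃ L')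
      (lab : L' → K) (f : Q.Hom L (fun p => x (lab (e p))) z) :
      Composes T (fun p => lab (e p)) f → Composes T lab (Q.perm e f)

variable {Q}

theorem Composes.post {I K : Type} {F : I → Q.Elt} {x : K → Q.Obj} {z w : Q.Obj}
    {T : Tree Q.sig F x z} {L : Type} [Finite L] {lab : L → K}
    {f : Q.Hom L (fun p => x (lab p)) z} (h : Q.Composes T lab f) (a : z ⟶ w) :
    Q.Composes (T.post a) lab (Q.post f a) := by
  induction h with
  | leaf k b => rw [ι_post]; exact Composes.leaf _ _
  | node i b ch lab f h ih => rw [post_post]; exact Composes.node _ _ _ _ _ h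
  | perm T e lab f h ih => rw [post_perm]; exact Composes.perm _ _ _ _ (ih a)

theorem Composes.graft {I K K' : Type} {F : I → Q.Elt} {x : K → Q.Obj} {x' : K' → Q.Obj}
    {t : ∀ k, Tree Q.sig F x' (x k)} {z : Q.Obj}
    {T : Tree Q.sig F x z} {L : Type} [Finite L] {lab : L → K}
    {f : Q.Hom L (fun p => x (lab p)) z} (h : Q.Composes T lab f)
    {L' : L → Type} [∀ l, Finite (L' l)] {lab' : ∀ l, L' l → K'}
    {g : ∀ l, Q.Hom (L' l) (fun p => x' (lab' l p)) (x (lab l))}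
    (hg : ∀ l, Q.Composes (t (lab l)) (lab' l) (g l)) :
    Q.Composes (T.graft t) (fun p : Σ l, L' l => lab' p.1 p.2) (Q.comp f g) := by
  induction h with
  | leaf k a =>
    have h1 := Composes.perm _ (punitSigma (L' ⟨⟩)).symm
      (fun p : Σ l, L' l => lab' p.1 p.2) _ ((hg ⟨⟩).post a)
    have h2 : Q.perm (x := fun p : Σ l, L' l => x' (lab' p.1 p.2)) (punitSigma (L' ⟨⟩)).symm
        (Q.post (g ⟨⟩) a) = Q.comp (Q.ι a) g := by
      unfold SymMulticat.post
      exact (Q.perm_perm (punitSigma (L' ⟨⟩)) (punitSigma (L' ⟨⟩)).symm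
        (x := fun p : Σ l, L' l => x' (lab' p.1 p.2)) _).trans (Q.perm_refl _)
    exact h2 ▸ h1
  | node i a ch lab f h ih =>
    have h1 := Composes.node i a (fun j => (ch j).graft t) _ _
      (fun j => ih j (lab' := fun l => lab' ⟨j, l⟩) (g := fun l => g ⟨j, l⟩)
        (fun l => hg ⟨j, l⟩))
    rw [← post_comp]
    have h3 := Composes.perm _ (Equiv.sigmaAssoc fun j l => L' ⟨j, l⟩).symm
      (fun p : Σ l, L' l => lab' p.1 p.2) _ h1
    have h2 := congrArg (fun q => Q.post q a) (Q.assoc (F i).hom f (fun j l => g ⟨j, l⟩))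
    have h4 := h2.symm.trans (post_perm (Equiv.sigmaAssoc fun j l => L' ⟨j, l⟩)
      (x := fun p => x' (lab' ⟨p.1, p.2.1⟩ p.2.2)) _ a)
    have h5 := (congrArg (Q.perm (x := fun p : Σ l, L' l => x' (lab' p.1 p.2))
      (Equiv.sigmaAssoc fun j l => L' ⟨j, l⟩).symm) h4).trans
      ((Q.perm_perm (x := fun p : Σ l, L' l => x' (lab' p.1 p.2)) _
        (Equiv.sigmaAssoc fun j l => L' ⟨j, l⟩).symm _).trans (Q.perm_refl _))
    exact h5 ▸ h3
  | perm T e lab f h ih =>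
    rw [Q.perm_comp]
    exact Composes.perm _ _ _ _ (ih (g := fun l => g (e l)) (fun l => hg (e l)))

theorem Composes.subst {I J K : Type} {F : I → Q.Elt} {G : J → Q.Elt} {x : K → Q.Obj}
    {U : ∀ i, Tree Q.sig G (F i).src (F i).tgt}
    (hU : ∀ i, Q.Composes (U i) (fun p => p) (F i).hom) {z : Q.Obj}
    {T : Tree Q.sig F x z} {L : Type} [Finite L] {lab : L → K}
    {f : Q.Hom L (fun p => x (lab p)) z} (h : Q.Composes T lab f) :
    Q.Composes (T.subst U) lab f := by
  induction h with
  | leaf k b => exact Composes.leaf _ _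
  | node i b ch lab f h ih => exact ((hU i).graft ih).post b
  | perm T e lab f h ih => exact Composes.perm _ _ _ _ ih

theorem Composes.rename {I J K : Type} {G : J → Q.Elt} {x : K → Q.Obj} (h : I → J) {z : Q.Obj}
    {T : Tree Q.sig (fun i => G (h i)) x z} {L : Type} [Finite L] {lab : L → K}
    {f : Q.Hom L (fun p => x (lab p)) z} (hT : Q.Composes T lab f) :
    Q.Composes (T.rename h) lab f := by
  induction hT with
  | leaf k b => exact Composes.leaf _ _
  | node i b ch lab f _ ih => exact Composes.node (h i) b _ lab f ih
  | perm T e lab f _ ih => exact Composes.perm _ _ _ _ ih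

theorem Composes.leafSum {I K : Type} {F : I → Q.Elt} {x : K → Q.Obj} {z : Q.Obj}
    {T : Tree Q.sig F x z} {L : Type} [Finite L] {lab : L → K}
    {f : Q.Hom L (fun p => x (lab p)) z} (h : Q.Composes T lab f) (w : K → ℕ) :
    T.leafSum w = ∑ᶠ p, w (lab p) := by
  induction h with
  | leaf k b =>
    rw [finsum_eq_sum_of_fintype]
    simp [Tree.leafSum]
  | @node z i b ch L _ lab f h ih =>
    have := fun j => Fintype.ofFinite (L j)
    rw [finsum_eq_sum_of_fintype, Fintype.sum_sigma]
    refine Finset.sum_congr rfl fun j _ => ?_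
    rw [ih, finsum_eq_sum_of_fintype]
  | perm T e lab f h ih => rw [ih]; exact finsum_comp_equiv e (f := fun p => w (lab p))

/-- The tree with one node given by a morphism of the category of elements. -/
def EltHom.tree {g g' : Q.Elt} (α : EltHom g g') :
    Tree Q.sig (fun _ : PUnit => g) g'.src g'.tgt :=
  Tree.node ⟨⟩ α.tgtMap (fun j => Tree.leaf (α.σ j) (α.srcMap j))

theorem EltHom.tree_composes {g g' : Q.Elt} (α : EltHom g g') :
    Q.Composes α.tree (fun p => p) g'.hom := by
  have h := Composes.node (Q := Q) (F := fun _ : PUnit => g) (x := g'.src) ⟨⟩ α.tgtMap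
    (fun j => Tree.leaf (α.σ j) (α.srcMap j)) _ _ (fun j => Composes.leaf _ _)
  have h' := Composes.perm _ ((sigmaPUnit (Fin g.ar)).trans α.σ) (fun p => p) _ h
  have e : Q.perm (x := g'.src) ((sigmaPUnit (Fin g.ar)).trans α.σ)
      (Q.post (Q.comp g.hom fun j => Q.ι (α.srcMap j)) α.tgtMap) = g'.hom := by
    rw [← α.eq]
    exact (Q.perm_perm (sigmaPUnit (Fin g.ar)) α.σ _).symm.trans
      (congrArg (Q.perm α.σ) (post_perm (x := fun i => g'.src (α.σ i)) (sigmaPUnit (Fin g.ar))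
        (Q.comp g.hom fun j => Q.ι (α.srcMap j)) α.tgtMap).symm)
  exact e ▸ h'

variable (Q)

/-- The arrows of the slice `Q⁺` with sources `F i` and target `f`: trees whose nodes are the
arrows `F i`, each index `i` naming exactly one node, and whose leaves are named
by the sources of `f`, such that composing along the tree yields `f` (in particular each
source of `f` names exactly one leaf). -/
def SliceHom (I : Type) (F : I → Q.Elt) (f : Q.Elt) : Type :=
  {T : Tree Q.sig F f.src f.tgt //
    Function.Bijective T.nodeName ∧ Q.Composes T (fun p => p) f.hom}

variable {Q}

theorem nodeName_subst_bijective {I : Type} {J : I → Type} {F : I → Q.Elt}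
    {G : ∀ i, J i → Q.Elt} {f : Q.Elt} (T : Q.SliceHom I F f)
    (U : ∀ i, Q.SliceHom (J i) (G i) (F i)) :
    Function.Bijective (T.1.subst (G := fun p : Σ i, J i => G p.1 p.2)
      (fun i => (U i).1.rename (Sigma.mk i))).nodeName := by
  classical
  rw [Tree.nodeName_bijective_iff]
  rintro ⟨i, j⟩
  rw [Tree.nodeSum_subst]
  · simp only [Tree.nodeSum_rename]
    refine Eq.trans ?_ ((Tree.nodeName_bijective_iff T.1).1 T.2.1 i)
    congr 1
    funext i'
    split_ifs with h
    · subst h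
      refine Eq.trans ?_ ((Tree.nodeName_bijective_iff (U i').1).1 (U i').2.1 j)
      congr 1
      funext j'
      simp
    · rw [← Tree.sum_nodes]
      refine Finset.sum_eq_zero fun N _ => if_neg fun e => h ?_
      exact congrArg Sigma.fst e
  · intro i v
    rw [Tree.leafSum_rename, (U i).2.2.leafSum, finsum_eq_sum_of_fintype]

variable (Q)

/-- The slice `Q⁺` of a symmetric multicategory. Its objects are the arrows of `Q`, forming the
category of elements; its arrows are the ways of composing arrows of `Q`. -/
def slice : SymMulticat where
  Obj := Q.Elt
  Hom I _ F f := Q.SliceHom I F f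
  ι {g g'} (α : EltHom g g') := ⟨α.tree, by
      rw [Tree.nodeName_bijective_iff]
      rintro ⟨⟩
      simp [EltHom.tree, Tree.nodeSum], α.tree_composes⟩
  comp T U := ⟨T.1.subst (fun i => (U i).1.rename (Sigma.mk i)),
    nodeName_subst_bijective T U,
    T.2.2.subst (fun i => (U i).2.2.rename (Sigma.mk i))⟩
  perm e _ _ T := ⟨T.1.rename e, by
      classical
      have h := T.2.1
      rw [Tree.nodeName_bijective_iff] at h ⊢
      intro j
      rw [Tree.nodeSum_rename]
      refine Eq.trans ?_ (h (e.symm j))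
      simp only [Equiv.eq_symm_apply], T.2.2.rename e⟩
  id_comp {I _ x y} T := Subtype.ext (by
    let m : I → Σ _ : PUnit.{1}, I := fun i => ⟨⟨⟩, i⟩
    let G : (Σ _ : PUnit.{1}, I) → Q.sig.Arr := fun p => x p.2
    let R : Tree Q.sig G y.src y.tgt := Tree.rename (S := Q.sig) (G := G) m T.1
    refine (Tree.subst_rename (S := Q.sig) (H := x) (punitSigma I) (fun _ : PUnit => R)
      (EltHom.tree (𝟙 y : EltHom y y))).trans ?_
    refine (Tree.corolla_subst (S := Q.sig) (F := fun _ : PUnit.{1} => y)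
      (fun _ => Tree.rename (S := Q.sig) (G := x) (punitSigma I) R) ⟨⟩).trans ?_
    exact (Tree.rename_rename (S := Q.sig) (H := x) m (punitSigma I) T.1).trans
      (Tree.rename_id T.1))
  comp_id {I _ x y} T := Subtype.ext (by
    let G : (Σ _ : I, PUnit.{1}) → Q.sig.Arr := fun p => x p.1
    let R : ∀ i, Tree Q.sig G (x i).src (x i).tgt := fun i =>
      Tree.rename (S := Q.sig) (G := G) (fun j => ⟨i, j⟩) (EltHom.tree (𝟙 (x i) : EltHom _ _))
    exact (Tree.subst_rename (S := Q.sig) (H := x) (sigmaPUnit I) R T.1).trans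
      (Tree.subst_corolla (S := Q.sig) T.1))
  assoc {I _ J _ K _ x y w v} T U V := Subtype.ext (by
    let H : (Σ i, Σ j, K i j) → Q.sig.Arr := fun p => v p.1 p.2.1 p.2.2
    let H' : (Σ p : Σ i, J i, K p.1 p.2) → Q.sig.Arr := fun p => v p.1.1 p.1.2 p.2
    refine (Tree.subst_rename (S := Q.sig) (H := H) (Equiv.sigmaAssoc K) _ _).trans ?_
    refine (Tree.subst_subst (S := Q.sig) _ _ T.1).trans ?_
    congr 1
    funext i
    refine (Tree.rename_subst (S := Q.sig) (G := fun p : Σ i, J i => w p.1 p.2)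
      (fun j => ⟨i, j⟩) _ (U i).1).trans ?_
    refine Eq.trans ?_ (Tree.subst_rename (S := Q.sig) (H := H) (Sigma.mk i) _ (U i).1).symm
    congr 1
    funext j
    exact (Tree.rename_rename (S := Q.sig) (H := H) (fun k => (⟨⟨i, j⟩, k⟩ : Σ p : Σ i, J i, K p.1 p.2))
      (Equiv.sigmaAssoc K) (V i j).1).trans
      (Tree.rename_rename (S := Q.sig) (H := H)
      (fun k => (⟨j, k⟩ : Σ j, K i j)) (fun p => (⟨i, p⟩ : Σ i, Σ j, K i j)) (V i j).1).symm)
  perm_refl T := Subtype.ext (Tree.rename_id T.1)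
  perm_perm e e' _ _ T := Subtype.ext (Tree.rename_rename e e' T.1)
  perm_comp {I I' _ _} e {J _ x y w} T U := Subtype.ext (by
    let H : (Σ i, J i) → Q.sig.Arr := fun p => w p.1 p.2
    refine (Tree.rename_subst (S := Q.sig) e _ T.1).trans ?_
    refine Eq.trans ?_ (Tree.subst_rename (S := Q.sig) (H := H)
      (Equiv.sigmaCongrLeft e) _ T.1).symm
    congr 1
    funext i
    exact (Tree.rename_rename (S := Q.sig) (H := H) (fun j => (⟨i, j⟩ : Σ i, J (e i)))
      (Equiv.sigmaCongrLeft e) (U (e i)).1).symm)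
  comp_perm {I _ J J' _ _} e {x y w} T U := Subtype.ext (by
    let H : (Σ i, J' i) → Q.sig.Arr := fun p => w p.1 p.2
    refine Eq.trans ?_ (Tree.subst_rename (S := Q.sig) (H := H)
      (Equiv.sigmaCongrRight e) _ T.1).symm
    refine congrArg (fun V => Tree.subst (S := Q.sig) (G := H) V T.1) (funext fun i => ?_)
    exact (Tree.rename_rename (S := Q.sig) (H := H) (e i) (Sigma.mk i) (U i).1).trans
      (Tree.rename_rename (S := Q.sig) (H := H) (fun j => (⟨i, j⟩ : Σ i, J i))
      (Equiv.sigmaCongrRight e) (U i).1).symm)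
  ι_comp a b := Subtype.ext rfl

end

end SymMulticat

/-! ### Generalised multicategories -/

/-- A generalised multicategory.

The amalgamating maps `ψ` and `φ` of a composite `f ∘_p g` are the two components of the
bijection `amalg f p g h`. In the coherence laws, numbers of sources of equal arrows are
compared as natural numbers. -/
structure GenMulticat where
  /-- The objects. -/
  Obj : Type
  /-- The arrows. -/
  Arr : Type
  /-- The number of sources of an arrow. -/
  ar : Arr → ℕ
  /-- The list of sources of an arrow. -/
  src : ∀ f : Arr, Fin (ar f) → Obj
  /-- The target of an arrow. -/
  tgt : Arr → Obj
  /-- The composite `f ∘_p g`. -/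
  comp : ∀ (f : Arr) (p : Fin (ar f)) (g : Arr), tgt g = src f p → Arr
  tgt_comp : ∀ f p g h, tgt (comp f p g h) = tgt f
  /-- The amalgamating maps. -/
  amalg : ∀ f p g h, {q : Fin (ar f) // q ≠ p} ⊕ Fin (ar g) ≃ Fin (ar (comp f p g h))
  src_ψ : ∀ f p g h q, src (comp f p g h) (amalg f p g h (Sum.inl q)) = src f q
  src_φ : ∀ f p g h r, src (comp f p g h) (amalg f p g h (Sum.inr r)) = src g r
  /-- The identities. -/
  one : Obj → Arr
  ar_one : ∀ x, ar (one x) = 1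
  src_one : ∀ x p, src (one x) p = x
  tgt_one : ∀ x, tgt (one x) = x
  /-- Left unit law. -/
  one_comp : ∀ y p f h, comp (one y) p f h = f
  one_comp_φ : ∀ y p f h r, (amalg (one y) p f h (Sum.inr r) : ℕ) = r
  /-- Right unit law. -/
  comp_one : ∀ f p x h, comp f p (one x) h = f
  comp_one_ψ : ∀ f p x h q, (amalg f p (one x) h (Sum.inl q) : ℕ) = q.1
  comp_one_φ : ∀ f p x h r, (amalg f p (one x) h (Sum.inr r) : ℕ) = p
  /-- Associativity. -/
  assoc : ∀ f p g h q k h₁ h₂ h₃,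
    comp (comp f p g h) (amalg f p g h (Sum.inr q)) k h₁ = comp f p (comp g q k h₂) h₃
  assoc_f : ∀ f p g h q k h₁ h₂ h₃ (r : Fin (ar f)) (hr : r ≠ p) hr',
    (amalg (comp f p g h) (amalg f p g h (Sum.inr q)) k h₁
      (Sum.inl ⟨amalg f p g h (Sum.inl ⟨r, hr⟩), hr'⟩) : ℕ) =
    amalg f p (comp g q k h₂) h₃ (Sum.inl ⟨r, hr⟩)
  assoc_g : ∀ f p g h q k h₁ h₂ h₃ (r : Fin (ar g)) (hr : r ≠ q) hr',
    (amalg (comp f p g h) (amalg f p g h (Sum.inr q)) k h₁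
      (Sum.inl ⟨amalg f p g h (Sum.inr r), hr'⟩) : ℕ) =
    amalg f p (comp g q k h₂) h₃ (Sum.inr (amalg g q k h₂ (Sum.inl ⟨r, hr⟩)))
  assoc_h : ∀ f p g h q k h₁ h₂ h₃ (r : Fin (ar k)),
    (amalg (comp f p g h) (amalg f p g h (Sum.inr q)) k h₁ (Sum.inr r) : ℕ) =
    amalg f p (comp g q k h₂) h₃ (Sum.inr (amalg g q k h₂ (Sum.inr r)))
  /-- Commutativity. -/
  comm : ∀ f p q g k h₁ h₂ (hqp : q ≠ p) (hpq : p ≠ q) h₃ h₄,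
    comp (comp f p g h₁) (amalg f p g h₁ (Sum.inl ⟨q, hqp⟩)) k h₃ =
    comp (comp f q k h₂) (amalg f q k h₂ (Sum.inl ⟨p, hpq⟩)) g h₄
  comm_f : ∀ f p q g k h₁ h₂ (hqp : q ≠ p) (hpq : p ≠ q) h₃ h₄ (r : Fin (ar f))
    (hrp : r ≠ p) (hrq : r ≠ q) hr₁ hr₂,
    (amalg (comp f p g h₁) (amalg f p g h₁ (Sum.inl ⟨q, hqp⟩)) k h₃
      (Sum.inl ⟨amalg f p g h₁ (Sum.inl ⟨r, hrp⟩), hr₁⟩) : ℕ) =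
    amalg (comp f q k h₂) (amalg f q k h₂ (Sum.inl ⟨p, hpq⟩)) g h₄
      (Sum.inl ⟨amalg f q k h₂ (Sum.inl ⟨r, hrq⟩), hr₂⟩)
  comm_g : ∀ f p q g k h₁ h₂ (hqp : q ≠ p) (hpq : p ≠ q) h₃ h₄ (r : Fin (ar g)) hr₁,
    (amalg (comp f p g h₁) (amalg f p g h₁ (Sum.inl ⟨q, hqp⟩)) k h₃
      (Sum.inl ⟨amalg f p g h₁ (Sum.inr r), hr₁⟩) : ℕ) =
    amalg (comp f q k h₂) (amalg f q k h₂ (Sum.inl ⟨p, hpq⟩)) g h₄ (Sum.inr r)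
  comm_h : ∀ f p q g k h₁ h₂ (hqp : q ≠ p) (hpq : p ≠ q) h₃ h₄ (r : Fin (ar k)) hr₂,
    (amalg (comp f p g h₁) (amalg f p g h₁ (Sum.inl ⟨q, hqp⟩)) k h₃ (Sum.inr r) : ℕ) =
    amalg (comp f q k h₂) (amalg f q k h₂ (Sum.inl ⟨p, hpq⟩)) g h₄
      (Sum.inl ⟨amalg f q k h₂ (Sum.inr r), hr₂⟩)

namespace GenMulticat

section

variable (M : GenMulticat)

/-- An arrow of `M` with target `y` whose sources carry names in `K`; the object of each source is
determined by its name. -/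
structure Named {K : Type} (x : K → M.Obj) (y : M.Obj) where
  arr : M.Arr
  name : Fin (M.ar arr) → K
  src_eq : ∀ p, M.src arr p = x (name p)
  tgt_eq : M.tgt arr = y

variable {M}

namespace Named

theorem ext' {K : Type} {x : K → M.Obj} {y : M.Obj} {a b : M.Named x y} (h : a.arr = b.arr)
    (h' : ∀ (p : Fin (M.ar a.arr)) (q : Fin (M.ar b.arr)), (p : ℕ) = q → a.name p = b.name q) :
    a = b := by
  obtain ⟨f, n, hs, ht⟩ := a
  obtain ⟨f', n', hs', ht'⟩ := b
  obtain rfl : f = f' := h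
  obtain rfl : n = n' := funext fun p => h' p p rfl
  rfl

theorem name_congr {K : Type} {x : K → M.Obj} {y : M.Obj} {a b : M.Named x y} (h : a = b)
    (p : Fin (M.ar a.arr)) (q : Fin (M.ar b.arr)) (hpq : (p : ℕ) = q) : a.name p = b.name q := by
  subst h
  rw [Fin.ext hpq]

/-- Rename the sources. -/
@[reducible] def map {K K' : Type} {x : K → M.Obj} {x' : K' → M.Obj} {y : M.Obj} (h : K → K')
    (hx : ∀ k, x' (h k) = x k) (a : M.Named x y) : M.Named x' y where
  arr := a.arr
  name p := h (a.name p)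
  src_eq p := (a.src_eq p).trans (hx _).symm
  tgt_eq := a.tgt_eq

/-- Change the target along an equality. -/
@[reducible] def cast {K : Type} {x : K → M.Obj} {y y' : M.Obj} (a : M.Named x y) (h : y = y') :
    M.Named x y' where
  arr := a.arr
  name := a.name
  src_eq := a.src_eq
  tgt_eq := a.tgt_eq.trans h

/-- The identity arrow of `x k`, its source being named `k`. -/
@[reducible] def unit {K : Type} {x : K → M.Obj} (k : K) : M.Named x (x k) where
  arr := M.one (x k)
  name _ := k
  src_eq p := M.src_one _ p
  tgt_eq := M.tgt_one _

/-- The arrow `f`, its sources being named by themselves. -/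
@[reducible] def of (f : M.Arr) : M.Named (M.src f) (M.tgt f) := ⟨f, fun p => p, fun _ => rfl, rfl⟩

/-- The composite of `a` at its source `p` with `b`; the sources keep their names. -/
@[reducible] def plug {K : Type} {x : K → M.Obj} {y z : M.Obj} (a : M.Named x y) (p : Fin (M.ar a.arr))
    (b : M.Named x z) (h : z = M.src a.arr p) : M.Named x y where
  arr := M.comp a.arr p b.arr (b.tgt_eq.trans h)
  name c := Sum.elim (fun q => a.name q.1) b.name
    ((M.amalg a.arr p b.arr (b.tgt_eq.trans h)).symm c)
  src_eq c := by
    obtain ⟨c, rfl⟩ := (M.amalg a.arr p b.arr (b.tgt_eq.trans h)).surjective c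
    rw [Equiv.symm_apply_apply]
    rcases c with q | r
    · rw [M.src_ψ]; exact a.src_eq _
    · rw [M.src_φ]; exact b.src_eq _
  tgt_eq := (M.tgt_comp _ _ _ _).trans a.tgt_eq

variable {K : Type} {x : K → M.Obj} {y z : M.Obj}

theorem plug_ψ (a : M.Named x y) (p : Fin (M.ar a.arr)) (b : M.Named x z)
    (h : z = M.src a.arr p) (q) :
    (a.plug p b h).name (M.amalg a.arr p b.arr (b.tgt_eq.trans h) (Sum.inl q)) = a.name q.1 := by
  simp

theorem plug_φ (a : M.Named x y) (p : Fin (M.ar a.arr)) (b : M.Named x z)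
    (h : z = M.src a.arr p) (r) :
    (a.plug p b h).name (M.amalg a.arr p b.arr (b.tgt_eq.trans h) (Sum.inr r)) = b.name r := by
  simp

theorem map_plug {K' : Type} {x' : K' → M.Obj} (h : K → K') (hx : ∀ k, x' (h k) = x k)
    (a : M.Named x y) (p : Fin (M.ar a.arr)) (b : M.Named x z) (e : z = M.src a.arr p) :
    (a.plug p b e).map h hx = (a.map h hx).plug p (b.map h hx) e := by
  refine ext' rfl fun c c' hc => ?_
  obtain rfl : c = c' := Fin.ext hc
  obtain ⟨c, rfl⟩ := (M.amalg a.arr p b.arr (b.tgt_eq.trans e)).surjective c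
  rcases c with q | r
  · exact (congrArg h (a.plug_ψ p b e q)).trans
      (plug_ψ (a.map h hx) p (b.map h hx) e q).symm
  · exact (congrArg h (a.plug_φ p b e r)).trans
      (plug_φ (a.map h hx) p (b.map h hx) e r).symm

theorem plug_assoc {w : M.Obj} (a : M.Named x y) (p : Fin (M.ar a.arr)) (b : M.Named x z)
    (e : z = M.src a.arr p) (q : Fin (M.ar b.arr)) (c : M.Named x w)
    (e' : w = M.src b.arr q) :
    (a.plug p b e).plug (M.amalg a.arr p b.arr (b.tgt_eq.trans e) (Sum.inr q)) c
      (e'.trans (M.src_φ _ _ _ _ _).symm) = a.plug p (b.plug q c e') e := by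
  refine ext' (M.assoc _ _ _ _ _ _ _ _ _) fun d d' hd => ?_
  obtain ⟨d, rfl⟩ := (M.amalg (a.plug p b e).arr _ c.arr
    (c.tgt_eq.trans (e'.trans (M.src_φ _ _ _ _ _).symm))).surjective d
  rcases d with ⟨d, hne⟩ | r
  · rw [plug_ψ]
    obtain ⟨d, rfl⟩ := (M.amalg a.arr p b.arr (b.tgt_eq.trans e)).surjective d
    rcases d with ⟨d, hd'⟩ | r
    · rw [plug_ψ]
      have := M.assoc_f a.arr p b.arr (b.tgt_eq.trans e) q c.arr
        (c.tgt_eq.trans (e'.trans (M.src_φ _ _ _ _ _).symm)) (c.tgt_eq.trans e')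
        ((b.plug q c e').tgt_eq.trans e) d hd' hne
      obtain rfl := Fin.ext (hd.symm.trans this)
      exact (plug_ψ a p (b.plug q c e') e ⟨d, hd'⟩).symm
    · rw [plug_φ]
      have hrq : r ≠ q := fun h => hne (by rw [h])
      have := M.assoc_g a.arr p b.arr (b.tgt_eq.trans e) q c.arr
        (c.tgt_eq.trans (e'.trans (M.src_φ _ _ _ _ _).symm)) (c.tgt_eq.trans e')
        ((b.plug q c e').tgt_eq.trans e) r hrq hne
      obtain rfl := Fin.ext (hd.symm.trans this)
      exact ((plug_φ a p (b.plug q c e') e _).trans (plug_ψ b q c e' ⟨r, hrq⟩)).symm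
  · rw [plug_φ]
    have := M.assoc_h a.arr p b.arr (b.tgt_eq.trans e) q c.arr
      (c.tgt_eq.trans (e'.trans (M.src_φ _ _ _ _ _).symm)) (c.tgt_eq.trans e')
      ((b.plug q c e').tgt_eq.trans e) r
    obtain rfl := Fin.ext (hd.symm.trans this)
    exact ((plug_φ a p (b.plug q c e') e _).trans (plug_φ b q c e' r)).symm

theorem plug_comm {w : M.Obj} (a : M.Named x y) (p q : Fin (M.ar a.arr)) (hqp : q ≠ p)
    (b : M.Named x z) (e : z = M.src a.arr p) (c : M.Named x w) (e' : w = M.src a.arr q) :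
    (a.plug p b e).plug (M.amalg a.arr p b.arr (b.tgt_eq.trans e) (Sum.inl ⟨q, hqp⟩)) c
      (e'.trans (M.src_ψ _ _ _ _ ⟨q, hqp⟩).symm) =
    (a.plug q c e').plug (M.amalg a.arr q c.arr (c.tgt_eq.trans e') (Sum.inl ⟨p, hqp.symm⟩)) b
      (e.trans (M.src_ψ a.arr q c.arr (c.tgt_eq.trans e') ⟨p, hqp.symm⟩).symm) := by
  refine ext' (M.comm _ _ _ _ _ _ _ _ _ _ _) fun d d' hd => ?_
  obtain ⟨d, rfl⟩ := (M.amalg (a.plug p b e).arr _ c.arr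
    (c.tgt_eq.trans (e'.trans (M.src_ψ _ _ _ _ ⟨q, hqp⟩).symm))).surjective d
  have hinj := (M.amalg a.arr q c.arr (c.tgt_eq.trans e')).injective
  rcases d with ⟨d, hne⟩ | r
  · rw [plug_ψ]
    obtain ⟨d, rfl⟩ := (M.amalg a.arr p b.arr (b.tgt_eq.trans e)).surjective d
    rcases d with ⟨d, hd'⟩ | r
    · rw [plug_ψ]
      have hdq : d ≠ q := fun h => hne (by subst h; rfl)
      have hr2 : M.amalg a.arr q c.arr (c.tgt_eq.trans e') (Sum.inl ⟨d, hdq⟩) ≠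
          M.amalg a.arr q c.arr (c.tgt_eq.trans e') (Sum.inl ⟨p, hqp.symm⟩) := fun h =>
        hd' (congrArg Subtype.val (Sum.inl_injective (hinj h)))
      have := M.comm_f a.arr p q b.arr c.arr (b.tgt_eq.trans e) (c.tgt_eq.trans e') hqp hqp.symm
        (c.tgt_eq.trans (e'.trans (M.src_ψ _ _ _ _ ⟨q, hqp⟩).symm))
        (b.tgt_eq.trans (e.trans (M.src_ψ _ _ _ _ ⟨p, hqp.symm⟩).symm)) d hd' hdq hne hr2
      obtain rfl := Fin.ext (hd.symm.trans this)
      exact ((plug_ψ (a.plug q c e') _ b _ ⟨_, hr2⟩).trans (plug_ψ a q c e' ⟨d, hdq⟩)).symm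
    · rw [plug_φ]
      have := M.comm_g a.arr p q b.arr c.arr (b.tgt_eq.trans e) (c.tgt_eq.trans e') hqp hqp.symm
        (c.tgt_eq.trans (e'.trans (M.src_ψ _ _ _ _ ⟨q, hqp⟩).symm))
        (b.tgt_eq.trans (e.trans (M.src_ψ _ _ _ _ ⟨p, hqp.symm⟩).symm)) r hne
      obtain rfl := Fin.ext (hd.symm.trans this)
      exact (plug_φ (a.plug q c e') _ b _ r).symm
  · rw [plug_φ]
    have hr2 : M.amalg a.arr q c.arr (c.tgt_eq.trans e') (Sum.inr r) ≠
        M.amalg a.arr q c.arr (c.tgt_eq.trans e') (Sum.inl ⟨p, hqp.symm⟩) := fun h => by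
      simpa using hinj h
    have := M.comm_h a.arr p q b.arr c.arr (b.tgt_eq.trans e) (c.tgt_eq.trans e') hqp hqp.symm
      (c.tgt_eq.trans (e'.trans (M.src_ψ _ _ _ _ ⟨q, hqp⟩).symm))
      (b.tgt_eq.trans (e.trans (M.src_ψ _ _ _ _ ⟨p, hqp.symm⟩).symm)) r hr2
    obtain rfl := Fin.ext (hd.symm.trans this)
    exact ((plug_ψ (a.plug q c e') _ b _ ⟨_, hr2⟩).trans (plug_φ a q c e' r)).symm

theorem plug_unit (a : M.Named x y) (p : Fin (M.ar a.arr)) (k : K) (hk : a.name p = k) :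
    a.plug p (unit k) (by rw [← hk, a.src_eq]) = a := by
  refine ext' (M.comp_one _ _ _ _) fun d d' hd => ?_
  obtain ⟨d, rfl⟩ := (M.amalg a.arr p (unit (x := x) k).arr
    ((M.tgt_one _).trans (by rw [← hk, a.src_eq]))).surjective d
  rcases d with d | r
  · obtain rfl := Fin.ext (hd.symm.trans (M.comp_one_ψ _ _ _ _ _))
    exact plug_ψ a p (unit k) _ d
  · obtain rfl := Fin.ext (hd.symm.trans (M.comp_one_φ _ _ _ _ _))
    exact (plug_φ a d' (unit k) _ r).trans hk.symm

theorem unit_plug (k : K) (p) (b : M.Named x (x k)) :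
    (unit (M := M) (x := x) k).plug p b (M.src_one _ _).symm = b := by
  refine ext' (M.one_comp _ _ _ _) fun d d' hd => ?_
  obtain ⟨d, rfl⟩ := (M.amalg (unit (x := x) k).arr p b.arr
    (b.tgt_eq.trans (M.src_one _ _).symm)).surjective d
  have hs : Subsingleton (Fin (M.ar (M.one (x k)))) := by
    rw [M.ar_one]; infer_instance
  rcases d with d | r
  · exact absurd (hs.elim _ _) d.2
  · obtain rfl := Fin.ext (hd.symm.trans (M.one_comp_φ _ _ _ _ _))
    exact plug_φ (unit k) p b _ d'

theorem plug_sum (a : M.Named x y) (p : Fin (M.ar a.arr)) (b : M.Named x z)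
    (h : z = M.src a.arr p) (w : K → ℕ) :
    ∑ c, w ((a.plug p b h).name c) + w (a.name p) =
      ∑ q, w (a.name q) + ∑ r, w (b.name r) := by
  have h1 : ∑ c, w ((a.plug p b h).name c) =
      ∑ q : {q // q ≠ p}, w (a.name q.1) + ∑ r, w (b.name r) := by
    rw [← (M.amalg a.arr p b.arr (b.tgt_eq.trans h)).sum_comp
      (fun c => w ((a.plug p b h).name c)), Fintype.sum_sum_type]
    simp only [Equiv.symm_apply_apply, Sum.elim_inl, Sum.elim_inr]
  have h2 : ∑ q, w (a.name q) = ∑ q : {q // q ≠ p}, w (a.name q.1) + w (a.name p) := by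
    rw [← Finset.sum_erase_add _ _ (Finset.mem_univ p)]
    congr 1
    exact Finset.sum_subtype _ (by simp) _
  omega

end Named

/-- `Reduces t s r`: the arrow `r` is obtained from `s` by composing, one after
another, the arrow `t k` at each source named `inl k`; the sources named `inr k'` are
left unchanged. -/
inductive Reduces {K K' : Type} {x : K → M.Obj} {x' : K' → M.Obj} (t : ∀ k, M.Named x' (x k))
    {y : M.Obj} : M.Named (Sum.elim x x') y → M.Named x' y → Prop
  | done (r : M.Named x' y) : Reduces t (r.map Sum.inr (Sum.elim_inr x x')) r
  | step (s : M.Named (Sum.elim x x') y) (p : Fin (M.ar s.arr)) (k : K)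
      (h : s.name p = Sum.inl k) (r : M.Named x' y) :
      Reduces t (s.plug p ((t k).map Sum.inr (Sum.elim_inr x x')) (by rw [s.src_eq, h]; rfl)) r →
      Reduces t s r

namespace Reduces

variable {K K' : Type} {x : K → M.Obj} {x' : K' → M.Obj} {t : ∀ k, M.Named x' (x k)} {y : M.Obj}

theorem exists_reduces (t : ∀ k, M.Named x' (x k)) (s : M.Named (Sum.elim x x') y) :
    ∃ r, Reduces t s r := by
  generalize hn : ∑ p, (Sum.elim (fun _ => 1) (fun _ => 0) (s.name p) : ℕ) = n
  induction n generalizing s with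
  | zero =>
    have h : ∀ p, ∃ k', s.name p = Sum.inr k' := fun p => by
      have := (Finset.sum_eq_zero_iff.1 hn) p (Finset.mem_univ p)
      rcases hs : s.name p with k | k'
      · simp [hs] at this
      · exact ⟨k', rfl⟩
    choose n hn using h
    refine ⟨⟨s.arr, n, fun p => by rw [s.src_eq, hn]; rfl, s.tgt_eq⟩, ?_⟩
    have : s = Named.map (x := x') Sum.inr (Sum.elim_inr x x')
        ⟨s.arr, n, fun p => by rw [s.src_eq, hn]; rfl, s.tgt_eq⟩ :=
      Named.ext' rfl fun p q h => by
        obtain rfl := Fin.ext h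
        exact hn p
    conv => enter [2]; rw [this]
    exact Reduces.done _
  | succ n ih =>
    obtain ⟨p, hp⟩ : ∃ p, (Sum.elim (fun _ => 1) (fun _ => 0) (s.name p) : ℕ) ≠ 0 := by
      by_contra! h
      simp [h] at hn
    rcases hs : s.name p with k | k'
    · have e : x k = M.src s.arr p := by rw [s.src_eq, hs]; rfl
      obtain ⟨r, hr⟩ := ih (s.plug p ((t k).map Sum.inr (Sum.elim_inr x x')) e) (by
        have := s.plug_sum p ((t k).map Sum.inr (Sum.elim_inr x x')) e
          (Sum.elim (fun _ => 1) (fun _ => 0))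
        simp only [hn, hs] at this
        simpa using this)
      exact ⟨r, Reduces.step s p k hs r hr⟩
    · simp [hs] at hp

theorem any_step {s : M.Named (Sum.elim x x') y} {r : M.Named x' y} (h : Reduces t s r)
    (p : Fin (M.ar s.arr)) (k : K) (hk : s.name p = Sum.inl k) (e : x k = M.src s.arr p) :
    Reduces t (s.plug p ((t k).map Sum.inr (Sum.elim_inr x x')) e) r := by
  induction h with
  | done r => simp at hk
  | step s q l hl r h ih =>
    have e' : x l = M.src s.arr q := by rw [s.src_eq, hl]; rfl
    by_cases hpq : p = q
    · subst hpq
      obtain rfl : k = l := Sum.inl_injective (hk.symm.trans hl)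
      exact h
    · have h1 := ih (M.amalg _ _ _ (((t l).map Sum.inr (Sum.elim_inr x x')).tgt_eq.trans e')
        (Sum.inl ⟨p, hpq⟩)) ((Named.plug_ψ _ _ _ _ _).trans hk)
        (e.trans (M.src_ψ _ _ _ _ ⟨p, hpq⟩).symm)
      rw [Named.plug_comm s q p hpq ((t l).map Sum.inr (Sum.elim_inr x x')) e'
        ((t k).map Sum.inr (Sum.elim_inr x x')) e] at h1
      exact Reduces.step _ _ l ((Named.plug_ψ s p _ e ⟨q, Ne.symm hpq⟩).trans hl) _ h1

theorem unique {s : M.Named (Sum.elim x x') y} {r r' : M.Named x' y} (h : Reduces t s r)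
    (h' : Reduces t s r') : r = r' := by
  induction h with
  | done r =>
    generalize hs : r.map Sum.inr (Sum.elim_inr x x') = s at h'
    cases h' with
    | done =>
      have h0 := congrArg (fun s : M.Named (Sum.elim x x') y => s.arr) hs
      refine Named.ext' h0 fun p q hpq => ?_
      exact Sum.inr_injective (Named.name_congr hs p q hpq)
    | step _ p k h =>
      subst hs
      exact absurd h Sum.inr_ne_inl
  | step s p k hk r h ih => exact ih (h'.any_step p k hk _)

theorem of_map {K₁ : Type} {x₁ : K₁ → M.Obj} (m : K₁ → K) (hm : ∀ k, x (m k) = x₁ k)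
    {t₁ : ∀ k, M.Named x' (x₁ k)} (ht : ∀ k, t₁ k = (t (m k)).cast (hm k))
    {s : M.Named (Sum.elim x₁ x') y} {r : M.Named x' y} (h : Reduces t₁ s r) :
    Reduces t (s.map (Sum.map m id) (by rintro (k | k); exacts [hm k, rfl])) r := by
  induction h with
  | done r => exact Reduces.done r
  | step s p k hk r h ih =>
    rw [Named.map_plug] at ih
    refine Reduces.step (t := t) _ p (m k) (by simp [hk]) r ?_
    have : ∀ (a : M.Named x' (x₁ k)) (b : M.Named x' (x (m k))) (_ : a = b.cast (hm k))
        (s : M.Named (Sum.elim x x') y) (p : Fin (M.ar s.arr)) (e₁ : x₁ k = M.src s.arr p)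
        (e₂ : x (m k) = M.src s.arr p),
        s.plug p ((a.map Sum.inr (Sum.elim_inr x₁ x') : M.Named (Sum.elim x₁ x') (x₁ k)).map
          (Sum.map m id) (by rintro (k | k); exacts [hm k, rfl])) e₁ =
        s.plug p (b.map Sum.inr (Sum.elim_inr x x')) e₂ := by
      rintro a b rfl s p e₁ e₂
      rfl
    rw [this _ _ (ht k)] at ih
    exact ih

theorem plug_inner {s : M.Named (Sum.elim x x') y} {z : M.Obj} {b : M.Named (Sum.elim x x') z}
    {c : M.Named x' z} (hb : Reduces t b c) (p : Fin (M.ar s.arr)) (e : z = M.src s.arr p)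
    {r : M.Named x' y} (h : Reduces t (s.plug p (c.map Sum.inr (Sum.elim_inr x x')) e) r) :
    Reduces t (s.plug p b e) r := by
  induction hb with
  | done c => exact h
  | step b q k hk c hb ih =>
    have := ih h
    rw [← Named.plug_assoc] at this
    exact Reduces.step _ _ k ((Named.plug_φ s p b e q).trans hk) _ this

theorem sum {s : M.Named (Sum.elim x x') y} {r : M.Named x' y} (h : Reduces t s r) (w : K' → ℕ) :
    ∑ p, w (r.name p) =
      ∑ p, Sum.elim (fun k => ∑ q, w ((t k).name q)) w (s.name p) := by
  induction h with
  | done r => rfl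
  | step s p k hk r h ih =>
    rw [ih]
    have := s.plug_sum p ((t k).map Sum.inr (Sum.elim_inr x x')) (by rw [s.src_eq, hk]; rfl)
      (Sum.elim (fun k => ∑ q, w ((t k).name q)) w)
    simp only [hk] at this
    exact Nat.add_right_cancel this

end Reduces

namespace Named

section

variable {K K' K'' : Type} {x : K → M.Obj} {x' : K' → M.Obj} {x'' : K'' → M.Obj} {y : M.Obj}

/-- The composite of `a` with the arrow `t k` at each source named `k`, the composition being
performed at one source after another (the order does not matter). -/
noncomputable def bind (a : M.Named x y) (t : ∀ k, M.Named x' (x k)) : M.Named x' y :=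
  (Reduces.exists_reduces t (a.map Sum.inl (Sum.elim_inl x x'))).choose

theorem bind_spec (a : M.Named x y) (t : ∀ k, M.Named x' (x k)) :
    Reduces t (a.map Sum.inl (Sum.elim_inl x x')) (a.bind t) :=
  (Reduces.exists_reduces t (a.map Sum.inl (Sum.elim_inl x x'))).choose_spec

theorem bind_eq {a : M.Named x y} {t : ∀ k, M.Named x' (x k)} {r : M.Named x' y}
    (h : Reduces t (a.map Sum.inl (Sum.elim_inl x x')) r) : a.bind t = r :=
  (bind_spec a t).unique h

theorem bind_map {K₁ : Type} {x₁ : K₁ → M.Obj} (m : K₁ → K) (hm : ∀ k, x (m k) = x₁ k)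
    (a : M.Named x₁ y) (t : ∀ k, M.Named x' (x k)) :
    (a.map m hm).bind t = a.bind (fun k => (t (m k)).cast (hm k)) :=
  bind_eq ((bind_spec a (fun k => (t (m k)).cast (hm k))).of_map m hm (fun _ => rfl))

theorem unit_bind (k : K) (t : ∀ k, M.Named x' (x k)) : (unit k).bind t = t k := by
  refine bind_eq (Reduces.step _ ⟨0, ?_⟩ k rfl _ ?_)
  · rw [show (((unit k : M.Named x (x k)).map Sum.inl (Sum.elim_inl x x') :
      M.Named (Sum.elim x x') (x k))).arr = M.one (x k) from rfl, M.ar_one]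
    exact Nat.one_pos
  · have := unit_plug (M := M) (x := Sum.elim x x') (Sum.inl k)
      ⟨0, by rw [show (unit (M := M) (x := Sum.elim x x') (Sum.inl k)).arr = M.one (x k) from rfl,
        M.ar_one]; exact Nat.one_pos⟩ ((t k).map Sum.inr (Sum.elim_inr x x'))
    exact (congrArg (fun s => Reduces t s (t k)) this).mpr (Reduces.done _)

theorem bind_unit_map (m : K → K') (hm : ∀ k, x' (m k) = x k) (a : M.Named x y) :
    a.bind (fun k => (unit (m k)).cast (hm k)) = a.map m hm := by
  have key : ∀ {s : M.Named (Sum.elim x x') y} {r : M.Named x' y},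
      Reduces (fun k => (unit (m k)).cast (hm k)) s r →
      r = s.map (Sum.elim m id) (by rintro (k | k); exacts [hm k, rfl]) := by
    intro s r h
    induction h with
    | done r => rfl
    | step s p k hk r h ih =>
      rw [ih, map_plug]
      have h1 := plug_unit (s.map (Sum.elim m id) (by rintro (k | k); exacts [hm k, rfl]) :
        M.Named x' y) p (m k) (by simp [hk])
      have : ∀ (S : M.Named x' y) (p : Fin (M.ar S.arr)) (e₁ : x k = M.src S.arr p)
          (e₂ : x' (m k) = M.src S.arr p),
          S.plug p (((((unit (m k) : M.Named x' (x' (m k))).cast (hm k)).map Sum.inr (Sum.elim_inr x x') : M.Named (Sum.elim x x') (x k))).map (Sum.elim m id)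
            (by rintro (k | k); exacts [hm k, rfl])) e₁ = S.plug p (unit (m k)) e₂ :=
        fun S p e₁ e₂ => ext' rfl fun c d hcd => by
          obtain rfl := Fin.ext hcd
          rfl
      exact (this _ _ _ _).trans h1
  exact key (bind_spec a _)

theorem bind_unit (a : M.Named x y) : a.bind (fun k => unit k) = a :=
  bind_unit_map (fun k => k) (fun _ => rfl) a

theorem plug_bind (a : M.Named x y) (p : Fin (M.ar a.arr)) (k : K) (hk : a.name p = k)
    (b : M.Named x (x k)) (e : x k = M.src a.arr p) (t : ∀ k, M.Named x' (x k))
    (ht : t k = b.bind t) : (a.plug p b e).bind t = a.bind t := by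
  refine bind_eq ?_
  rw [map_plug]
  refine Reduces.plug_inner (s := a.map Sum.inl (Sum.elim_inl x x')) (bind_spec b t) p e ?_
  rw [← ht]
  exact (bind_spec a t).any_step p k (by simp [hk]) _

theorem bind_bind (a : M.Named x y) (t : ∀ k, M.Named x' (x k)) (u : ∀ k, M.Named x'' (x' k)) :
    (a.bind t).bind u = a.bind (fun k => (t k).bind u) := by
  let v : ∀ c, M.Named x'' (Sum.elim x x' c) := fun c =>
    Sum.rec (motive := fun c => M.Named x'' (Sum.elim x x' c)) (fun k => (t k).bind u) u c
  have key : ∀ {s : M.Named (Sum.elim x x') y} {r : M.Named x' y}, Reduces t s r →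
      r.bind u = s.bind v := by
    intro s r h
    induction h with
    | done r => exact (bind_map (x := Sum.elim x x') Sum.inr (Sum.elim_inr x x') r v).symm
    | step s p k hk r h ih =>
      rw [ih]
      exact plug_bind s p (Sum.inl k) hk _ _ v
        (bind_map (x := Sum.elim x x') Sum.inr (Sum.elim_inr x x') (t k) v).symm
  rw [key (bind_spec a t)]
  exact bind_map (x := Sum.elim x x') Sum.inl (Sum.elim_inl x x') a v

theorem map_bind (m : K' → K'') (hm : ∀ k, x'' (m k) = x' k) (a : M.Named x y)
    (t : ∀ k, M.Named x' (x k)) :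
    (a.bind t).map m hm = a.bind (fun k => (t k).map m hm) := by
  rw [← bind_unit_map, bind_bind]
  simp only [bind_unit_map]

theorem cast_bind {y' : M.Obj} (h : y = y') (a : M.Named x y) (t : ∀ k, M.Named x' (x k)) :
    (a.cast h).bind t = (a.bind t).cast h := by
  subst h
  rfl

theorem sum_bind (a : M.Named x y) (t : ∀ k, M.Named x' (x k)) (w : K' → ℕ) :
    ∑ p, w ((a.bind t).name p) = ∑ p, ∑ q, w ((t (a.name p)).name q) :=
  (bind_spec a t).sum w

end

end Named

end

end GenMulticat

namespace GenMulticat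

section

variable (M : GenMulticat)

/-- The signature formed by the arrows of `M`, over the discrete category of objects of `M`: in
trees over this signature all edges are labelled by identities. -/
abbrev sig : Sig (Discrete M.Obj) where
  Arr := M.Arr
  ar := M.ar
  src f j := ⟨M.src f j⟩
  tgt f := ⟨M.tgt f⟩

variable {M}

/-- The arrow obtained by composing the arrows at the nodes of a tree, according to their
positions; each source of the composite is given the name of the corresponding leaf. -/
noncomputable def eval {I K : Type} {F : I → M.Arr} {x : K → Discrete M.Obj} :
    ∀ {z : Discrete M.Obj}, Tree M.sig F x z → M.Named (fun k => (x k).as) z.as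
  | _, Tree.leaf k a => (Named.unit k).cast (Discrete.eq_of_hom a)
  | _, Tree.node i a ch =>
    ((Named.of (F i)).bind (fun j => eval (ch j))).cast (Discrete.eq_of_hom a)

theorem eval_post {I K : Type} {F : I → M.Arr} {x : K → Discrete M.Obj} {z w : Discrete M.Obj}
    (T : Tree M.sig F x z) (a : z ⟶ w) :
    eval (T.post a) = (eval T).cast (Discrete.eq_of_hom a) := by
  cases T <;> rfl

theorem eval_graft {I K K' : Type} {F : I → M.Arr} {x : K → Discrete M.Obj}
    {x' : K' → Discrete M.Obj} (t : ∀ k, Tree M.sig F x' (x k)) {z : Discrete M.Obj}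
    (T : Tree M.sig F x z) : eval (T.graft t) = (eval T).bind (fun k => eval (t k)) := by
  induction T with
  | leaf k a =>
    refine (eval_post _ _).trans ?_
    refine Eq.trans ?_ (Named.cast_bind (Discrete.eq_of_hom a)
      (Named.unit (x := fun k => (x k).as) k) (fun k => eval (t k))).symm
    rw [Named.unit_bind (x := fun k => (x k).as) k (fun k => eval (t k))]
  | node i a ch ih =>
    refine Eq.trans ?_ (Named.cast_bind (Discrete.eq_of_hom a)
      ((Named.of (F i)).bind (fun j => eval (ch j))) (fun k => eval (t k))).symm
    rw [Named.bind_bind]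
    exact congrArg (fun b => ((Named.of (F i)).bind b).cast (Discrete.eq_of_hom a)) (funext ih)

theorem eval_subst {I J K : Type} {F : I → M.Arr} {G : J → M.Arr} {x : K → Discrete M.Obj}
    (U : ∀ i, Tree M.sig G (M.sig.src (F i)) (M.sig.tgt (F i)))
    (hU : ∀ i, eval (U i) = Named.of (F i)) {z : Discrete M.Obj} (T : Tree M.sig F x z) :
    eval (T.subst U) = eval T := by
  induction T with
  | leaf k a => rfl
  | node i a ch ih =>
    refine (eval_post _ _).trans ?_
    rw [eval_graft, hU]
    exact congrArg (fun b => ((Named.of (F i)).bind b).cast (Discrete.eq_of_hom a)) (funext ih)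

theorem eval_corolla {I : Type} {F : I → M.Arr} (i : I) :
    eval (Tree.corolla (S := M.sig) (F := F) i) = Named.of (F i) :=
  Named.bind_unit _

theorem eval_rename {I J K : Type} {G : J → M.Arr} {x : K → Discrete M.Obj} (h : I → J)
    {z : Discrete M.Obj} (T : Tree M.sig (fun i => G (h i)) x z) :
    eval (Tree.rename (S := M.sig) (G := G) h T) = eval T := by
  rw [Tree.rename_eq (S := M.sig)]
  exact eval_subst _ (fun i => eval_corolla (F := G) (h i)) T

theorem eval_graft_leaf {I K K' : Type} {F : I → M.Arr} {x : K → Discrete M.Obj}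
    {x' : K' → Discrete M.Obj} (m : K → K') (a : ∀ k, x' (m k) ⟶ x k) {z : Discrete M.Obj}
    (T : Tree M.sig F x z) : eval (T.graft (fun k => Tree.leaf (m k) (a k))) =
      (eval T).map m (fun k => Discrete.eq_of_hom (a k)) := by
  rw [eval_graft]
  exact Named.bind_unit_map m _ (eval T)

theorem leafSum_eval {I K : Type} {F : I → M.Arr} {x : K → Discrete M.Obj} {z : Discrete M.Obj}
    (T : Tree M.sig F x z) (w : K → ℕ) : T.leafSum w = ∑ p, w ((eval T).name p) := by
  induction T with
  | @leaf z k a =>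
    have : Fintype.card (Fin (M.ar (M.one (x k).as))) = 1 := by simp [M.ar_one]
    refine Eq.trans ?_ (Fin.sum_const (M.ar (M.one (x k).as)) (w k)).symm
    rw [M.ar_one, one_smul]
    rfl
  | node i a ch ih =>
    refine Eq.trans ?_ (Named.sum_bind (Named.of (F i)) (fun j => eval (ch j)) w).symm
    exact Finset.sum_congr rfl fun j _ => ih j

theorem leaf_congr {I K : Type} {F : I → M.Arr} {x : K → Discrete M.Obj} {z : Discrete M.Obj}
    {k k' : K} (h : k = k') (a : x k ⟶ z) (a' : x k' ⟶ z) :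
    (Tree.leaf k a : Tree M.sig F x z) = Tree.leaf k' a' := by
  subst h
  rw [Subsingleton.elim a a']

/-- Forget the names of the leaves; every leaf is named by its object instead. -/
def close {I K : Type} {F : I → M.Arr} {x : K → Discrete M.Obj} {z : Discrete M.Obj}
    (T : Tree M.sig F x z) : Tree M.sig F (Discrete.mk : M.Obj → Discrete M.Obj) z :=
  T.graft (fun k => Tree.leaf (x k).as (𝟙 (x k)))

theorem exists_named {I K : Type} {F : I → M.Arr} {x : K → Discrete M.Obj} {z : Discrete M.Obj}
    (T : Tree M.sig F x z) :
    ∃ (g : M.Arr) (V : Tree M.sig F (M.sig.src g) z) (n : Fin (M.ar g) → K)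
      (hn : ∀ j, x (n j) = M.sig.src g j) (hg : M.tgt g = z.as),
      V.graft (fun j => Tree.leaf (n j) (eqToHom (hn j))) = T ∧
        eval V = (Named.of g).cast hg := by
  induction T with
  | @leaf z k a =>
    have h1 := M.ar_one (x k).as
    have hs := M.src_one (x k).as
    refine ⟨M.one (x k).as, Tree.leaf ⟨0, lt_of_lt_of_eq Nat.one_pos h1.symm⟩
      (eqToHom (congrArg Discrete.mk (hs _)) ≫ a), fun _ => k,
      fun j => congrArg Discrete.mk (hs j).symm,
      (M.tgt_one _).trans (Discrete.eq_of_hom a), ?_, ?_⟩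
    · exact leaf_congr rfl _ _
    · refine Named.ext' (congrArg M.one (hs _)) fun p q h => Fin.ext ?_
      have : (q : ℕ) < M.ar (M.one (x k).as) := q.2
      change 0 = (q : ℕ)
      omega
  | @node z i a ch ih =>
    choose g V n hn hg hV he using ih
    let y : (Σ j, Fin (M.ar (g j))) → M.Obj := fun p => M.src (g p.1) p.2
    let t : ∀ j, M.Named y (M.src (F i) j) := fun j =>
      ((Named.of (g j)).cast (hg j)).map (fun r => (⟨j, r⟩ : Σ j, Fin (M.ar (g j))))
        (fun _ => rfl)
    let b := (Named.of (F i)).bind t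
    have hb : Function.Bijective b.name := by
      classical
      rw [Tree.bijective_iff_sum]
      rintro ⟨j, r⟩
      have h0 := Named.sum_bind (Named.of (F i)) t (fun c => if c = ⟨j, r⟩ then 1 else 0)
      refine Eq.trans (Finset.sum_congr rfl fun c _ => ?_) (h0.trans ?_)
      · by_cases h : b.name c = ⟨j, r⟩
        · rw [if_pos h]; exact (if_pos h).symm
        · rw [if_neg h]; exact (if_neg h).symm
      have : ∀ j', ∑ r', (if (⟨j', r'⟩ : Σ j, Fin (M.ar (g j))) = ⟨j, r⟩ then 1 else 0 : ℕ) =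
          if j' = j then 1 else 0 := by
        intro j'
        by_cases h : j' = j
        · subst h
          simp
        · simp [h]
      exact (Finset.sum_congr rfl fun j' _ => this j').trans (by simp)
    let e := Equiv.ofBijective _ hb
    have hsrc : ∀ c, M.src b.arr (e.symm c) = y c := fun c =>
      (b.src_eq _).trans (congrArg y (e.apply_symm_apply c))
    refine ⟨b.arr, Tree.node i a (fun j => (V j).graft fun r =>
      Tree.leaf (x := M.sig.src b.arr) (e.symm ⟨j, r⟩)
        (eqToHom (congrArg Discrete.mk (hsrc ⟨j, r⟩)))),
      fun c => n (b.name c).1 (b.name c).2, fun c => (hn _ _).trans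
        (congrArg Discrete.mk (b.src_eq c).symm),
      b.tgt_eq.trans (Discrete.eq_of_hom a), ?_, ?_⟩
    · refine congrArg (Tree.node (S := M.sig) i a) (funext fun j => ?_)
      refine (Tree.graft_graft (S := M.sig) _ _ (V j)).trans ?_
      refine Eq.trans ?_ (hV j)
      congr 1
      funext r
      refine leaf_congr ?_ _ _
      have : b.name (e.symm ⟨j, r⟩) = ⟨j, r⟩ := e.apply_symm_apply _
      beta_reduce
      exact congrArg (fun c : Σ j, Fin (M.ar (g j)) => n c.1 c.2) this
    · have h1 : ∀ j, eval ((V j).graft fun r => Tree.leaf (x := M.sig.src b.arr) (e.symm ⟨j, r⟩)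
          (eqToHom (congrArg Discrete.mk (hsrc ⟨j, r⟩)))) = (t j).map e.symm hsrc := by
        intro j
        rw [eval_graft_leaf, he]
      have h2 : b.map e.symm hsrc = (Named.of b.arr).cast b.tgt_eq := by
        refine Named.ext' rfl fun p q h => ?_
        exact (e.symm_apply_apply p).trans (Fin.ext h)
      have h3 := Named.map_bind e.symm hsrc (Named.of (F i)) t
      rw [h2] at h3
      refine (congrArg (fun s => ((Named.of (F i)).bind s).cast (Discrete.eq_of_hom a))
        (funext h1)).trans ?_
      rw [← h3]

theorem exists_pair {I K K' : Type} {F : I → M.Arr} {x : K → Discrete M.Obj}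
    {x' : K' → Discrete M.Obj} {z : Discrete M.Obj} (V : Tree M.sig F x z)
    (V' : Tree M.sig F x' z) (h : close V = close V') :
    ∃ P : Tree M.sig F (fun k : {k : K × K' // x k.1 = x' k.2} => x k.1.1) z,
      P.graft (fun k : {k : K × K' // x k.1 = x' k.2} => Tree.leaf (x := x) k.1.1 (𝟙 _)) = V ∧
      P.graft (fun k : {k : K × K' // x k.1 = x' k.2} =>
        Tree.leaf (x := x') k.1.2 (eqToHom k.2.symm)) = V' := by
  induction V with
  | leaf k a =>
    cases V' with
    | leaf k' a' =>
      simp only [close, Tree.graft, Tree.post] at h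
      injection h with h1 h2
      have hk : x k = x' k' := congrArg Discrete.mk h2
      exact ⟨Tree.leaf ⟨(k, k'), hk⟩ a, leaf_congr rfl _ _, leaf_congr rfl _ _⟩
    | node => simp [close, Tree.graft, Tree.post] at h
  | node i a ch ih =>
    cases V' with
    | leaf k' a' => simp [close, Tree.graft, Tree.post] at h
    | node i' a' ch' =>
      simp only [close, Tree.graft] at h
      injection h with h1 h2 h3 h4
      subst h2
      have h4 := eq_of_heq h4
      have h3 := eq_of_heq h3
      choose P hP hP' using fun j => ih j (ch' j) (congrFun h4 j)
      refine ⟨Tree.node i a P, congrArg (Tree.node (S := M.sig) i a) (funext hP), ?_⟩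
      subst h3
      exact congrArg (Tree.node (S := M.sig) i a) (funext hP')

theorem graft_congr_of_leafSum {I K K' : Type} {F : I → M.Arr} {x : K → Discrete M.Obj}
    {x' : K' → Discrete M.Obj} {z : Discrete M.Obj} (P : Tree M.sig F x z)
    (t t' : ∀ k, Tree M.sig F x' (x k)) (w : K → ℕ) (hw : ∀ k, w k = 0 → t k = t' k)
    (h : P.leafSum w = 0) : P.graft t = P.graft t' := by
  induction P with
  | leaf k a =>
    simp only [Tree.graft]
    rw [hw k h]
  | node i a ch ih =>
    refine congrArg (Tree.node (S := M.sig) i a) (funext fun j => ih j ?_)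
    exact (Finset.sum_eq_zero_iff.1 h) j (Finset.mem_univ j)

theorem named_unique {I : Type} {F : I → M.Arr} {f : M.Arr}
    {V V' : Tree M.sig F (M.sig.src f) (M.sig.tgt f)} (h : close V = close V')
    (hV : eval V = Named.of f) (hV' : eval V' = Named.of f) : V = V' := by
  classical
  obtain ⟨P, rfl, rfl⟩ := exists_pair V V' h
  rw [eval_graft_leaf] at hV hV'
  refine graft_congr_of_leafSum P _ _ (fun k => if k.1.1 = k.1.2 then 0 else 1) ?_ ?_
  · intro k hk
    exact leaf_congr (by simpa using hk) _ _
  · rw [leafSum_eval]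
    refine Finset.sum_eq_zero fun p _ => if_pos ?_
    have ha : M.ar (eval P).arr = M.ar f := congrArg (fun b => M.ar b.arr) hV
    have h1 := Named.name_congr hV p (Fin.cast ha p) rfl
    have h2 := Named.name_congr hV' p (Fin.cast ha p) rfl
    exact h1.trans h2.symm

variable (M)

/-- Planar trees whose nodes stand for arrows of `M` and also carry names in `I`,
with unnamed leaves. -/
abbrev TaggedTree (I : Type) : Type :=
  Σ z : Discrete M.Obj, Tree M.sig (fun c : I × M.Arr => c.2) (Discrete.mk : M.Obj → _) z

/-- Planar trees whose nodes are labelled by arrows of `M`, with unnamed leaves. The edges are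
labelled by the objects of `M`. -/
abbrev PlanarTree : Type :=
  Σ z : Discrete M.Obj, Tree M.sig (fun f : M.Arr => f) (Discrete.mk : M.Obj → _) z

variable {M}

/-- Attach names to the nodes of a tree. -/
def tag {I K : Type} {x : K → Discrete M.Obj} : ∀ {z : Discrete M.Obj}
    (T : Tree M.sig (fun f : M.Arr => f) x z), (T.Nodes → I) →
      Tree M.sig (fun c : I × M.Arr => c.2) x z
  | _, Tree.leaf k a, _ => Tree.leaf k a
  | _, Tree.node f a ch, g =>
    Tree.node (S := M.sig) (F := fun c : I × M.Arr => c.2) (x := x) (g (Sum.inl ⟨⟩), f) a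
      (fun j => tag (ch j) (fun N => g (Sum.inr ⟨j, N⟩)))

/-- The underlying planar tree of a tree whose nodes carry names, and the name of each node. -/
def untag {I K : Type} {x : K → Discrete M.Obj} : ∀ {z : Discrete M.Obj},
    Tree M.sig (fun c : I × M.Arr => c.2) x z →
      Σ T : Tree M.sig (fun f : M.Arr => f) x z, T.Nodes → I
  | _, Tree.leaf k a => ⟨Tree.leaf k a, Empty.elim⟩
  | _, Tree.node c a ch => ⟨Tree.node (S := M.sig) (F := fun f : M.Arr => f) (x := x) c.2 a
        (fun j => (untag (ch j)).1),
      Sum.elim (fun _ => c.1)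
        (fun p : Σ j, (untag (ch j)).1.Nodes => (untag (ch p.1)).2 p.2)⟩

/-- A node put below a family of trees. -/
abbrev untagNode {I K : Type} {x : K → Discrete M.Obj} {z : Discrete M.Obj} (i : I) (f : M.Arr)
    (a : M.sig.tgt f ⟶ z)
    (u : ∀ j : Fin (M.ar f), Σ T : Tree M.sig (fun f : M.Arr => f) x (M.sig.src f j), T.Nodes → I) :
    Σ T : Tree M.sig (fun f : M.Arr => f) x z, T.Nodes → I :=
  ⟨Tree.node (S := M.sig) (F := fun f : M.Arr => f) (x := x) f a (fun j => (u j).1),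
    Sum.elim (fun _ => i) (fun p : Σ j, (u j).1.Nodes => (u p.1).2 p.2)⟩

theorem untag_tag {I K : Type} {x : K → Discrete M.Obj} {z : Discrete M.Obj}
    (T : Tree M.sig (fun f : M.Arr => f) x z) (g : T.Nodes → I) : untag (tag T g) = ⟨T, g⟩ := by
  induction T with
  | leaf k a => exact Sigma.ext rfl (heq_of_eq (funext fun N : Empty => N.elim))
  | node f a ch ih =>
    refine (congrArg (untagNode (g (Sum.inl ⟨⟩)) f a) (funext fun j => ih j _)).trans ?_
    refine Sigma.ext rfl (heq_of_eq (funext fun N => ?_))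
    rcases N with N | N <;> rfl

theorem tag_untag {I K : Type} {x : K → Discrete M.Obj} {z : Discrete M.Obj}
    (T : Tree M.sig (fun c : I × M.Arr => c.2) x z) : tag (untag T).1 (untag T).2 = T := by
  induction T with
  | leaf k a => rfl
  | node c a ch ih => exact congrArg (Tree.node (S := M.sig) c a) (funext ih)

/-- Rename the nodes of a tree; the new name of a node may depend on its arrow. -/
def relabel {I J K : Type} {x : K → Discrete M.Obj} {z : Discrete M.Obj} (h : I × M.Arr → J)
    (T : Tree M.sig (fun c : I × M.Arr => c.2) x z) : Tree M.sig (fun c : J × M.Arr => c.2) x z :=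
  Tree.rename (S := M.sig) (G := fun c : J × M.Arr => c.2) (fun c : I × M.Arr => (h c, c.2)) T

theorem untag_relabel {I J K : Type} {x : K → Discrete M.Obj} {z : Discrete M.Obj}
    (h : I × M.Arr → J) (T : Tree M.sig (fun c : I × M.Arr => c.2) x z) :
    untag (relabel h T) =
      ⟨(untag T).1, fun N => h ((untag T).2 N, (untag T).1.nodeName N)⟩ := by
  induction T with
  | leaf k a => exact Sigma.ext rfl (heq_of_eq (funext fun N : Empty => N.elim))
  | node c a ch ih =>
    refine (congrArg (untagNode (h c) c.2 a) (funext fun j => ih j)).trans ?_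
    refine Sigma.ext rfl (heq_of_eq (funext fun N => ?_))
    rcases N with N | N <;> rfl

theorem relabel_graft {I J K K' : Type} {x : K → Discrete M.Obj} {x' : K' → Discrete M.Obj}
    {z : Discrete M.Obj} (h : I × M.Arr → J)
    (t : ∀ k, Tree M.sig (fun c : I × M.Arr => c.2) x' (x k))
    (T : Tree M.sig (fun c : I × M.Arr => c.2) x z) :
    relabel h (T.graft t) = (relabel h T).graft (fun k => relabel h (t k)) :=
  Tree.rename_graft (S := M.sig) (G := fun c : J × M.Arr => c.2)
    (fun c : I × M.Arr => (h c, c.2)) t T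

theorem relabel_subst {I J K L : Type} {x : K → Discrete M.Obj} {z : Discrete M.Obj}
    (h : I × M.Arr → J)
    (U : ∀ c : J × M.Arr, Tree M.sig (fun c : L × M.Arr => c.2) (M.sig.src c.2) (M.sig.tgt c.2))
    (T : Tree M.sig (fun c : I × M.Arr => c.2) x z) :
    (relabel h T).subst U = T.subst (F := fun c : I × M.Arr => c.2) (fun c => U (h c, c.2)) :=
  Tree.rename_subst (S := M.sig) (G := fun c : J × M.Arr => c.2) (H := fun c : L × M.Arr => c.2)
    (fun c : I × M.Arr => (h c, c.2)) U T

theorem subst_relabel {I J K L : Type} {x : K → Discrete M.Obj} {z : Discrete M.Obj}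
    (h : J × M.Arr → L)
    (U : ∀ c : I × M.Arr, Tree M.sig (fun c : J × M.Arr => c.2) (M.sig.src c.2) (M.sig.tgt c.2))
    (T : Tree M.sig (fun c : I × M.Arr => c.2) x z) :
    relabel h (T.subst U) = T.subst (F := fun c : I × M.Arr => c.2) (fun c => relabel h (U c)) :=
  Tree.subst_rename (S := M.sig) (F := fun c : I × M.Arr => c.2) (H := fun c : L × M.Arr => c.2)
    (fun c : J × M.Arr => (h c, c.2)) U T

theorem relabel_relabel {I J K L : Type} {x : K → Discrete M.Obj} {z : Discrete M.Obj}
    (h : I × M.Arr → J) (h' : J × M.Arr → L) (T : Tree M.sig (fun c : I × M.Arr => c.2) x z) :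
    relabel h' (relabel h T) = relabel (fun c => h' (h c, c.2)) T :=
  Tree.rename_rename (S := M.sig) (H := fun c : L × M.Arr => c.2)
    (fun c : I × M.Arr => (h c, c.2)) (fun c : J × M.Arr => (h' c, c.2)) T

theorem relabel_fst_fst {I J K L : Type} {x : K → Discrete M.Obj} {z : Discrete M.Obj}
    (h : I → J) (h' : J → L) (T : Tree M.sig (fun c : I × M.Arr => c.2) x z) :
    relabel (fun c => h' c.1) (relabel (fun c => h c.1) T) = relabel (fun c => h' (h c.1)) T :=
  relabel_relabel _ _ T

theorem relabel_eq {I J K : Type} {x : K → Discrete M.Obj} {z : Discrete M.Obj}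
    (h : I × M.Arr → J) (T : Tree M.sig (fun c : I × M.Arr => c.2) x z) :
    relabel h T = T.subst (F := fun c : I × M.Arr => c.2)
      (fun c => Tree.corolla (S := M.sig) (F := fun c : J × M.Arr => c.2) (h c, c.2)) :=
  Tree.rename_eq (S := M.sig) (G := fun c : J × M.Arr => c.2)
    (fun c : I × M.Arr => (h c, c.2)) T

theorem eval_relabel {I J K : Type} {x : K → Discrete M.Obj} {z : Discrete M.Obj}
    (h : I × M.Arr → J) (T : Tree M.sig (fun c : I × M.Arr => c.2) x z) :
    eval (relabel h T) = eval T :=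
  eval_rename (G := fun c : J × M.Arr => c.2) (fun c : I × M.Arr => (h c, c.2)) T

theorem nodeSum_relabel {I J K : Type} {x : K → Discrete M.Obj} {z : Discrete M.Obj}
    (h : I × M.Arr → J) (T : Tree M.sig (fun c : I × M.Arr => c.2) x z) (w : J × M.Arr → ℕ) :
    (relabel h T).nodeSum w = T.nodeSum (fun c => w (h c, c.2)) :=
  Tree.nodeSum_rename (S := M.sig) (G := fun c : J × M.Arr => c.2)
    (fun c : I × M.Arr => (h c, c.2)) w T

theorem nodeSum_tag {I K : Type} {x : K → Discrete M.Obj} {z : Discrete M.Obj}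
    (T : Tree M.sig (fun f : M.Arr => f) x z) (g : T.Nodes → I) (w : I × M.Arr → ℕ) :
    (tag T g).nodeSum w = ∑ N, w (g N, T.nodeName N) := by
  induction T with
  | leaf k a => exact (Fintype.sum_empty (ι := Empty) _).symm
  | node f a ch ih =>
    refine Eq.trans ?_ (Fintype.sum_sum_type (α₁ := PUnit) (α₂ := Σ j, (ch j).Nodes) _).symm
    rw [Fintype.sum_sigma]
    simp only [tag, Tree.nodeSum, ih, Tree.nodeName]
    simp

theorem eval_tag {I K : Type} {x : K → Discrete M.Obj} {z : Discrete M.Obj}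
    (T : Tree M.sig (fun f : M.Arr => f) x z) (g : T.Nodes → I) : eval (tag T g) = eval T := by
  induction T with
  | leaf k a => rfl
  | node f a ch ih =>
    exact congrArg (fun b => ((Named.of f).bind b).cast (Discrete.eq_of_hom a))
      (funext fun j => ih j _)

namespace TaggedTree

/-- Rename the nodes. -/
def rename {I J : Type} (h : I → J) (T : M.TaggedTree I) : M.TaggedTree J :=
  ⟨T.1, relabel (fun c => h c.1) T.2⟩

theorem rename_rename {I J L : Type} (h : I → J) (h' : J → L) (T : M.TaggedTree I) :
    (T.rename h).rename h' = T.rename (fun i => h' (h i)) :=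
  congrArg (Sigma.mk T.1) (relabel_relabel _ _ T.2)

/-- `IsNamed T f V`: the tree `V` is `T` with its leaves named by the sources of the
arrow `f`, and `f` is the composite along `T`, each leaf being the source of `f` which it
is named by. -/
def IsNamed {I : Type} (T : M.TaggedTree I) (f : M.Arr)
    (V : Tree M.sig (fun c : I × M.Arr => c.2) (M.sig.src f) (M.sig.tgt f)) : Prop :=
  (⟨M.sig.tgt f, close V⟩ : M.TaggedTree I) = T ∧ eval V = Named.of f

theorem IsNamed.arr_eq {I : Type} {T : M.TaggedTree I} {f : M.Arr} {V} (h : T.IsNamed f V) :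
    (eval T.2).arr = f := by
  obtain ⟨rfl, h⟩ := h
  have : eval (close V) = (eval V).map _ _ := eval_graft_leaf (fun k => M.src f k) (fun _ => 𝟙 _) V
  rw [this]
  exact congrArg (fun b => b.arr) h

theorem exists_isNamed {I : Type} (T : M.TaggedTree I) (f : M.Arr) (h : (eval T.2).arr = f) :
    ∃ V, T.IsNamed f V := by
  obtain ⟨z, T⟩ := T
  obtain ⟨g, V, n, hn, hg, hV, he⟩ := exists_named T
  have h1 : eval T = (eval V).map n (fun j => congrArg Discrete.as (hn j)) := by
    rw [← hV]
    exact eval_graft_leaf n (fun j => eqToHom (hn j)) V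
  obtain rfl : g = f := by
    rw [← h, h1, he]
  obtain rfl : M.sig.tgt g = z := congrArg Discrete.mk hg
  refine ⟨V, ?_, he⟩
  refine congrArg (Sigma.mk (M.sig.tgt g)) ?_
  rw [← hV]
  refine congrArg (fun t => V.graft t) (funext fun j => leaf_congr ?_ _ _)
  exact (congrArg Discrete.as (hn j)).symm

theorem IsNamed.unique {I : Type} {T : M.TaggedTree I} {f : M.Arr} {V V'} (h : T.IsNamed f V)
    (h' : T.IsNamed f V') : V = V' :=
  named_unique (eq_of_heq (Sigma.mk.inj (h.1.trans h'.1.symm)).2) h.2 h'.2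

theorem IsNamed.rename {I J : Type} {T : M.TaggedTree I} {f : M.Arr} {V} (h : T.IsNamed f V)
    (m : I → J) : (T.rename m).IsNamed f (relabel (fun c => m c.1) V) := by
  obtain ⟨rfl, h⟩ := h
  exact ⟨congrArg (Sigma.mk (M.sig.tgt f)) (relabel_graft (fun c => m c.1)
    (fun k => Tree.leaf (x := Discrete.mk) (M.src f k) (𝟙 _)) V).symm, (eval_relabel _ V).trans h⟩

open Classical in
/-- The tree to be put in place of a node `c` when every node with name `p` and
whose arrow is the composite along `T` is to be replaced by `T`, the other nodes being kept. -/
noncomputable def replacement {I J : Type} (p : I) (T : M.TaggedTree J) (c : I × M.Arr) :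
    Tree M.sig (fun d : (I ⊕ J) × M.Arr => d.2) (M.sig.src c.2) (M.sig.tgt c.2) :=
  if h : c.1 = p ∧ ∃ V, T.IsNamed c.2 V then relabel (fun d => Sum.inr d.1) h.2.choose
  else Tree.corolla (S := M.sig) (F := fun d : (I ⊕ J) × M.Arr => d.2) (Sum.inl c.1, c.2)

/-- Replace the node named `p` of the tree `S` by the tree `T`; the leaves of `T` are
joined to the input edges of this node as prescribed by the sources of the composite
along `T`. -/
noncomputable def plug {I J : Type} (S : M.TaggedTree I) (p : I) (T : M.TaggedTree J) :
    M.TaggedTree (I ⊕ J) :=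
  ⟨S.1, S.2.subst (replacement p T)⟩

theorem replacement_pos {I J : Type} {p : I} {T : M.TaggedTree J} {c : I × M.Arr} {V}
    (hp : c.1 = p) (h : T.IsNamed c.2 V) :
    replacement p T c = relabel (fun d => Sum.inr d.1) V := by
  have h' : c.1 = p ∧ ∃ V, T.IsNamed c.2 V := ⟨hp, V, h⟩
  rw [replacement, dif_pos h', IsNamed.unique h'.2.choose_spec h]

theorem replacement_neg {I J : Type} {p : I} {T : M.TaggedTree J} {c : I × M.Arr}
    (h : ¬ (c.1 = p ∧ ∃ V, T.IsNamed c.2 V)) : replacement p T c =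
      Tree.corolla (S := M.sig) (F := fun d : (I ⊕ J) × M.Arr => d.2) (Sum.inl c.1, c.2) := by
  rw [replacement, dif_neg h]

theorem eval_replacement {I J : Type} (p : I) (T : M.TaggedTree J) (c : I × M.Arr) :
    eval (replacement p T c) = Named.of c.2 := by
  by_cases h : c.1 = p ∧ ∃ V, T.IsNamed c.2 V
  · obtain ⟨hp, V, hV⟩ := h
    rw [replacement_pos hp hV]
    exact (eval_relabel _ V).trans hV.2
  · rw [replacement_neg h]
    exact eval_corolla (F := fun d : (I ⊕ J) × M.Arr => d.2) _

theorem eval_plug {I J : Type} (S : M.TaggedTree I) (p : I) (T : M.TaggedTree J) :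
    eval (S.plug p T).2 = eval S.2 :=
  eval_subst (F := fun c : I × M.Arr => c.2) _ (eval_replacement p T) S.2

theorem eval_rename {I J : Type} (m : I → J) (T : M.TaggedTree I) : eval (T.rename m).2 = eval T.2 :=
  eval_relabel _ T.2

theorem isNamed_rename_iff {I J : Type} (m : I → J) (T : M.TaggedTree I) (f : M.Arr) :
    (∃ V, (T.rename m).IsNamed f V) ↔ ∃ V, T.IsNamed f V := by
  constructor
  · rintro ⟨V, hV⟩
    exact exists_isNamed T f ((congrArg (fun b => b.arr) (eval_rename m T)).symm.trans hV.arr_eq)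
  · rintro ⟨V, hV⟩
    exact ⟨_, hV.rename m⟩

theorem leafSum_replacement {I J : Type} (p : I) (T : M.TaggedTree J) (c : I × M.Arr)
    (v : Fin (M.ar c.2) → ℕ) : (replacement p T c).leafSum v = ∑ j, v j := by
  rw [leafSum_eval, eval_replacement]

theorem rename_plug {I I' J : Type} (S : M.TaggedTree I) (p : I) (T : M.TaggedTree J)
    (a : I → I') (ha : Function.Injective a) :
    (S.rename a).plug (a p) T = (S.plug p T).rename (Sum.map a id) := by
  refine congrArg (Sigma.mk S.1) ?_
  refine (relabel_subst _ _ S.2).trans (Eq.trans ?_ (subst_relabel _ _ S.2).symm)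
  refine congrArg (fun U => S.2.subst U) (funext fun c => ?_)
  by_cases h : c.1 = p ∧ ∃ V, T.IsNamed c.2 V
  · obtain ⟨hp, V, hV⟩ := h
    rw [replacement_pos hp hV]
    exact (replacement_pos (c := (a c.1, c.2)) (congrArg a hp) hV).trans
      (relabel_fst_fst (Sum.inr : J → I ⊕ J) (Sum.map a id) V).symm
  · rw [replacement_neg h]
    exact replacement_neg (c := (a c.1, c.2)) (fun h' => h ⟨ha h'.1, h'.2⟩)

theorem plug_rename {I J J' : Type} (S : M.TaggedTree I) (p : I) (T : M.TaggedTree J)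
    (b : J → J') : S.plug p (T.rename b) = (S.plug p T).rename (Sum.map id b) := by
  refine congrArg (Sigma.mk S.1) ?_
  refine Eq.trans ?_ (subst_relabel _ _ S.2).symm
  refine congrArg (fun U => S.2.subst U) (funext fun c => ?_)
  by_cases h : c.1 = p ∧ ∃ V, T.IsNamed c.2 V
  · obtain ⟨hp, V, hV⟩ := h
    rw [replacement_pos hp hV, replacement_pos hp (hV.rename b)]
    exact (relabel_fst_fst b Sum.inr V).trans (relabel_fst_fst (Sum.inr : J → I ⊕ J) (Sum.map id b) V).symm
  · rw [replacement_neg h, replacement_neg (by rwa [isNamed_rename_iff])]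
    rfl

theorem IsNamed.plug {I J : Type} {S : M.TaggedTree I} {f : M.Arr} {V} (h : S.IsNamed f V)
    (p : I) (T : M.TaggedTree J) : (S.plug p T).IsNamed f
      (V.subst (F := fun c : I × M.Arr => c.2) (replacement p T)) := by
  obtain ⟨rfl, h⟩ := h
  exact ⟨congrArg (Sigma.mk (M.sig.tgt f)) (Tree.subst_graft (S := M.sig)
      (F := fun c : I × M.Arr => c.2) (replacement p T)
      (fun k => Tree.leaf (x := Discrete.mk) (M.src f k) (𝟙 _)) V).symm,
    (eval_subst (F := fun c : I × M.Arr => c.2) _ (eval_replacement p T) V).trans h⟩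

theorem isNamed_plug_iff {I J : Type} (S : M.TaggedTree I) (p : I) (T : M.TaggedTree J)
    (f : M.Arr) : (∃ V, (S.plug p T).IsNamed f V) ↔ ∃ V, S.IsNamed f V := by
  constructor
  · rintro ⟨V, hV⟩
    exact exists_isNamed S f ((congrArg (fun b => b.arr) (eval_plug S p T)).symm.trans hV.arr_eq)
  · rintro ⟨V, hV⟩
    exact ⟨_, hV.plug p T⟩

theorem plug_assoc {I J L : Type} (S : M.TaggedTree I) (p : I) (T : M.TaggedTree J) (q : J)
    (W : M.TaggedTree L) : ((S.plug p T).plug (Sum.inr q) W).rename (Equiv.sumAssoc I J L) =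
      S.plug p (T.plug q W) := by
  refine congrArg (Sigma.mk S.1) ?_
  refine (congrArg (relabel _) (Tree.subst_subst (S := M.sig) (F := fun c : I × M.Arr => c.2)
    (replacement p T) (replacement (Sum.inr q) W) S.2)).trans ?_
  refine (subst_relabel _ _ S.2).trans ?_
  refine congrArg (fun U => S.2.subst U) (funext fun c => ?_)
  by_cases h : c.1 = p ∧ ∃ V, T.IsNamed c.2 V
  · obtain ⟨hp, V, hV⟩ := h
    rw [replacement_pos hp hV, replacement_pos hp (hV.plug q W)]
    refine (congrArg (relabel _) (relabel_subst _ _ V)).trans ?_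
    refine (subst_relabel _ _ V).trans (Eq.trans ?_ (subst_relabel _ _ V).symm)
    refine congrArg (fun U => V.subst U) (funext fun c => ?_)
    by_cases h : c.1 = q ∧ ∃ V, W.IsNamed c.2 V
    · obtain ⟨hq, V, hV⟩ := h
      rw [replacement_pos hq hV]
      refine (congrArg (relabel _) (replacement_pos (c := ((Sum.inr c.1 : I ⊕ J), c.2))
        (congrArg Sum.inr hq) hV)).trans ?_
      exact (relabel_fst_fst _ _ V).trans
        (relabel_fst_fst (Sum.inr : L → J ⊕ L) (Sum.inr : J ⊕ L → I ⊕ J ⊕ L) V).symm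
    · rw [replacement_neg h]
      exact congrArg (relabel _) (replacement_neg (c := ((Sum.inr c.1 : I ⊕ J), c.2))
        (fun h' => h ⟨Sum.inr_injective h'.1, h'.2⟩))
  · rw [replacement_neg h, Tree.corolla_subst (S := M.sig), replacement_neg,
      replacement_neg (by rwa [isNamed_plug_iff])]
    · rfl
    · rintro ⟨h1, -⟩
      exact Sum.inl_ne_inr h1

theorem relabel_inr_subst {I J L K : Type} {x : K → Discrete M.Obj} {z : Discrete M.Obj} (q : I)
    (W : M.TaggedTree L) (V : Tree M.sig (fun c : J × M.Arr => c.2) x z) :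
    (relabel (fun d => (Sum.inr d.1 : I ⊕ J)) V).subst (F := fun c : (I ⊕ J) × M.Arr => c.2)
      (replacement (Sum.inl q) W) = relabel (fun d => Sum.inl (Sum.inr d.1)) V := by
  rw [relabel_subst, relabel_eq]
  refine congrArg (fun U => V.subst U) (funext fun c => ?_)
  exact replacement_neg (c := ((Sum.inr c.1 : I ⊕ J), c.2)) (fun h' => Sum.inr_ne_inl h'.1)

/-- Exchange the second and the third summand. -/
def swap (I J L : Type) : (I ⊕ J) ⊕ L → (I ⊕ L) ⊕ J :=
  Sum.elim (Sum.elim (fun i => Sum.inl (Sum.inl i)) Sum.inr) (fun l => Sum.inl (Sum.inr l))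

theorem plug_comm {I J L : Type} (S : M.TaggedTree I) (p q : I) (hqp : q ≠ p)
    (T : M.TaggedTree J) (W : M.TaggedTree L) :
    ((S.plug p T).plug (Sum.inl q) W).rename (swap I J L) = (S.plug q W).plug (Sum.inl p) T := by
  refine congrArg (Sigma.mk S.1) ?_
  refine (congrArg (relabel _) (Tree.subst_subst (S := M.sig) (F := fun c : I × M.Arr => c.2)
    (replacement p T) (replacement (Sum.inl q) W) S.2)).trans ?_
  refine (subst_relabel _ _ S.2).trans ?_
  refine Eq.trans ?_ (Tree.subst_subst (S := M.sig) (F := fun c : I × M.Arr => c.2)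
    (replacement q W) (replacement (Sum.inl p) T) S.2).symm
  refine congrArg (fun U => S.2.subst U) (funext fun c => ?_)
  by_cases h : c.1 = p ∧ ∃ V, T.IsNamed c.2 V
  · obtain ⟨hp, V, hV⟩ := h
    rw [replacement_pos hp hV, relabel_inr_subst,
      replacement_neg (p := q) (T := W) (fun h' => hqp (h'.1.symm.trans hp)),
      Tree.corolla_subst (S := M.sig)]
    refine Eq.trans ?_ (replacement_pos (c := ((Sum.inl c.1 : I ⊕ L), c.2))
      (congrArg Sum.inl hp) hV).symm
    exact relabel_fst_fst (fun j : J => (Sum.inl (Sum.inr j) : (I ⊕ J) ⊕ L)) (swap I J L) V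
  · rw [replacement_neg h, Tree.corolla_subst (S := M.sig)]
    by_cases h₂ : c.1 = q ∧ ∃ V, W.IsNamed c.2 V
    · obtain ⟨hq, V, hV⟩ := h₂
      rw [replacement_pos hq hV, relabel_inr_subst,
        replacement_pos (c := ((Sum.inl c.1 : I ⊕ J), c.2)) (congrArg Sum.inl hq) hV]
      exact relabel_fst_fst _ (swap I J L) V
    · rw [replacement_neg h₂, Tree.corolla_subst (S := M.sig),
        replacement_neg (c := ((Sum.inl c.1 : I ⊕ J), c.2))
          (fun h' => h₂ ⟨Sum.inl_injective h'.1, h'.2⟩),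
        replacement_neg (c := ((Sum.inl c.1 : I ⊕ L), c.2))
          (fun h' => h ⟨Sum.inl_injective h'.1, h'.2⟩)]
      rfl

end TaggedTree

end

end GenMulticat

namespace GenMulticat

section

variable {M : GenMulticat}

theorem exists_equiv_of_sum {A B D : Type} [Fintype A] [Fintype D] (γ : A → B) (e : D → B)
    (he : Function.Injective e) (h : ∀ w : B → ℕ, ∑ a, w (γ a) = ∑ c, w (e c)) :
    ∃ σ : D ≃ A, ∀ c, γ (σ c) = e c := by
  classical
  have h1 : ∀ c, ∃! a, γ a = e c := by
    intro c
    have := h (fun b => if b = e c then 1 else 0)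
    have h2 : ∑ c', (if e c' = e c then 1 else 0 : ℕ) = 1 := by
      simp [he.eq_iff]
    rw [h2] at this
    simp only [Finset.sum_boole, Nat.cast_id, Finset.card_eq_one] at this
    obtain ⟨a, ha⟩ := this
    simp only [Finset.ext_iff, Finset.mem_filter, Finset.mem_univ, true_and,
      Finset.mem_singleton] at ha
    exact ⟨a, (ha a).2 rfl, fun a' h' => (ha a').1 h'⟩
  choose s hs hs' using h1
  refine ⟨Equiv.ofBijective s ⟨fun c c' hc => ?_, fun a => ?_⟩, hs⟩
  · exact he ((hs c).symm.trans ((congrArg γ hc).trans (hs c')))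
  · by_contra hne
    have := h (fun b => if b = γ a then 1 else 0)
    have h2 : ∑ c, (if e c = γ a then 1 else 0 : ℕ) = 0 := by
      refine Finset.sum_eq_zero fun c _ => if_neg fun hc => hne ⟨c, ?_⟩
      exact (hs' c a hc.symm).symm
    rw [h2, Finset.sum_eq_zero_iff] at this
    simpa using this a (Finset.mem_univ a)

variable (M) in
/-- A choice, for every tree, of an order on the set of its nodes. -/
abbrev NodeOrder : Type :=
  ∀ T : M.PlanarTree, T.2.Nodes ≃ Fin (Fintype.card T.2.Nodes)

namespace TaggedTree

/-- Forget the names of the nodes. -/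
def under {I : Type} (S : M.TaggedTree I) : M.PlanarTree := ⟨S.1, (untag S.2).1⟩

theorem under_rename {I J : Type} (S : M.TaggedTree I) (a : I → J) :
    (S.rename a).under = S.under :=
  congrArg (fun u : Σ T : Tree M.sig (fun f : M.Arr => f) _ S.1, T.Nodes → J =>
    (⟨S.1, u.1⟩ : M.PlanarTree)) (untag_relabel (fun c => a c.1) S.2)

/-- The node named `c` has number `k`. -/
def Num (ord : M.NodeOrder) {I : Type} (S : M.TaggedTree I) (c : I) (k : ℕ) : Prop :=
  ∃ N : S.under.2.Nodes, (untag S.2).2 N = c ∧ (ord S.under N : ℕ) = k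

theorem num_relabel {ord : M.NodeOrder} {I J : Type} {S : M.TaggedTree I}
    (h : I × M.Arr → J) (N : S.under.2.Nodes) :
    Num ord ⟨S.1, relabel h S.2⟩ (h ((untag S.2).2 N, S.under.2.nodeName N))
      (ord S.under N : ℕ) := by
  have : ∀ u : Σ T : Tree M.sig (fun f : M.Arr => f) Discrete.mk S.1, T.Nodes → J,
      u = ⟨(untag S.2).1, fun N => h ((untag S.2).2 N, (untag S.2).1.nodeName N)⟩ →
      ∃ N' : u.1.Nodes, u.2 N' = h ((untag S.2).2 N, (untag S.2).1.nodeName N) ∧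
        (ord ⟨S.1, u.1⟩ N' : ℕ) = ord S.under N := by
    rintro _ rfl
    exact ⟨N, rfl, rfl⟩
  exact this _ (untag_relabel h S.2)

theorem Num.rename {ord : M.NodeOrder} {I J : Type} {S : M.TaggedTree I} {c : I} {k : ℕ}
    (h : S.Num ord c k) (a : I → J) : (S.rename a).Num ord (a c) k := by
  obtain ⟨N, rfl, rfl⟩ := h
  exact num_relabel (fun c => a c.1) N

theorem Num.unique {ord : M.NodeOrder} {I : Type} {S : M.TaggedTree I}
    (hS : Function.Injective (untag S.2).2) {c : I} {k k' : ℕ} (h : S.Num ord c k)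
    (h' : S.Num ord c k') : k = k' := by
  obtain ⟨N, hN, rfl⟩ := h
  obtain ⟨N', hN', rfl⟩ := h'
  rw [hS (hN.trans hN'.symm)]

theorem injective_rename {I J : Type} {S : M.TaggedTree I}
    (hS : Function.Injective (untag S.2).2) (a : I → J) (ha : Function.Injective a) :
    Function.Injective (untag (S.rename a).2).2 := by
  have : ∀ u : Σ T : Tree M.sig (fun f : M.Arr => f) Discrete.mk S.1, T.Nodes → J,
      u = ⟨(untag S.2).1, fun N => a ((untag S.2).2 N)⟩ → Function.Injective u.2 := by
    rintro _ rfl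
    exact ha.comp hS
  exact this _ (untag_relabel (fun c => a c.1) S.2)

theorem nodeSum_under {I : Type} (S : M.TaggedTree I) (w : I × M.Arr → ℕ) :
    S.2.nodeSum w = ∑ N : S.under.2.Nodes, w ((untag S.2).2 N, S.under.2.nodeName N) := by
  conv_lhs => rw [← tag_untag S.2]
  exact nodeSum_tag _ _ w

theorem eval_under {I : Type} (S : M.TaggedTree I) : eval S.under.2 = eval S.2 := by
  conv_rhs => rw [← tag_untag S.2]
  exact (eval_tag _ _).symm

theorem nodeSum_close {I K : Type} {x : K → Discrete M.Obj} {z : Discrete M.Obj}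
    (V : Tree M.sig (fun c : I × M.Arr => c.2) x z) (w : I × M.Arr → ℕ) :
    (close V).nodeSum w = V.nodeSum w := by
  refine (Tree.nodeSum_graft (S := M.sig) _ _ V).trans ?_
  rw [leafSum_eval]
  exact Nat.add_eq_left.2 (Finset.sum_eq_zero fun _ _ => rfl)

theorem nodeSum_replacement_pos {I J : Type} {p : I} {T : M.TaggedTree J} {c : I × M.Arr}
    (hp : c.1 = p) (h : (eval T.2).arr = c.2) (w : (I ⊕ J) × M.Arr → ℕ) :
    (replacement p T c).nodeSum w = T.2.nodeSum (fun d => w (Sum.inr d.1, d.2)) := by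
  obtain ⟨V, hV⟩ := exists_isNamed T c.2 h
  rw [replacement_pos hp hV]
  refine (nodeSum_relabel _ V w).trans ?_
  rw [← nodeSum_close V]
  obtain ⟨rfl, -⟩ := hV
  rfl

theorem nodeSum_replacement_neg {I J : Type} {p : I} {T : M.TaggedTree J} {c : I × M.Arr}
    (hp : c.1 ≠ p) (w : (I ⊕ J) × M.Arr → ℕ) :
    (replacement p T c).nodeSum w = w (Sum.inl c.1, c.2) := by
  rw [replacement_neg (fun h => hp h.1)]
  simp [Tree.corolla, Tree.nodeSum]

/-- A tree with one node. -/
abbrev single {I : Type} (i : I) (f : M.Arr) : M.TaggedTree I :=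
  ⟨M.sig.tgt f, close (Tree.corolla (S := M.sig) (F := fun c : I × M.Arr => c.2) (i, f))⟩

theorem single_isNamed {I : Type} (i : I) (f : M.Arr) : (single i f).IsNamed f
    (Tree.corolla (S := M.sig) (F := fun c : I × M.Arr => c.2) (i, f)) :=
  ⟨rfl, eval_corolla (F := fun c : I × M.Arr => c.2) (i, f)⟩

theorem single_plug {I J : Type} (i : I) (f : M.Arr) (T : M.TaggedTree J)
    (h : (eval T.2).arr = f) : (single i f).plug i T = T.rename Sum.inr := by
  obtain ⟨V, hV⟩ := exists_isNamed T f h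
  have h1 := (single_isNamed i f).plug i T
  rw [Tree.corolla_subst (S := M.sig), replacement_pos (c := (i, f)) rfl hV] at h1
  exact h1.1.symm.trans (hV.rename Sum.inr).1

theorem plug_single {I J : Type} (S : M.TaggedTree I) (p : I) (i : J) (f : M.Arr)
    (h : I × M.Arr → I ⊕ J) (h₁ : ∀ c, c.1 = p ∧ c.2 = f → h c = Sum.inr i)
    (h₂ : ∀ c, ¬ (c.1 = p ∧ c.2 = f) → h c = Sum.inl c.1) :
    S.plug p (single i f) = ⟨S.1, relabel h S.2⟩ := by
  refine congrArg (Sigma.mk S.1) ?_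
  rw [relabel_eq]
  refine congrArg (fun U => S.2.subst U) (funext fun c => ?_)
  by_cases hc : c.1 = p ∧ c.2 = f
  · rw [h₁ c hc]
    obtain ⟨j, f'⟩ := c
    obtain ⟨h1, h2⟩ : j = p ∧ f' = f := hc
    subst h1 h2
    exact (replacement_pos (c := (j, f')) rfl (single_isNamed i f')).trans rfl
  · rw [h₂ c hc, replacement_neg]
    rintro ⟨h1, V, hV⟩
    exact hc ⟨h1, hV.arr_eq.symm.trans (single_isNamed i f).arr_eq⟩

end TaggedTree

variable (M) in
/-- The tree with exactly one node, labelled by `f`. -/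
abbrev oneNode (f : M.Arr) : M.PlanarTree :=
  ⟨M.sig.tgt f, Tree.node (S := M.sig) (F := fun f : M.Arr => f) f (𝟙 _)
    (fun j => Tree.leaf (x := Discrete.mk) (M.src f j) (𝟙 _))⟩

namespace NodeOrder

variable (ord : M.NodeOrder)

/-- Name the nodes of a tree by their numbers. -/
def number (T : M.PlanarTree) : M.TaggedTree (Fin (Fintype.card T.2.Nodes)) :=
  ⟨T.1, tag T.2 (ord T)⟩

/-- The arrow at the node with number `k`. -/
def src (T : M.PlanarTree) (k : Fin (Fintype.card T.2.Nodes)) : M.Arr :=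
  T.2.nodeName ((ord T).symm k)

/-- The tree obtained by replacing the node with number `p` of `T₁` by the tree `T₂`. -/
noncomputable def comp (T₁ : M.PlanarTree) (p : Fin (Fintype.card T₁.2.Nodes))
    (T₂ : M.PlanarTree) : M.PlanarTree :=
  ((ord.number T₁).plug p (ord.number T₂)).under

theorem eval_number (T : M.PlanarTree) : eval (ord.number T).2 = eval T.2 :=
  eval_tag _ _

theorem nodeSum_number (T : M.PlanarTree) (w) :
    (ord.number T).2.nodeSum w = ∑ k, w (k, ord.src T k) := by
  refine (nodeSum_tag T.2 (ord T) w).trans ?_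
  rw [← (ord T).sum_comp (fun k => w (k, ord.src T k))]
  simp [src]

theorem sum_plug (T₁ : M.PlanarTree) (p : Fin (Fintype.card T₁.2.Nodes))
    (T₂ : M.PlanarTree) (h : (eval T₂.2).arr = ord.src T₁ p)
    (w : (Fin (Fintype.card T₁.2.Nodes) ⊕ Fin (Fintype.card T₂.2.Nodes)) × M.Arr → ℕ) :
    ((ord.number T₁).plug p (ord.number T₂)).2.nodeSum w =
      ∑ c : {q // q ≠ p} ⊕ Fin (Fintype.card T₂.2.Nodes),
        w (Sum.map Subtype.val id c,
          Sum.elim (fun q => ord.src T₁ q.1) (fun r => ord.src T₂ r) c) := by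
  classical
  refine (Tree.nodeSum_subst (S := M.sig) (F := fun c : _ × M.Arr => c.2) _
    (TaggedTree.leafSum_replacement p _) w _).trans ?_
  refine (ord.nodeSum_number T₁ _).trans ?_
  rw [Fintype.sum_sum_type, ← Finset.sum_erase_add _ _ (Finset.mem_univ p)]
  refine congrArg₂ (· + ·) ?_ ?_
  · rw [Finset.sum_subtype (p := fun q => q ≠ p) _ (by simp)]
    exact Finset.sum_congr rfl fun q _ => TaggedTree.nodeSum_replacement_neg q.2 w
  · refine (TaggedTree.nodeSum_replacement_pos (c := (p, ord.src T₁ p)) rfl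
      ((congrArg (fun b => b.arr) (ord.eval_number T₂)).trans h) w).trans ?_
    exact ord.nodeSum_number T₂ _

theorem exists_amalg (T₁ : M.PlanarTree) (p : Fin (Fintype.card T₁.2.Nodes))
    (T₂ : M.PlanarTree) (h : (eval T₂.2).arr = ord.src T₁ p) :
    ∃ σ : {q // q ≠ p} ⊕ Fin (Fintype.card T₂.2.Nodes) ≃ (ord.comp T₁ p T₂).2.Nodes,
      ∀ c, ((untag ((ord.number T₁).plug p (ord.number T₂)).2).2 (σ c),
          (ord.comp T₁ p T₂).2.nodeName (σ c)) =
        (Sum.map Subtype.val id c,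
          Sum.elim (fun q => ord.src T₁ q.1) (fun r => ord.src T₂ r) c) := by
  refine exists_equiv_of_sum (A := (ord.comp T₁ p T₂).2.Nodes)
    (fun N => ((untag ((ord.number T₁).plug p (ord.number T₂)).2).2 N,
      (ord.comp T₁ p T₂).2.nodeName N))
    (fun c : {q // q ≠ p} ⊕ Fin (Fintype.card T₂.2.Nodes) => (Sum.map Subtype.val id c,
      Sum.elim (fun q => ord.src T₁ q.1) (fun r => ord.src T₂ r) c)) ?_ fun w => ?_
  · intro c c' hc
    exact (Function.Injective.sumMap Subtype.val_injective Function.injective_id)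
      (congrArg Prod.fst hc)
  · exact (TaggedTree.nodeSum_under ((ord.number T₁).plug p (ord.number T₂)) w).symm.trans
      (ord.sum_plug T₁ p T₂ h w)

/-- The bijection between the nodes of `T₁` other than the one replaced, together with
those of `T₂`, and the nodes of the tree obtained by the replacement. -/
noncomputable def amalg (T₁ : M.PlanarTree) (p : Fin (Fintype.card T₁.2.Nodes))
    (T₂ : M.PlanarTree) (h : (eval T₂.2).arr = ord.src T₁ p) :
    {q // q ≠ p} ⊕ Fin (Fintype.card T₂.2.Nodes) ≃
      Fin (Fintype.card (ord.comp T₁ p T₂).2.Nodes) :=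
  (ord.exists_amalg T₁ p T₂ h).choose.trans (ord _)

theorem src_amalg (T₁ : M.PlanarTree) (p : Fin (Fintype.card T₁.2.Nodes))
    (T₂ : M.PlanarTree) (h : (eval T₂.2).arr = ord.src T₁ p) (c) :
    ord.src (ord.comp T₁ p T₂) (ord.amalg T₁ p T₂ h c) =
      Sum.elim (fun q => ord.src T₁ q.1) (fun r => ord.src T₂ r) c := by
  rw [src, amalg, Equiv.trans_apply, Equiv.symm_apply_apply]
  exact congrArg Prod.snd ((ord.exists_amalg T₁ p T₂ h).choose_spec c)

/-- The origin of a node of the composite. -/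
noncomputable def origin (T₁ : M.PlanarTree) (p : Fin (Fintype.card T₁.2.Nodes))
    (T₂ : M.PlanarTree) (k : Fin (Fintype.card (ord.comp T₁ p T₂).2.Nodes)) :
    Fin (Fintype.card T₁.2.Nodes) ⊕ Fin (Fintype.card T₂.2.Nodes) :=
  (untag ((ord.number T₁).plug p (ord.number T₂)).2).2 ((ord (ord.comp T₁ p T₂)).symm k)

theorem origin_amalg (T₁ : M.PlanarTree) (p : Fin (Fintype.card T₁.2.Nodes))
    (T₂ : M.PlanarTree) (h : (eval T₂.2).arr = ord.src T₁ p) (c) :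
    ord.origin T₁ p T₂ (ord.amalg T₁ p T₂ h c) = Sum.map Subtype.val id c := by
  rw [origin, amalg, Equiv.trans_apply, Equiv.symm_apply_apply]
  exact congrArg Prod.fst ((ord.exists_amalg T₁ p T₂ h).choose_spec c)

theorem origin_injective (T₁ : M.PlanarTree) (p : Fin (Fintype.card T₁.2.Nodes))
    (T₂ : M.PlanarTree) (h : (eval T₂.2).arr = ord.src T₁ p) :
    Function.Injective (ord.origin T₁ p T₂) := by
  intro k k' hk
  obtain ⟨c, rfl⟩ := (ord.amalg T₁ p T₂ h).surjective k
  obtain ⟨c', rfl⟩ := (ord.amalg T₁ p T₂ h).surjective k'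
  rw [origin_amalg, origin_amalg] at hk
  rw [(Function.Injective.sumMap Subtype.val_injective Function.injective_id) hk]

theorem injective_plug (T₁ : M.PlanarTree) (p : Fin (Fintype.card T₁.2.Nodes))
    (T₂ : M.PlanarTree) (h : (eval T₂.2).arr = ord.src T₁ p) :
    Function.Injective (untag ((ord.number T₁).plug p (ord.number T₂)).2).2 := by
  intro N N' hN
  have h1 : ∀ N, ord.origin T₁ p T₂ (ord (ord.comp T₁ p T₂) N) =
      (untag ((ord.number T₁).plug p (ord.number T₂)).2).2 N := fun N =>
    congrArg (untag ((ord.number T₁).plug p (ord.number T₂)).2).2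
      ((ord (ord.comp T₁ p T₂)).symm_apply_apply N)
  have := ord.origin_injective T₁ p T₂ h (((h1 N).trans hN).trans (h1 N').symm)
  exact (ord _).injective this

theorem number_rename_origin (T₁ : M.PlanarTree) (p : Fin (Fintype.card T₁.2.Nodes))
    (T₂ : M.PlanarTree) : (ord.number (ord.comp T₁ p T₂)).rename (ord.origin T₁ p T₂) =
      (ord.number T₁).plug p (ord.number T₂) := by
  refine congrArg (Sigma.mk T₁.1) ?_
  have h := untag_relabel (fun c => ord.origin T₁ p T₂ c.1) (ord.number (ord.comp T₁ p T₂)).2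
  have h1 : untag (ord.number (ord.comp T₁ p T₂)).2 =
    ⟨(ord.comp T₁ p T₂).2, ord (ord.comp T₁ p T₂)⟩ := untag_tag _ _
  have h2 : ∀ u : Σ T : Tree M.sig (fun f : M.Arr => f) Discrete.mk T₁.1,
      T.Nodes → Fin (Fintype.card (ord.comp T₁ p T₂).2.Nodes),
      u = ⟨(ord.comp T₁ p T₂).2, ord (ord.comp T₁ p T₂)⟩ →
      tag u.1 (fun N => ord.origin T₁ p T₂ (u.2 N)) =
        ((ord.number T₁).plug p (ord.number T₂)).2 := by
    rintro _ rfl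
    refine Eq.trans (congrArg (tag _) (funext fun N => ?_)) (tag_untag _)
    exact congrArg (untag ((ord.number T₁).plug p (ord.number T₂)).2).2
      ((ord (ord.comp T₁ p T₂)).symm_apply_apply N)
  refine Eq.trans ?_ (h2 _ h1)
  refine (tag_untag _).symm.trans ?_
  exact congrArg (fun u : Σ T : Tree M.sig (fun f : M.Arr => f) Discrete.mk T₁.1, T.Nodes → _ =>
    tag u.1 u.2) h

theorem num_number (T : M.PlanarTree) (k : Fin (Fintype.card T.2.Nodes)) :
    (ord.number T).Num ord k k := by
  have : ∀ u : Σ S : Tree M.sig (fun f : M.Arr => f) Discrete.mk T.1,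
      S.Nodes → Fin (Fintype.card T.2.Nodes), u = ⟨T.2, ord T⟩ →
      ∃ N : u.1.Nodes, u.2 N = k ∧ (ord ⟨T.1, u.1⟩ N : ℕ) = k := by
    rintro _ rfl
    exact ⟨(ord T).symm k, by simp, congrArg Fin.val ((ord T).apply_symm_apply k)⟩
  exact this _ (untag_tag T.2 (ord T))

theorem injective_number (T : M.PlanarTree) : Function.Injective (untag (ord.number T).2).2 := by
  have : ∀ u : Σ S : Tree M.sig (fun f : M.Arr => f) Discrete.mk T.1,
      S.Nodes → Fin (Fintype.card T.2.Nodes), u = ⟨T.2, ord T⟩ → Function.Injective u.2 := by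
    rintro _ rfl
    exact (ord T).injective
  exact this _ (untag_tag T.2 (ord T))

theorem under_number (T : M.PlanarTree) : (ord.number T).under = T :=
  congrArg (fun u : Σ S : Tree M.sig (fun f : M.Arr => f) Discrete.mk T.1,
      S.Nodes → Fin (Fintype.card T.2.Nodes) => (⟨T.1, u.1⟩ : M.PlanarTree))
    (untag_tag T.2 (ord T))

theorem num_amalg (T₁ : M.PlanarTree) (p : Fin (Fintype.card T₁.2.Nodes))
    (T₂ : M.PlanarTree) (h : (eval T₂.2).arr = ord.src T₁ p) (c) :
    ((ord.number T₁).plug p (ord.number T₂)).Num ord (Sum.map Subtype.val id c)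
      (ord.amalg T₁ p T₂ h c) :=
  ⟨(ord _).symm (ord.amalg T₁ p T₂ h c), ord.origin_amalg T₁ p T₂ h c,
    congrArg Fin.val ((ord (ord.comp T₁ p T₂)).apply_symm_apply _)⟩

theorem tgt_comp (T₁ : M.PlanarTree) (p : Fin (Fintype.card T₁.2.Nodes))
    (T₂ : M.PlanarTree) : (eval (ord.comp T₁ p T₂).2).arr = (eval T₁.2).arr := by
  have h1 := TaggedTree.eval_under ((ord.number T₁).plug p (ord.number T₂))
  have h2 := TaggedTree.eval_plug (ord.number T₁) p (ord.number T₂)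
  exact congrArg (fun b => b.arr) (h1.trans (h2.trans (ord.eval_number T₁)))

theorem tag_oneNode {I : Type} (f : M.Arr) (g : (M.oneNode f).2.Nodes → I) :
    (⟨M.sig.tgt f, tag (M.oneNode f).2 g⟩ : M.TaggedTree I) =
      TaggedTree.single (g (Sum.inl ⟨⟩)) f := by
  refine congrArg (Sigma.mk (M.sig.tgt f)) ?_
  exact congrArg (Tree.node (S := M.sig) (F := fun c : I × M.Arr => c.2)
    (g (Sum.inl ⟨⟩), f) (𝟙 _)) (funext fun j => leaf_congr rfl _ _)

theorem number_oneNode (f : M.Arr) :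
    ord.number (M.oneNode f) = TaggedTree.single (ord (M.oneNode f) (Sum.inl ⟨⟩)) f :=
  tag_oneNode f _

theorem eval_oneNode (f : M.Arr) : (eval (M.oneNode f).2).arr = f := by
  have h := congrArg (fun T : M.TaggedTree PUnit => (eval T.2).arr) (tag_oneNode f fun _ => ⟨⟩)
  refine (congrArg (fun b => b.arr) (eval_tag (M.oneNode f).2 fun _ => PUnit.unit)).symm.trans ?_
  exact h.trans (TaggedTree.single_isNamed _ f).arr_eq

theorem subsingleton_nodes (f : M.Arr) : Subsingleton (M.oneNode f).2.Nodes := by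
  refine ⟨fun N N' => ?_⟩
  rcases N with N | N
  · rcases N' with N' | N'
    · rfl
    · exact Empty.elim N'.2
  · exact Empty.elim N.2

theorem card_oneNode (f : M.Arr) : Fintype.card (M.oneNode f).2.Nodes = 1 :=
  haveI := subsingleton_nodes f
  Fintype.card_eq_one_iff.2 ⟨Sum.inl ⟨⟩, fun _ => Subsingleton.elim _ _⟩

theorem src_oneNode (f : M.Arr) (p) : ord.src (M.oneNode f) p = f := by
  have := subsingleton_nodes f
  rw [src, Subsingleton.elim ((ord (M.oneNode f)).symm p) (Sum.inl ⟨⟩)]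
  rfl

theorem eq_oneNode (f : M.Arr) (p) : p = ord (M.oneNode f) (Sum.inl ⟨⟩) := by
  have := subsingleton_nodes f
  exact ((ord (M.oneNode f)).symm_apply_eq).1
    (Subsingleton.elim ((ord (M.oneNode f)).symm p) (Sum.inl ⟨⟩))

theorem oneNode_plug (f : M.Arr) (p) (T : M.PlanarTree) (h : (eval T.2).arr = f) :
    (ord.number (M.oneNode f)).plug p (ord.number T) = (ord.number T).rename Sum.inr := by
  rw [number_oneNode, ord.eq_oneNode f p]
  exact TaggedTree.single_plug _ f _ ((congrArg (fun b => b.arr) (ord.eval_number T)).trans h)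

theorem one_comp (f : M.Arr) (p) (T : M.PlanarTree) (h : (eval T.2).arr = f) :
    ord.comp (M.oneNode f) p T = T := by
  rw [comp, ord.oneNode_plug f p T h, TaggedTree.under_rename, under_number]

theorem one_comp_φ (f : M.Arr) (p) (T : M.PlanarTree)
    (h : (eval T.2).arr = ord.src (M.oneNode f) p) (r) :
    (ord.amalg (M.oneNode f) p T h (Sum.inr r) : ℕ) = r := by
  have h1 := ord.num_amalg (M.oneNode f) p T h (Sum.inr r)
  have h0 := h.trans (ord.src_oneNode f p)
  rw [ord.oneNode_plug f p T h0] at h1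
  exact h1.unique (TaggedTree.injective_rename (ord.injective_number T) _ Sum.inr_injective)
    ((ord.num_number T r).rename Sum.inr)

open Classical in
theorem plug_oneNode (T : M.PlanarTree) (p) (f : M.Arr) :
    (ord.number T).plug p (ord.number (M.oneNode f)) =
      ⟨T.1, relabel (fun c => if c.1 = p ∧ c.2 = f then
        Sum.inr (ord (M.oneNode f) (Sum.inl ⟨⟩)) else Sum.inl c.1) (ord.number T).2⟩ := by
  rw [number_oneNode]
  exact TaggedTree.plug_single _ _ _ _ _ (fun c h => if_pos h) (fun c h => if_neg h)

theorem comp_one (T : M.PlanarTree) (p) (f : M.Arr) :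
    ord.comp T p (M.oneNode f) = T := by
  rw [comp, plug_oneNode]
  refine Eq.trans ?_ (ord.under_number T)
  exact congrArg (fun u : Σ S : Tree M.sig (fun f : M.Arr => f) Discrete.mk T.1, S.Nodes → _ =>
    (⟨T.1, u.1⟩ : M.PlanarTree)) (untag_relabel _ _)

open Classical in
theorem num_comp_one (T : M.PlanarTree) (p) (f : M.Arr) (k) :
    ((ord.number T).plug p (ord.number (M.oneNode f))).Num ord
      (if k = p ∧ ord.src T k = f then
        Sum.inr (ord (M.oneNode f) (Sum.inl ⟨⟩)) else Sum.inl k) k := by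
  rw [plug_oneNode]
  have : ∀ u : Σ S : Tree M.sig (fun f : M.Arr => f) Discrete.mk T.1,
      S.Nodes → (Fin (Fintype.card T.2.Nodes) ⊕ Fin (Fintype.card (M.oneNode f).2.Nodes)),
      u = ⟨T.2, fun N => if ord T N = p ∧ T.2.nodeName N = f then
        Sum.inr (ord (M.oneNode f) (Sum.inl ⟨⟩)) else Sum.inl (ord T N)⟩ →
      ∃ N : u.1.Nodes, u.2 N = (if k = p ∧ ord.src T k = f then
        Sum.inr (ord (M.oneNode f) (Sum.inl ⟨⟩)) else Sum.inl k) ∧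
        (ord ⟨T.1, u.1⟩ N : ℕ) = k := by
    rintro _ rfl
    refine ⟨(ord T).symm k, ?_, congrArg Fin.val ((ord T).apply_symm_apply k)⟩
    simp only [Equiv.apply_symm_apply]
    rfl
  refine this _ ((untag_relabel _ _).trans ?_)
  exact congrArg (fun u : Σ S : Tree M.sig (fun f : M.Arr => f) Discrete.mk T.1,
      S.Nodes → Fin (Fintype.card T.2.Nodes) =>
    (⟨u.1, fun N => if u.2 N = p ∧ u.1.nodeName N = f then
        Sum.inr (ord (M.oneNode f) (Sum.inl ⟨⟩)) else Sum.inl (u.2 N)⟩ :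
      Σ S : Tree M.sig (fun f : M.Arr => f) Discrete.mk T.1,
      S.Nodes → (Fin (Fintype.card T.2.Nodes) ⊕ Fin (Fintype.card (M.oneNode f).2.Nodes))))
    (untag_tag T.2 (ord T))

theorem comp_one_ψ (T : M.PlanarTree) (p) (f : M.Arr)
    (h : (eval (M.oneNode f).2).arr = ord.src T p) (q) :
    (ord.amalg T p (M.oneNode f) h (Sum.inl q) : ℕ) = q.1 := by
  have h1 := ord.num_amalg T p (M.oneNode f) h (Sum.inl q)
  have h2 := ord.num_comp_one T p f q.1
  rw [if_neg (fun h => q.2 h.1)] at h2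
  exact h1.unique (ord.injective_plug T p _ h) h2

theorem comp_one_φ (T : M.PlanarTree) (p) (f : M.Arr)
    (h : (eval (M.oneNode f).2).arr = ord.src T p) (r) :
    (ord.amalg T p (M.oneNode f) h (Sum.inr r) : ℕ) = p := by
  have h1 := ord.num_amalg T p (M.oneNode f) h (Sum.inr r)
  have h2 := ord.num_comp_one T p f p
  rw [if_pos ⟨rfl, h.symm.trans (NodeOrder.eval_oneNode f)⟩, ← ord.eq_oneNode f r] at h2
  exact h1.unique (ord.injective_plug T p _ h) h2

theorem left_eq (T₁ : M.PlanarTree) (p : Fin (Fintype.card T₁.2.Nodes))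
    (T₂ : M.PlanarTree) (h₁ : (eval T₂.2).arr = ord.src T₁ p) (p') (T₃ : M.PlanarTree) :
    ((ord.number (ord.comp T₁ p T₂)).plug p' (ord.number T₃)).rename
      (Sum.map (ord.origin T₁ p T₂) id) =
    ((ord.number T₁).plug p (ord.number T₂)).plug (ord.origin T₁ p T₂ p') (ord.number T₃) := by
  rw [← TaggedTree.rename_plug _ _ _ _ (ord.origin_injective T₁ p T₂ h₁), number_rename_origin]

theorem injective_left (T₁ : M.PlanarTree) (p : Fin (Fintype.card T₁.2.Nodes))
    (T₂ : M.PlanarTree) (h₁ : (eval T₂.2).arr = ord.src T₁ p) (p') (T₃ : M.PlanarTree)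
    (h₃ : (eval T₃.2).arr = ord.src (ord.comp T₁ p T₂) p') : Function.Injective
    (untag (((ord.number T₁).plug p (ord.number T₂)).plug
      (ord.origin T₁ p T₂ p') (ord.number T₃)).2).2 := by
  rw [← ord.left_eq T₁ p T₂ h₁ p' T₃]
  exact TaggedTree.injective_rename (ord.injective_plug _ _ _ h₃) _
    (Function.Injective.sumMap (ord.origin_injective T₁ p T₂ h₁) Function.injective_id)

theorem num_left (T₁ : M.PlanarTree) (p : Fin (Fintype.card T₁.2.Nodes))
    (T₂ : M.PlanarTree) (h₁ : (eval T₂.2).arr = ord.src T₁ p) (p') (T₃ : M.PlanarTree)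
    (h₃ : (eval T₃.2).arr = ord.src (ord.comp T₁ p T₂) p') (c) :
    (((ord.number T₁).plug p (ord.number T₂)).plug (ord.origin T₁ p T₂ p') (ord.number T₃)).Num ord
      (Sum.map (fun q => ord.origin T₁ p T₂ q.1) id c)
      (ord.amalg (ord.comp T₁ p T₂) p' T₃ h₃ c) := by
  rw [← ord.left_eq T₁ p T₂ h₁ p' T₃]
  have := (ord.num_amalg (ord.comp T₁ p T₂) p' T₃ h₃ c).rename (Sum.map (ord.origin T₁ p T₂) id)
  rcases c with c | c <;> exact this

theorem right_eq (T₁ : M.PlanarTree) (p : Fin (Fintype.card T₁.2.Nodes))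
    (T₂ : M.PlanarTree) (q : Fin (Fintype.card T₂.2.Nodes)) (T₃ : M.PlanarTree) :
    ((ord.number T₁).plug p (ord.number (ord.comp T₂ q T₃))).rename
      (Sum.map id (ord.origin T₂ q T₃)) =
    (ord.number T₁).plug p ((ord.number T₂).plug q (ord.number T₃)) := by
  rw [← TaggedTree.plug_rename, number_rename_origin]

theorem num_right (T₁ : M.PlanarTree) (p : Fin (Fintype.card T₁.2.Nodes))
    (T₂ : M.PlanarTree) (q : Fin (Fintype.card T₂.2.Nodes)) (T₃ : M.PlanarTree)
    (h₃ : (eval (ord.comp T₂ q T₃).2).arr = ord.src T₁ p) (c) :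
    ((ord.number T₁).plug p ((ord.number T₂).plug q (ord.number T₃))).Num ord
      (Sum.map Subtype.val (ord.origin T₂ q T₃) c)
      (ord.amalg T₁ p (ord.comp T₂ q T₃) h₃ c) := by
  rw [← ord.right_eq T₁ p T₂ q T₃]
  have := (ord.num_amalg T₁ p (ord.comp T₂ q T₃) h₃ c).rename (Sum.map id (ord.origin T₂ q T₃))
  rcases c with c | c <;> exact this

theorem assoc (T₁ : M.PlanarTree) (p : Fin (Fintype.card T₁.2.Nodes)) (T₂ : M.PlanarTree)
    (h₁ : (eval T₂.2).arr = ord.src T₁ p) (q : Fin (Fintype.card T₂.2.Nodes))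
    (T₃ : M.PlanarTree) :
    ord.comp (ord.comp T₁ p T₂) (ord.amalg T₁ p T₂ h₁ (Sum.inr q)) T₃ =
      ord.comp T₁ p (ord.comp T₂ q T₃) := by
  have h1 := congrArg TaggedTree.under
    (ord.left_eq T₁ p T₂ h₁ (ord.amalg T₁ p T₂ h₁ (Sum.inr q)) T₃)
  have h2 := congrArg TaggedTree.under (ord.right_eq T₁ p T₂ q T₃)
  rw [TaggedTree.under_rename] at h1 h2
  refine h1.trans (Eq.trans ?_ h2.symm)
  rw [origin_amalg, ← TaggedTree.plug_assoc, TaggedTree.under_rename]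
  rfl

theorem assoc_num (T₁ : M.PlanarTree) (p : Fin (Fintype.card T₁.2.Nodes)) (T₂ : M.PlanarTree)
    (h₁ : (eval T₂.2).arr = ord.src T₁ p) (q : Fin (Fintype.card T₂.2.Nodes))
    (T₃ : M.PlanarTree)
    (h₂ : (eval T₃.2).arr =
      ord.src (ord.comp T₁ p T₂) (ord.amalg T₁ p T₂ h₁ (Sum.inr q)))
    (h₃ : (eval (ord.comp T₂ q T₃).2).arr = ord.src T₁ p) (c d)
    (hcd : Equiv.sumAssoc _ _ _ (Sum.map (fun q => ord.origin T₁ p T₂ q.1) id c) =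
      Sum.map Subtype.val (ord.origin T₂ q T₃) d) :
    (ord.amalg (ord.comp T₁ p T₂) (ord.amalg T₁ p T₂ h₁ (Sum.inr q)) T₃ h₂ c : ℕ) =
      ord.amalg T₁ p (ord.comp T₂ q T₃) h₃ d := by
  have h1 := ord.num_left T₁ p T₂ h₁ _ T₃ h₂ c
  have h1' := ord.injective_left T₁ p T₂ h₁ _ T₃ h₂
  have h2 := ord.num_right T₁ p T₂ q T₃ h₃ d
  rw [origin_amalg] at h1 h1'
  have h3 := h1.rename (Equiv.sumAssoc _ _ _)
  have h3' := TaggedTree.injective_rename h1' _ (Equiv.sumAssoc _ _ _).injective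
  rw [hcd] at h3
  rw [Sum.map_inr, TaggedTree.plug_assoc] at h3 h3'
  exact h3.unique h3' h2

theorem swap_injective (I J L : Type) : Function.Injective (TaggedTree.swap I J L) := by
  rintro ((c | c) | c) ((d | d) | d) h <;> simp_all [TaggedTree.swap]

theorem comm (T : M.PlanarTree) (p q : Fin (Fintype.card T.2.Nodes)) (T₁ T₂ : M.PlanarTree)
    (h₁ : (eval T₁.2).arr = ord.src T p) (h₂ : (eval T₂.2).arr = ord.src T q) (hqp : q ≠ p)
    (hpq : p ≠ q) :
    ord.comp (ord.comp T p T₁) (ord.amalg T p T₁ h₁ (Sum.inl ⟨q, hqp⟩)) T₂ =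
      ord.comp (ord.comp T q T₂) (ord.amalg T q T₂ h₂ (Sum.inl ⟨p, hpq⟩)) T₁ := by
  have h1 := congrArg TaggedTree.under
    (ord.left_eq T p T₁ h₁ (ord.amalg T p T₁ h₁ (Sum.inl ⟨q, hqp⟩)) T₂)
  have h2 := congrArg TaggedTree.under
    (ord.left_eq T q T₂ h₂ (ord.amalg T q T₂ h₂ (Sum.inl ⟨p, hpq⟩)) T₁)
  rw [TaggedTree.under_rename, origin_amalg] at h1 h2
  refine h1.trans (Eq.trans ?_ h2.symm)
  refine Eq.trans ?_ (congrArg TaggedTree.under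
    (TaggedTree.plug_comm (ord.number T) p q hqp (ord.number T₁) (ord.number T₂)))
  rw [TaggedTree.under_rename]
  rfl

theorem comm_num (T : M.PlanarTree) (p q : Fin (Fintype.card T.2.Nodes)) (T₁ T₂ : M.PlanarTree)
    (h₁ : (eval T₁.2).arr = ord.src T p) (h₂ : (eval T₂.2).arr = ord.src T q) (hqp : q ≠ p)
    (hpq : p ≠ q)
    (h₃ : (eval T₂.2).arr = ord.src (ord.comp T p T₁) (ord.amalg T p T₁ h₁ (Sum.inl ⟨q, hqp⟩)))
    (h₄ : (eval T₁.2).arr = ord.src (ord.comp T q T₂) (ord.amalg T q T₂ h₂ (Sum.inl ⟨p, hpq⟩)))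
    (c d) (hcd : TaggedTree.swap _ _ _ (Sum.map (fun q => ord.origin T p T₁ q.1) id c) =
      Sum.map (fun p => ord.origin T q T₂ p.1) id d) :
    (ord.amalg (ord.comp T p T₁) (ord.amalg T p T₁ h₁ (Sum.inl ⟨q, hqp⟩)) T₂ h₃ c : ℕ) =
      ord.amalg (ord.comp T q T₂) (ord.amalg T q T₂ h₂ (Sum.inl ⟨p, hpq⟩)) T₁ h₄ d := by
  have h1 := ord.num_left T p T₁ h₁ _ T₂ h₃ c
  have h1' := ord.injective_left T p T₁ h₁ _ T₂ h₃
  have h2 := ord.num_left T q T₂ h₂ _ T₁ h₄ d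
  rw [origin_amalg] at h1 h1' h2
  have h3 := h1.rename (TaggedTree.swap _ _ _)
  have h3' := TaggedTree.injective_rename h1' _ (swap_injective _ _ _)
  rw [hcd] at h3
  rw [Sum.map_inl, TaggedTree.plug_comm _ _ _ hqp] at h3 h3'
  exact h3.unique h3' h2

end NodeOrder

/-- The slice `M₊` of a generalised multicategory `M`, built by means of a chosen order on the
nodes of each tree.
Its objects are the arrows of `M`. Its arrows are the trees whose nodes are labelled by arrows
of `M`; the sources of a tree are the arrows at its nodes, listed in the chosen order, and its
target is the composite of these arrows along the tree. Trees are composed by replacing a node by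
a tree, and the amalgamating maps keep track of the nodes. -/
noncomputable def slice (M : GenMulticat) (ord : M.NodeOrder) : GenMulticat where
  Obj := M.Arr
  Arr := M.PlanarTree
  ar T := Fintype.card T.2.Nodes
  src := ord.src
  tgt T := (eval T.2).arr
  comp T₁ p T₂ _ := ord.comp T₁ p T₂
  tgt_comp T₁ p T₂ _ := ord.tgt_comp T₁ p T₂
  amalg := ord.amalg
  src_ψ T₁ p T₂ h q := ord.src_amalg T₁ p T₂ h (Sum.inl q)
  src_φ T₁ p T₂ h r := ord.src_amalg T₁ p T₂ h (Sum.inr r)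
  one f := M.oneNode f
  ar_one f := NodeOrder.card_oneNode f
  src_one f p := ord.src_oneNode f p
  tgt_one f := NodeOrder.eval_oneNode f
  one_comp f p T h := ord.one_comp f p T (h.trans (ord.src_oneNode f p))
  one_comp_φ f p T h r := ord.one_comp_φ f p T h r
  comp_one T p f _ := ord.comp_one T p f
  comp_one_ψ T p f h q := ord.comp_one_ψ T p f h q
  comp_one_φ T p f h r := ord.comp_one_φ T p f h r
  assoc T₁ p T₂ h₁ q T₃ _ _ _ := ord.assoc T₁ p T₂ h₁ q T₃
  assoc_f T₁ p T₂ h₁ q T₃ h₂ _ h₃ r hr hr' := by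
    refine ord.assoc_num T₁ p T₂ h₁ q T₃ h₂ h₃ _ _ ?_
    simp only [Sum.map_inl, NodeOrder.origin_amalg]
    rfl
  assoc_g T₁ p T₂ h₁ q T₃ h₂ h₂' h₃ r hr hr' := by
    refine ord.assoc_num T₁ p T₂ h₁ q T₃ h₂ h₃ _ _ ?_
    simp only [Sum.map_inl, Sum.map_inr, NodeOrder.origin_amalg]
    rfl
  assoc_h T₁ p T₂ h₁ q T₃ h₂ h₂' h₃ r := by
    refine ord.assoc_num T₁ p T₂ h₁ q T₃ h₂ h₃ _ _ ?_
    simp only [Sum.map_inr, NodeOrder.origin_amalg]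
    rfl
  comm T p q T₁ T₂ h₁ h₂ hqp hpq _ _ := ord.comm T p q T₁ T₂ h₁ h₂ hqp hpq
  comm_f T p q T₁ T₂ h₁ h₂ hqp hpq h₃ h₄ r hrp hrq hr₁ hr₂ := by
    refine ord.comm_num T p q T₁ T₂ h₁ h₂ hqp hpq h₃ h₄ _ _ ?_
    simp only [Sum.map_inl, NodeOrder.origin_amalg]
    rfl
  comm_g T p q T₁ T₂ h₁ h₂ hqp hpq h₃ h₄ r hr₁ := by
    refine ord.comm_num T p q T₁ T₂ h₁ h₂ hqp hpq h₃ h₄ _ _ ?_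
    simp only [Sum.map_inl, Sum.map_inr, NodeOrder.origin_amalg]
    rfl
  comm_h T p q T₁ T₂ h₁ h₂ hqp hpq h₃ h₄ r hr₂ := by
    refine ord.comm_num T p q T₁ T₂ h₁ h₂ hqp hpq h₃ h₄ _ _ ?_
    simp only [Sum.map_inl, Sum.map_inr, NodeOrder.origin_amalg]
    rfl

end

end GenMulticat

/-! ### Opetopes and multitopes -/

/-- The symmetric multicategory `I` with precisely one object, precisely one object-morphism and
precisely one arrow, which is the identity: there is one arrow for every index set with exactly
one element, and there is no arrow for the other index sets. -/
def initialSym : SymMulticat where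
  Obj := Discrete PUnit
  Hom I _ _ _ := I ≃ PUnit.{1}
  ι _ := Equiv.refl _
  comp {I _ _ _ _ _ _} f g := (Equiv.sigmaCongrRight g).trans ((sigmaPUnit I).trans f)
  perm e _ _ f := e.symm.trans f
  id_comp _ := Subsingleton.elim _ _
  comp_id _ := Subsingleton.elim _ _
  assoc _ _ _ := Subsingleton.elim _ _
  perm_refl _ := Subsingleton.elim _ _
  perm_perm _ _ _ _ _ := Subsingleton.elim _ _
  perm_comp := by intros; exact Subsingleton.elim _ _
  comp_perm := by intros; exact Subsingleton.elim _ _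
  ι_comp _ _ := Subsingleton.elim _ _

/-- The iterated slices of `I`. -/
def opetopeMulticat : ℕ → SymMulticat
  | 0 => initialSym
  | k + 1 => (opetopeMulticat k).slice

/-- The category of `k`-opetopes. -/
abbrev Opetope (k : ℕ) : Type := (opetopeMulticat k).Obj

/-- The generalised multicategory `J` with precisely one object and precisely one arrow,
which is the identity. -/
def initialGen : GenMulticat where
  Obj := PUnit
  Arr := PUnit
  ar _ := 1
  src _ _ := ⟨⟩
  tgt _ := ⟨⟩
  comp _ _ _ _ := ⟨⟩
  tgt_comp _ _ _ _ := rfl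
  amalg _ _p _ _ :=
    have : IsEmpty {q : Fin 1 // q ≠ _p} := ⟨fun q => q.2 (Subsingleton.elim _ _)⟩
    Equiv.emptySum _ _
  src_ψ _ _ _ _ _ := rfl
  src_φ _ _ _ _ _ := rfl
  one _ := ⟨⟩
  ar_one _ := rfl
  src_one _ _ := rfl
  tgt_one _ := rfl
  one_comp _ _ _ _ := rfl
  one_comp_φ _ _ _ _ _ := congrArg Fin.val (Subsingleton.elim _ _)
  comp_one _ _ _ _ := rfl
  comp_one_ψ _ _ _ _ q := (q.2 (Subsingleton.elim _ _)).elim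
  comp_one_φ _ _ _ _ _ := congrArg Fin.val (Subsingleton.elim _ _)
  assoc _ _ _ _ _ _ _ _ _ := rfl
  assoc_f _ _ _ _ _ _ _ _ _ _ _ _ := congrArg Fin.val (Subsingleton.elim _ _)
  assoc_g _ _ _ _ _ _ _ _ _ _ _ _ := congrArg Fin.val (Subsingleton.elim _ _)
  assoc_h _ _ _ _ _ _ _ _ _ _ := congrArg Fin.val (Subsingleton.elim _ _)
  comm _ _ _ _ _ _ _ _ _ _ _ := rfl
  comm_f _ _ _ _ _ _ _ _ _ _ _ _ _ _ _ _ := congrArg Fin.val (Subsingleton.elim _ _)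
  comm_g _ _ _ _ _ _ _ _ _ _ _ _ _ := congrArg Fin.val (Subsingleton.elim _ _)
  comm_h _ _ _ _ _ _ _ _ _ _ _ _ _ := congrArg Fin.val (Subsingleton.elim _ _)

/-- The iterated slices of `J`, formed with given choices of orders on the nodes of trees,
one choice for every stage. -/
noncomputable def multitopeMulticat (ord : ∀ (_ : ℕ) (M : GenMulticat), M.NodeOrder) :
    ℕ → GenMulticat
  | 0 => initialGen
  | k + 1 => (multitopeMulticat ord k).slice (ord k _)

/-- The set of `k`-multitopes. -/
abbrev Multitope (ord : ∀ (_ : ℕ) (M : GenMulticat), M.NodeOrder) (k : ℕ) : Type :=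
  (multitopeMulticat ord k).Obj

end Opetopic

/-! A generalised multicategory `M` generates a free symmetric multicategory, whose arrows are the
arrows of `M` with a bijective naming of their sources. The reason for the theorem is that, up to
equivalence on objects, the iterated slices of `I` are the free symmetric multicategories on the
iterated slices of `J`. This relation is recorded by `Comparison Q M`: object-morphisms of `Q` are
unique and exist exactly between objects with the same image in `M`, and arrows of `Q` are arrows of
`M` with bijectively named sources, compatibly with renaming, composition and `ι`. The conditions on
objects alone make `Q.Obj ⥤ Discrete M.Obj` an equivalence, so it suffices to have a comparison for
every `k`. The case of `I` and `J` is immediate, and the inductive step is `Comparison.slice`.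

On objects of the slices: a morphism in the category of elements has to match sources at the same
position of the underlying arrow of `M`, so its permutation is forced, and its object-morphisms are
unique. Hence elements of `Q` up to isomorphism are the arrows of `M`.

On arrows: a tree over `Q` becomes a tree over `M` when the inputs of each node are listed in the
order of the corresponding arrow of `M` (`Comparison.tree`); the edge labels carry no information.
That composing along `T` gives `f` becomes the equation `eval (R.tree T) = R.arr f.hom`
(`composes_iff`). Arrows of `M₊` have no names on their leaves, but such names are no additional
data: evaluation in `M` matches each leaf with a definite source of the composite. So a tree with
named leaves is determined by its shape, the names of its nodes and its value
(`eq_of_tagged_of_eval`), and every arrow of `M₊` arises from such a tree (`exists_encode`).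

What remains is composition. In `M₊` one node is replaced at a time, and `Named.bind` iterates this,
whereas `Q⁺` substitutes trees for all nodes at once. The two are reconciled by `encode_bind`, an
induction along `Reduces` that rests on `encode_plug` and the associativity of substitution. -/

namespace Opetopic

namespace GenMulticat

/-! ### Trees with named leaves over a generalised multicategory -/

section

variable {M : GenMulticat} {I J K K' : Type}

/-- Edge labels lie in a discrete category, so they never obstruct an equality of trees over
`M.sig`. -/
theorem node_congr {F : I → M.Arr} {l : K → Discrete M.Obj} {z : Discrete M.Obj} (i : I)
    (a a' : M.sig.tgt (F i) ⟶ z) {ch ch' : ∀ j : Fin (M.ar (F i)), Tree M.sig F l (M.sig.src (F i) j)}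
    (h : ∀ j, ch j = ch' j) :
    (Tree.node (S := M.sig) i a ch : Tree M.sig F l z) = Tree.node (S := M.sig) i a' ch' := by
  obtain rfl : ch = ch' := funext h
  rw [Subsingleton.elim a a']

theorem post_injective {F : I → M.Arr} {l : K → Discrete M.Obj} {z w : Discrete M.Obj}
    (a : z ⟶ w) {V V' : Tree M.sig F l z} (h : V.post a = V'.post a) : V = V' := by
  obtain rfl : z = w := Discrete.ext (Discrete.eq_of_hom a)
  obtain rfl : 𝟙 z = a := Subsingleton.elim _ _
  rwa [Tree.post_id, Tree.post_id] at h

/-- A morphism of a discrete category is an equality, so `post` merely transports the tree; packing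
the root object into the pair hides the transport. -/
theorem sigma_post {F : I → M.Arr} {l : K → Discrete M.Obj} {z w : Discrete M.Obj}
    (V : Tree M.sig F l z) (a : z ⟶ w) :
    (⟨w, V.post a⟩ : Σ z, Tree M.sig F l z) = ⟨z, V⟩ := by
  obtain rfl : z = w := Discrete.ext (Discrete.eq_of_hom a)
  obtain rfl : 𝟙 z = a := Subsingleton.elim _ _
  rw [Tree.post_id]

/-- Trees of the same shape are two renamings of one tree `P` whose leaves are named by pairs.
Equality of the values says that the two components agree at every source of the composite along
`P`, and by `leafSum_eval` the leaves are counted by these sources, so no leaf carries an unequal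
pair. -/
theorem eq_of_close_of_eval {F : I → M.Arr} {x : K → Discrete M.Obj} {z : Discrete M.Obj}
    {V V' : Tree M.sig F x z} (h : close V = close V') (he : eval V = eval V') : V = V' := by
  classical
  obtain ⟨P, rfl, rfl⟩ := exists_pair V V' h
  rw [eval_graft_leaf, eval_graft_leaf] at he
  refine graft_congr_of_leafSum P _ _ (fun k => if k.1.1 = k.1.2 then 0 else 1) ?_ ?_
  · intro k hk
    exact leaf_congr (by simpa using hk) _ _
  · rw [leafSum_eval]
    exact Finset.sum_eq_zero fun p _ => if_pos (Named.name_congr he p p rfl)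

theorem close_post {F : I → M.Arr} {l : K → Discrete M.Obj} {z w : Discrete M.Obj}
    (V : Tree M.sig F l z) (a : z ⟶ w) : close (V.post a) = (close V).post a :=
  Tree.graft_post (S := M.sig) _ V a

theorem close_graft_leaf {F : I → M.Arr} {l : K → Discrete M.Obj} {l' : K' → Discrete M.Obj}
    (m : K → K') (a : ∀ k, l' (m k) ⟶ l k) {z : Discrete M.Obj} (V : Tree M.sig F l z) :
    close (V.graft fun k => Tree.leaf (m k) (a k)) = close V := by
  refine (Tree.graft_graft (S := M.sig) _ _ V).trans ?_
  refine congrArg (fun t => V.graft t) (funext fun k => leaf_congr ?_ _ _)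
  exact Discrete.eq_of_hom (a k)

theorem close_subst {F : I → M.Arr} {G : J → M.Arr} {l : K → Discrete M.Obj} {z : Discrete M.Obj}
    (U : ∀ i, Tree M.sig G (M.sig.src (F i)) (M.sig.tgt (F i))) (V : Tree M.sig F l z) :
    close (V.subst U) = (close V).subst U :=
  (Tree.subst_graft (S := M.sig) U
    (fun k => Tree.leaf (x := Discrete.mk) (l k).as (𝟙 (l k))) V).symm

/-- Add the arrow of each node to its name. -/
def expand {x : I → M.Arr} {l : K → Discrete M.Obj} {z : Discrete M.Obj} (V : Tree M.sig x l z) :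
    Tree M.sig (fun c : I × M.Arr => c.2) l z :=
  Tree.rename (S := M.sig) (G := fun c : I × M.Arr => c.2) (fun i => (i, x i)) V

theorem expand_post {x : I → M.Arr} {l : K → Discrete M.Obj} {z w : Discrete M.Obj}
    (V : Tree M.sig x l z) (a : z ⟶ w) : expand (V.post a) = (expand V).post a :=
  Tree.rename_post (S := M.sig) (G := fun c : I × M.Arr => c.2) (fun i => (i, x i)) V a

theorem expand_graft {x : I → M.Arr} {l : K → Discrete M.Obj} {l' : K' → Discrete M.Obj}
    (t : ∀ k, Tree M.sig x l' (l k)) {z : Discrete M.Obj} (V : Tree M.sig x l z) :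
    expand (V.graft t) = (expand V).graft fun k => expand (t k) :=
  Tree.rename_graft (S := M.sig) (G := fun c : I × M.Arr => c.2) (fun i => (i, x i)) t V

theorem close_expand {x : I → M.Arr} {l : K → Discrete M.Obj} {z : Discrete M.Obj}
    (V : Tree M.sig x l z) : close (expand V) = expand (close V) :=
  (expand_graft (fun k => Tree.leaf (x := Discrete.mk) (l k).as (𝟙 (l k))) V).symm

theorem expand_subst {x : I → M.Arr} {y : J → M.Arr} {l : K → Discrete M.Obj} {z : Discrete M.Obj}
    (U : ∀ i, Tree M.sig y (M.sig.src (x i)) (M.sig.tgt (x i))) (V : Tree M.sig x l z) :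
    expand (V.subst U) = V.subst fun i => expand (U i) :=
  Tree.subst_rename (S := M.sig) (H := fun c : J × M.Arr => c.2) (fun j => (j, y j)) U V

theorem subst_expand {x : I → M.Arr} {y : J → M.Arr} {l : K → Discrete M.Obj} {z : Discrete M.Obj}
    (U : ∀ c : I × M.Arr, Tree M.sig y (M.sig.src c.2) (M.sig.tgt c.2)) (V : Tree M.sig x l z) :
    (expand V).subst U = V.subst fun i => U (i, x i) :=
  Tree.rename_subst (S := M.sig) (G := fun c : I × M.Arr => c.2) (fun i => (i, x i)) U V

theorem eval_expand {x : I → M.Arr} {l : K → Discrete M.Obj} {z : Discrete M.Obj}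
    (V : Tree M.sig x l z) : eval (expand V) = eval V :=
  eval_rename (G := fun c : I × M.Arr => c.2) (fun i => (i, x i)) V

theorem nodeSum_expand {x : I → M.Arr} {l : K → Discrete M.Obj} {z : Discrete M.Obj}
    (V : Tree M.sig x l z) (w : I × M.Arr → ℕ) :
    (expand V).nodeSum w = V.nodeSum fun i => w (i, x i) :=
  Tree.nodeSum_rename (S := M.sig) (G := fun c : I × M.Arr => c.2) (fun i => (i, x i)) w V

theorem expand_injective {x : I → M.Arr} {l : K → Discrete M.Obj} {z : Discrete M.Obj}
    {V V' : Tree M.sig x l z} (h : expand V = expand V') : V = V' := by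
  induction V with
  | leaf k a =>
    cases V' with
    | leaf k' a' =>
      simp only [expand, Tree.rename] at h
      injection h with h1 h2
      exact leaf_congr h2 _ _
    | node => simp [expand, Tree.rename] at h
  | node i a ch ih =>
    cases V' with
    | leaf => simp [expand, Tree.rename] at h
    | node i' a' ch' =>
      simp only [expand, Tree.rename] at h
      injection h with h1 h2 h3 h4
      obtain rfl : i = i' := congrArg Prod.fst h2
      exact node_congr i _ _ fun j => ih j (congrFun (eq_of_heq h4) j)

-- The sum counts the nodes whose arrow differs from the one prescribed by their name. If there are
-- none, the arrow in the tag is redundant.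
open Classical in
theorem exists_expand (x : I → M.Arr) {l : K → Discrete M.Obj} {z : Discrete M.Obj}
    (V : Tree M.sig (fun c : I × M.Arr => c.2) l z)
    (h : V.nodeSum (fun c => if c.2 = x c.1 then 0 else 1) = 0) :
    ∃ W : Tree M.sig x l z, expand W = V := by
  induction V with
  | leaf k a => exact ⟨Tree.leaf k a, rfl⟩
  | node c a ch ih =>
    simp only [Tree.nodeSum, Nat.add_eq_zero_iff, Finset.sum_eq_zero_iff] at h
    obtain ⟨i, f⟩ := c
    obtain rfl : f = x i := by simpa using h.1
    choose W hW using fun j => ih j (h.2 j (Finset.mem_univ j))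
    exact ⟨Tree.node (S := M.sig) (F := x) i a W,
      congrArg (Tree.node (S := M.sig) (F := fun c : I × M.Arr => c.2) (i, x i) a) (funext hW)⟩

/-- Forget the names of the leaves of a tree. -/
abbrev tagged {x : I → M.Arr} {l : K → Discrete M.Obj} {z : Discrete M.Obj}
    (V : Tree M.sig x l z) : M.TaggedTree I :=
  ⟨z, expand (close V)⟩

theorem tagged_post {x : I → M.Arr} {l : K → Discrete M.Obj} {z w : Discrete M.Obj}
    (V : Tree M.sig x l z) (a : z ⟶ w) : tagged (V.post a) = tagged V := by
  unfold tagged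
  rw [close_post, expand_post]
  exact sigma_post (expand (close V)) a

theorem tagged_graft_leaf {x : I → M.Arr} {l : K → Discrete M.Obj} {l' : K' → Discrete M.Obj}
    (m : K → K') (a : ∀ k, l' (m k) ⟶ l k) {z : Discrete M.Obj} (V : Tree M.sig x l z) :
    tagged (V.graft fun k => Tree.leaf (m k) (a k)) = tagged V := by
  unfold tagged
  rw [close_graft_leaf]

theorem tagged_rename {x : J → M.Arr} {l : K → Discrete M.Obj} {z : Discrete M.Obj} (m : I → J)
    (V : Tree M.sig (fun i => x (m i)) l z) :
    tagged (Tree.rename (S := M.sig) (G := x) m V) = (tagged V).rename m := by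
  refine congrArg (Sigma.mk z) ?_
  have h : close (Tree.rename (S := M.sig) (G := x) m V) =
      Tree.rename (S := M.sig) (G := x) m (close V) :=
    (Tree.rename_graft (S := M.sig) (G := x) m
      (fun k => Tree.leaf (x := Discrete.mk) (l k).as (𝟙 (l k))) V).symm
  rw [h]
  exact (Tree.rename_rename (S := M.sig) (H := fun c : J × M.Arr => c.2) m
    (fun j => (j, x j)) (close V)).trans
    (Tree.rename_rename (S := M.sig) (H := fun c : J × M.Arr => c.2) (fun i => (i, x (m i)))
      (fun c : I × M.Arr => (m c.1, c.2)) (close V)).symm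

theorem tagged_subst {x : I → M.Arr} {y : J → M.Arr} {l : K → Discrete M.Obj} {z : Discrete M.Obj}
    (U : ∀ i, Tree M.sig y (M.sig.src (x i)) (M.sig.tgt (x i))) (V : Tree M.sig x l z) :
    tagged (V.subst U) = ⟨z, (close V).subst fun i => expand (U i)⟩ := by
  unfold tagged
  rw [close_subst, expand_subst]

/-- Once the value is known, the names of the leaves carry no further information. This is what
allows arrows of `M₊`, which have no leaf names, to be compared with arrows of `Q⁺`, which have
them. -/
theorem eq_of_tagged_of_eval {x : I → M.Arr} {l : K → Discrete M.Obj} {z : Discrete M.Obj}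
    {V V' : Tree M.sig x l z} (h : tagged V = tagged V') (he : eval V = eval V') : V = V' :=
  eq_of_close_of_eval (expand_injective (eq_of_heq (Sigma.mk.inj h).2)) he

theorem nodeSum_tagged {x : I → M.Arr} {l : K → Discrete M.Obj} {z : Discrete M.Obj}
    (V : Tree M.sig x l z) (w : I × M.Arr → ℕ) :
    (tagged V).2.nodeSum w = V.nodeSum fun i => w (i, x i) := by
  have h : (tagged V).2 = close (expand V) := (close_expand V).symm
  rw [h, TaggedTree.nodeSum_close, nodeSum_expand]

theorem eval_tagged_arr {x : I → M.Arr} {l : K → Discrete M.Obj} {z : Discrete M.Obj}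
    (V : Tree M.sig x l z) : (eval (tagged V).2).arr = (eval V).arr := by
  refine (congrArg (fun b => b.arr) (eval_expand (close V))).trans ?_
  exact congrArg (fun b => b.arr) (eval_graft_leaf (x' := Discrete.mk)
    (fun k => (l k).as) (fun k => 𝟙 (l k)) V)

theorem isNamed_expand {x : I → M.Arr} {f : M.Arr} {V : Tree M.sig x (M.sig.src f) (M.sig.tgt f)}
    (h : eval V = Named.of f) : (tagged V).IsNamed f (expand V) :=
  ⟨congrArg (Sigma.mk (M.sig.tgt f)) (close_expand V), (eval_expand V).trans h⟩

end

/-! ### Arrows of the slice as trees -/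

section

variable {M : GenMulticat} {I J K : Type}

variable (ord : M.NodeOrder)

/-- The tree which an arrow of the slice consists of, its nodes carrying the names of the
sources. -/
def sliceTree {x : I → M.Arr} {f : M.Arr} (a : (M.slice ord).Named x f) : M.TaggedTree I :=
  (ord.number a.arr).rename a.name

theorem sliceTree_eq_tag {x : I → M.Arr} {f : M.Arr} (a : (M.slice ord).Named x f) :
    sliceTree ord a = ⟨a.arr.1, tag a.arr.2 fun N => a.name (ord a.arr N)⟩ := by
  have h := untag_relabel (fun c => a.name c.1) (ord.number a.arr).2
  -- `untag_tag` is an equation between dependent pairs; stating the claim for an arbitrary pair `u`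
  -- makes it possible to substitute it.
  have h2 : ∀ u : Σ T : Tree M.sig (fun f : M.Arr => f) Discrete.mk a.arr.1,
      T.Nodes → Fin (Fintype.card a.arr.2.Nodes), u = ⟨a.arr.2, ord a.arr⟩ →
      tag u.1 (fun N => a.name (u.2 N)) = tag a.arr.2 (fun N => a.name (ord a.arr N)) := by
    rintro _ rfl
    rfl
  refine congrArg (Sigma.mk a.arr.1) (Eq.trans ?_ (h2 _ (untag_tag a.arr.2 (ord a.arr))))
  refine (tag_untag _).symm.trans ?_
  exact congrArg (fun u : Σ T : Tree M.sig (fun f : M.Arr => f) Discrete.mk a.arr.1,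
    T.Nodes → I => tag u.1 u.2) h

/-- The order on the nodes depends on the planar tree only, so the tree together with the names at
its nodes recovers the names of the numbered sources. -/
theorem sliceTree_injective {x : I → M.Arr} {f : M.Arr} {a b : (M.slice ord).Named x f}
    (h : sliceTree ord a = sliceTree ord b) : a = b := by
  rw [sliceTree_eq_tag, sliceTree_eq_tag] at h
  obtain ⟨⟨z, T⟩, n, hs, ht⟩ := a
  obtain ⟨⟨z', T'⟩, n', hs', ht'⟩ := b
  obtain rfl : z = z' := congrArg Sigma.fst h
  have h1 := congrArg untag (eq_of_heq (Sigma.mk.inj h).2)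
  rw [untag_tag, untag_tag] at h1
  obtain rfl : T = T' := congrArg Sigma.fst h1
  have h2 := eq_of_heq (Sigma.mk.inj h1).2
  obtain rfl : n = n' := funext fun p => by
    have hp := (ord ⟨z, T⟩).apply_symm_apply p
    exact (congrArg n hp).symm.trans
      ((congrFun h2 ((ord ⟨z, T⟩).symm p)).trans (congrArg n' hp))
  rfl

theorem sliceTree_map {x : I → M.Arr} {y : J → M.Arr} {f : M.Arr} (m : I → J)
    (hm : ∀ i, y (m i) = x i) (a : (M.slice ord).Named x f) :
    sliceTree ord (GenMulticat.Named.map (M := M.slice ord) (x' := y) m hm a) =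
      (sliceTree ord a).rename m :=
  (TaggedTree.rename_rename a.name m (ord.number a.arr)).symm

theorem eval_sliceTree_arr {x : I → M.Arr} {f : M.Arr} (a : (M.slice ord).Named x f) :
    (eval (sliceTree ord a).2).arr = f := by
  refine (congrArg (fun b => b.arr) (TaggedTree.eval_rename a.name (ord.number a.arr))).trans ?_
  exact (congrArg (fun b => b.arr) (ord.eval_number a.arr)).trans a.tgt_eq

theorem sliceTree_nodeSum {x : I → M.Arr} {f : M.Arr} (a : (M.slice ord).Named x f)
    (w : I × M.Arr → ℕ) : (sliceTree ord a).2.nodeSum w =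
      ∑ p : Fin (Fintype.card a.arr.2.Nodes), w (a.name p, x (a.name p)) := by
  refine (nodeSum_relabel (fun c => a.name c.1) (ord.number a.arr).2 w).trans ?_
  refine (ord.nodeSum_number a.arr _).trans ?_
  refine Finset.sum_congr rfl fun p _ => congrArg (fun f => w (a.name p, f)) (a.src_eq p)

/-- The order chosen for the composite tree is unrelated to those of its two parts. Naming the nodes
through `origin` removes it from the computation. -/
theorem sliceTree_plug {x : I → M.Arr} {f g : M.Arr} (a : (M.slice ord).Named x f)
    (p : Fin ((M.slice ord).ar a.arr)) (b : (M.slice ord).Named x g)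
    (e : g = (M.slice ord).src a.arr p) :
    sliceTree ord (a.plug p b e) =
      ((ord.number a.arr).plug p (sliceTree ord b)).rename (Sum.elim a.name id) := by
  have h : (eval b.arr.2).arr = ord.src a.arr p := b.tgt_eq.trans e
  refine (congrArg (TaggedTree.rename · (ord.number (ord.comp a.arr p b.arr)))
    (?_ : _ = fun c => Sum.elim a.name b.name (ord.origin a.arr p b.arr c))).trans ?_
  · funext c
    -- Each node of the composite comes from one summand of the amalgamating bijection, and there
    -- both sides read off the name given by `a` or by `b`.
    obtain ⟨c, rfl⟩ := (ord.amalg a.arr p b.arr h).surjective c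
    rw [ord.origin_amalg a.arr p b.arr h]
    refine (congrArg (Sum.elim (fun q : {q // q ≠ p} => a.name q.1) b.name)
      (Equiv.symm_apply_apply (ord.amalg a.arr p b.arr h) c)).trans ?_
    rcases c with c | c <;> rfl
  · refine (TaggedTree.rename_rename (ord.origin a.arr p b.arr) (Sum.elim a.name b.name) _).symm.trans
      ?_
    refine (congrArg (TaggedTree.rename (Sum.elim a.name b.name))
      (ord.number_rename_origin a.arr p b.arr)).trans ?_
    refine Eq.trans ?_ (congrArg (TaggedTree.rename (Sum.elim a.name id))
      (TaggedTree.plug_rename (ord.number a.arr) p (ord.number b.arr) b.name)).symm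
    refine Eq.trans ?_ (TaggedTree.rename_rename (Sum.map id b.name) (Sum.elim a.name id) _).symm
    refine congrArg (TaggedTree.rename · _) (funext fun c => ?_)
    rcases c with c | c <;> rfl

theorem sliceTree_unit (x : I → M.Arr) (i : I) :
    sliceTree ord (GenMulticat.Named.unit (M := M.slice ord) (x := x) i) =
      tagged (Tree.corolla (S := M.sig) (F := x) i) := by
  refine (sliceTree_eq_tag ord _).trans ?_
  refine (NodeOrder.tag_oneNode (x i) (fun _ => i)).trans ?_
  rfl

/-- The arrow of the slice given by a tree. -/
noncomputable def decode {x : I → M.Arr} {l : K → Discrete M.Obj} {z : Discrete M.Obj}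
    (V : Tree M.sig x l z) {f : M.Arr} (h : (eval V).arr = f) : (M.slice ord).Named x f where
  arr := (tagged V).under
  name p := (untag (tagged V).2).2 ((ord (tagged V).under).symm p)
  src_eq p := by
    -- The number of nodes of `tagged V` whose arrow is not the one prescribed by their name is a
    -- sum of zeros.
    have h1 : ∀ N, (tagged V).under.2.nodeName N = x ((untag (tagged V).2).2 N) := by
      classical
      have h2 := TaggedTree.nodeSum_under (tagged V) (fun c => if c.2 = x c.1 then 0 else 1)
      rw [nodeSum_tagged, ← Tree.sum_nodes] at h2
      intro N
      have h3 := Finset.sum_eq_zero_iff.1 (h2.symm.trans (by simp)) N (Finset.mem_univ N)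
      simpa using h3
    exact h1 _
  tgt_eq := (congrArg (fun b => b.arr) (TaggedTree.eval_under (tagged V))).trans
    ((eval_tagged_arr V).trans h)

theorem sliceTree_decode {x : I → M.Arr} {l : K → Discrete M.Obj} {z : Discrete M.Obj}
    (V : Tree M.sig x l z) {f : M.Arr} (h : (eval V).arr = f) :
    sliceTree ord (decode ord V h) = tagged V := by
  refine (sliceTree_eq_tag ord _).trans (congrArg (Sigma.mk z) ?_)
  refine Eq.trans (congrArg (tag _) (funext fun N => ?_)) (tag_untag (tagged V).2)
  exact congrArg (untag (tagged V).2).2 ((ord (tagged V).under).symm_apply_apply N)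

/-- The leaves receive their names from the evaluation of the tree, by `exists_isNamed`. Since the
sources of `a` are the arrows prescribed by their names, the arrows in the tags can then be dropped
by `exists_expand`. -/
theorem exists_encode {x : I → M.Arr} {f : M.Arr} (a : (M.slice ord).Named x f) :
    ∃ V : Tree M.sig x (M.sig.src f) (M.sig.tgt f),
      tagged V = sliceTree ord a ∧ eval V = Named.of f := by
  classical
  obtain ⟨V, hV⟩ := TaggedTree.exists_isNamed _ f (eval_sliceTree_arr ord a)
  obtain ⟨W, rfl⟩ := exists_expand x V (by
    rw [← TaggedTree.nodeSum_close]
    have h := sliceTree_nodeSum ord a (fun c => if c.2 = x c.1 then 0 else 1)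
    rw [← hV.1] at h
    exact h.trans (Finset.sum_eq_zero fun p _ => if_pos rfl))
  refine ⟨W, ?_, (eval_expand W).symm.trans hV.2⟩
  rw [← hV.1, close_expand]

/-- The tree which an arrow of the slice consists of, with its leaves named by the sources of its
composite. -/
noncomputable def encode {x : I → M.Arr} {f : M.Arr} (a : (M.slice ord).Named x f) :
    Tree M.sig x (M.sig.src f) (M.sig.tgt f) :=
  (exists_encode ord a).choose

theorem tagged_encode {x : I → M.Arr} {f : M.Arr} (a : (M.slice ord).Named x f) :
    tagged (encode ord a) = sliceTree ord a :=
  (exists_encode ord a).choose_spec.1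

theorem eval_encode {x : I → M.Arr} {f : M.Arr} (a : (M.slice ord).Named x f) :
    eval (encode ord a) = Named.of f :=
  (exists_encode ord a).choose_spec.2

/-- The choice in `encode` is harmless, because shape, node names and value determine the tree. All
computations of `encode` go through this characterisation. -/
theorem encode_eq {x : I → M.Arr} {f : M.Arr} {a : (M.slice ord).Named x f}
    {V : Tree M.sig x (M.sig.src f) (M.sig.tgt f)} (h : tagged V = sliceTree ord a)
    (he : eval V = Named.of f) : encode ord a = V :=
  eq_of_tagged_of_eval ((tagged_encode ord a).trans h.symm) ((eval_encode ord a).trans he.symm)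

theorem encode_map {y : J → M.Arr} {f : M.Arr} (m : I → J)
    (a : (M.slice ord).Named (fun i => y (m i)) f) :
    encode ord (GenMulticat.Named.map (M := M.slice ord) (x' := y) m (fun _ => rfl) a) =
      Tree.rename (S := M.sig) (G := y) m (encode ord a) := by
  refine encode_eq ord ?_ ((eval_rename m _).trans (eval_encode ord a))
  rw [tagged_rename, tagged_encode]
  exact (sliceTree_map ord m (fun _ => rfl) a).symm

end

/-! ### Composition in the slice as substitution of trees -/

section

variable {M : GenMulticat} {I J K : Type}

/-- Transport a tree along an equality of arrows. -/
def along {F : I → M.Arr} {g g' : M.Arr} (h : g = g')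
    (V : Tree M.sig F (M.sig.src g) (M.sig.tgt g)) :
    Tree M.sig F (M.sig.src g') (M.sig.tgt g') :=
  h ▸ V

theorem eval_along {F : I → M.Arr} {g g' : M.Arr} (h : g = g')
    {V : Tree M.sig F (M.sig.src g) (M.sig.tgt g)} (hV : eval V = Named.of g) :
    eval (along h V) = Named.of g' := by
  subst h
  exact hV

theorem along_subst {F : I → M.Arr} {G : J → M.Arr} {g g' : M.Arr} (h : g = g')
    (V : Tree M.sig F (M.sig.src g) (M.sig.tgt g))
    (U : ∀ i, Tree M.sig G (M.sig.src (F i)) (M.sig.tgt (F i))) :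
    (along h V).subst U = along h (V.subst U) := by
  subst h
  rfl

theorem expand_along_corolla {x : I → M.Arr} {g : M.Arr} (i : I) (h : x i = g) :
    expand (along h (Tree.corolla (S := M.sig) (F := x) i)) =
      Tree.corolla (S := M.sig) (F := fun c : I × M.Arr => c.2) (i, g) := by
  subst h
  rfl

/-- Passes between substitution indexed by names and substitution indexed by pairs of a name and an
arrow, the form in which `TaggedTree.plug` is defined. Only the pairs `(i, x i)` occur at nodes of
`tagged V`. -/
theorem tagged_subst_eq {x : I → M.Arr} {y : J → M.Arr} {l : K → Discrete M.Obj}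
    {z : Discrete M.Obj} (V : Tree M.sig x l z) {S : M.TaggedTree I} (hS : tagged V = S)
    (U : ∀ i, Tree M.sig y (M.sig.src (x i)) (M.sig.tgt (x i)))
    (U' : ∀ c : I × M.Arr, Tree M.sig (fun d : J × M.Arr => d.2) (M.sig.src c.2) (M.sig.tgt c.2))
    (h : ∀ i, U' (i, x i) = expand (U i)) :
    tagged (V.subst U) = ⟨S.1, S.2.subst U'⟩ := by
  subst hS
  rw [tagged_subst]
  refine congrArg (Sigma.mk z) (Eq.symm ((subst_expand U' (close V)).trans ?_))
  exact congrArg (fun U => (close V).subst U) (funext h)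

variable (ord : M.NodeOrder)

theorem sliceTree_of (T : M.PlanarTree) :
    sliceTree ord (GenMulticat.Named.of (M := M.slice ord) T) = ord.number T :=
  sliceTree_eq_tag ord _

/-- Separates the tree from the naming of its nodes: in `Named.of T` each node is named by its own
number, and renaming is substitution of corollas. The transport `along` appears because `ord.src T
q` and `x (n q)` are only propositionally equal. -/
theorem encode_eq_subst {x : I → M.Arr} {T : M.PlanarTree}
    (n : Fin (Fintype.card T.2.Nodes) → I) (hs : ∀ p, ord.src T p = x (n p)) :
    encode ord (⟨T, n, hs, rfl⟩ : (M.slice ord).Named x ((M.slice ord).tgt T)) =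
      (encode ord (GenMulticat.Named.of (M := M.slice ord) T)).subst
        (F := ord.src T) (fun q => along (hs q).symm (Tree.corolla (S := M.sig) (F := x) (n q))) := by
  refine encode_eq ord ?_ ?_
  · refine (tagged_subst_eq _ ((tagged_encode ord _).trans (sliceTree_of ord T)) _
      (fun c => Tree.corolla (S := M.sig) (F := fun c : I × M.Arr => c.2) (n c.1, c.2))
      fun q => (expand_along_corolla (n q) (hs q).symm).symm).trans ?_
    exact congrArg (Sigma.mk T.1) (relabel_eq (fun c => n c.1) (ord.number T).2).symm
  · exact (eval_subst (F := ord.src T) _ (fun q => eval_along _ (eval_corolla (n q))) _).trans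
      (eval_encode ord _)

-- Several nodes may share the name `n p`, while only the node with number `p` is replaced. The
-- substitution is therefore made in the tree of `Named.of T`, whose nodes have distinct names, and
-- it renames the other nodes at the same time.
open Classical in
theorem encode_plug {x : I → M.Arr} {T : M.PlanarTree}
    (n : Fin (Fintype.card T.2.Nodes) → I) (hs : ∀ p, ord.src T p = x (n p))
    (p : Fin (Fintype.card T.2.Nodes)) (b : (M.slice ord).Named x (ord.src T p)) :
    encode ord (GenMulticat.Named.plug (M := M.slice ord) (x := x) ⟨T, n, hs, rfl⟩ p b rfl) =
      (encode ord (GenMulticat.Named.of (M := M.slice ord) T)).subst (F := ord.src T)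
        (fun q => if h : p = q then along (congrArg (ord.src T) h) (encode ord b) else
          along (hs q).symm (Tree.corolla (S := M.sig) (F := x) (n q))) := by
  refine encode_eq ord ?_ ?_
  · refine (tagged_subst_eq _ ((tagged_encode ord _).trans (sliceTree_of ord T)) _
      (fun c => relabel (fun d => Sum.elim n id d.1)
        (TaggedTree.replacement p (sliceTree ord b) c)) fun q => ?_).trans ?_
    · by_cases h : p = q
      · subst h
        rw [dif_pos rfl]
        -- The leaves of `encode ord b` are named as `replacement` demands, and such a tree is
        -- unique, so it is the one put in place of the node `p`.
        have h1 := isNamed_expand (eval_encode ord b)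
        rw [tagged_encode] at h1
        refine (congrArg (relabel fun d => Sum.elim n id d.1)
          (TaggedTree.replacement_pos (c := (p, ord.src T p)) rfl h1)).trans ?_
        refine (relabel_fst_fst Sum.inr (Sum.elim n id) _).trans ?_
        exact Tree.rename_id (S := M.sig) _
      · rw [dif_neg h]
        exact (congrArg (relabel fun d => Sum.elim n id d.1)
          (TaggedTree.replacement_neg (c := (q, ord.src T q)) fun h' => h h'.1.symm)).trans
          (expand_along_corolla (n q) (hs q).symm).symm
    · refine Eq.trans ?_ (sliceTree_plug ord
        (⟨T, n, hs, rfl⟩ : (M.slice ord).Named x ((M.slice ord).tgt T)) p b rfl).symm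
      exact congrArg (Sigma.mk T.1) (subst_relabel (fun d => Sum.elim n id d.1)
        (TaggedTree.replacement p (sliceTree ord b)) (ord.number T).2).symm
  · refine (eval_subst (F := ord.src T) _ (fun q => ?_) _).trans (eval_encode ord _)
    by_cases h : p = q
    · rw [dif_pos h]
      exact eval_along _ (eval_encode ord b)
    · rw [dif_neg h]
      exact eval_along _ (eval_corolla (n q))

/-- Associativity of substitution: if `W i` is already what `W` makes out of `b`, it does not matter
whether the node `p` is first replaced by `b` or receives `W i` directly. The other nodes, even
those also named `i`, are treated alike on both sides. -/
theorem encode_plug_subst {x : I → M.Arr} {y : J → M.Arr} {f : M.Arr}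
    (s : (M.slice ord).Named x f) (p : Fin ((M.slice ord).ar s.arr)) (i : I) (hi : s.name p = i)
    (b : (M.slice ord).Named x (x i)) (e : x i = (M.slice ord).src s.arr p)
    (W : ∀ i, Tree M.sig y (M.sig.src (x i)) (M.sig.tgt (x i)))
    (hW : (encode ord b).subst W = W i) :
    (encode ord (s.plug p b e)).subst W = (encode ord s).subst W := by
  classical
  obtain ⟨T, n, hs, rfl⟩ := s
  subst hi
  -- With the target of `b` replaced by a variable `g`, the equation `e` can be substituted, which
  -- brings the composite into the form of `encode_plug`.
  have key : ∀ (g : M.Arr) (h : x (n p) = g) (e : g = ord.src T p) (b' : (M.slice ord).Named x g),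
      (encode ord b').subst W = along h (W (n p)) →
      (encode ord (GenMulticat.Named.plug (M := M.slice ord) (x := x) ⟨T, n, hs, rfl⟩ p b' e)).subst
        W = (encode ord (⟨T, n, hs, rfl⟩ : (M.slice ord).Named x ((M.slice ord).tgt T))).subst W := by
    rintro _ h rfl b' hb
    refine Eq.trans (congrArg (Tree.subst W) (encode_plug ord n hs p b')) (Eq.trans ?_
      (congrArg (Tree.subst W) (encode_eq_subst ord n hs)).symm)
    refine (Tree.subst_subst (S := M.sig) _ _ _).trans
      (Eq.trans ?_ (Tree.subst_subst (S := M.sig) _ _ _).symm)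
    refine congrArg (fun U => Tree.subst (S := M.sig) (F := ord.src T) U _) (funext fun q => ?_)
    by_cases hq : p = q
    · subst hq
      refine (congrArg (Tree.subst W) (dif_pos rfl)).trans ?_
      refine hb.trans (Eq.trans ?_ (along_subst _ _ W).symm)
      exact congrArg (along h) (Tree.corolla_subst (S := M.sig) W (n p)).symm
    · exact congrArg (Tree.subst W) (dif_neg hq)
  exact key (x (n p)) rfl e b hW

/-- Substituting `encode ord (t k)` at the nodes still to be replaced, and corollas at the finished
ones, gives a tree that is invariant along the reduction: each step merely carries out a part of
this substitution in advance. When nothing is left to replace, only corollas are substituted. -/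
theorem encode_reduces {K K' : Type} {x : K → M.Arr} {x' : K' → M.Arr}
    {t : ∀ k, (M.slice ord).Named x' (x k)} {f : M.Arr}
    {s : (M.slice ord).Named (Sum.elim x x') f} {r : (M.slice ord).Named x' f}
    (h : Reduces (M := M.slice ord) t s r) :
    (encode ord (x := Sum.elim x x') s).subst (fun c => Sum.rec
      (motive := fun c => Tree M.sig x' (M.sig.src (Sum.elim x x' c)) (M.sig.tgt (Sum.elim x x' c)))
      (fun k => encode ord (t k)) (fun k => Tree.corolla (S := M.sig) (F := x') k) c) =
      encode ord r := by
  induction h with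
  | done r =>
    refine (congrArg (fun V => Tree.subst _ V)
      (encode_map ord (y := Sum.elim x x') Sum.inr r)).trans ?_
    refine (Tree.rename_subst (S := M.sig) (G := Sum.elim x x') Sum.inr _ _).trans ?_
    exact Tree.subst_corolla (S := M.sig) _
  | step s p k hk r h ih =>
    refine Eq.trans (Eq.symm ?_) ih
    refine encode_plug_subst ord (x := Sum.elim x x') s p (Sum.inl k) hk _ _ _ ?_
    refine (congrArg (fun V => Tree.subst _ V)
      (encode_map ord (y := Sum.elim x x') Sum.inr (t k))).trans ?_
    refine (Tree.rename_subst (S := M.sig) (G := Sum.elim x x') Sum.inr _ _).trans ?_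
    exact Tree.subst_corolla (S := M.sig) _

/-- The reduction defining `bind` starts with every source named by `inl`, where the invariant of
`encode_reduces` is the full simultaneous substitution. This turns composition one source after
another into the composition used in `Q⁺`. -/
theorem encode_bind {K K' : Type} {x : K → M.Arr} {x' : K' → M.Arr} {f : M.Arr}
    (a : (M.slice ord).Named x f) (t : ∀ k, (M.slice ord).Named x' (x k)) :
    encode ord (a.bind t) = (encode ord a).subst fun k => encode ord (t k) := by
  refine (encode_reduces ord (GenMulticat.Named.bind_spec a t)).symm.trans ?_
  refine (congrArg (fun V => Tree.subst _ V)
    (encode_map ord (y := Sum.elim x x') Sum.inl a)).trans ?_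
  exact Tree.rename_subst (S := M.sig) (G := Sum.elim x x') Sum.inl _ _

end

end GenMulticat

/-- A comparison of a symmetric multicategory `Q` with a generalised multicategory `M`: it
presents `Q` as equivalent to the free symmetric multicategory on `M`, whose arrows are the
arrows of `M` with their sources bijectively renamed. -/
structure Comparison (Q : SymMulticat) (M : GenMulticat) where
  obj : Q.Obj → M.Obj
  obj_surjective : Function.Surjective obj
  obj_eq : ∀ {x y : Q.Obj}, (x ⟶ y) → obj x = obj y
  nonempty_hom : ∀ {x y : Q.Obj}, obj x = obj y → Nonempty (x ⟶ y)
  subsingleton_hom : ∀ x y : Q.Obj, Subsingleton (x ⟶ y)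
  arr : ∀ {I : Type} [Finite I] {x : I → Q.Obj} {y : Q.Obj}, Q.Hom I x y →
    M.Named (fun i => obj (x i)) (obj y)
  name_bijective : ∀ {I : Type} [Finite I] {x : I → Q.Obj} {y : Q.Obj} (f : Q.Hom I x y),
    Function.Bijective (arr f).name
  arr_injective : ∀ {I : Type} [Finite I] {x : I → Q.Obj} {y : Q.Obj} {f g : Q.Hom I x y},
    arr f = arr g → f = g
  exists_arr_eq : ∀ {I : Type} [Finite I] {x : I → Q.Obj} {y : Q.Obj}
    (a : M.Named (fun i => obj (x i)) (obj y)), Function.Bijective a.name → ∃ f, arr f = a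
  arr_perm : ∀ {I J : Type} [Finite I] [Finite J] (e : I ≃ J) {x : J → Q.Obj} {y : Q.Obj}
    (f : Q.Hom I (fun i => x (e i)) y), arr (Q.perm e f) = (arr f).map e (fun _ => rfl)
  arr_comp : ∀ {I : Type} [Finite I] {J : I → Type} [∀ i, Finite (J i)] {x : I → Q.Obj}
    {y : Q.Obj} {w : ∀ i, J i → Q.Obj} (f : Q.Hom I x y) (g : ∀ i, Q.Hom (J i) (w i) (x i)),
    arr (Q.comp f g) = (arr f).bind fun i => (arr (g i)).map (Sigma.mk i) fun _ => rfl
  arr_ι : ∀ {x y : Q.Obj} (a : x ⟶ y),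
    arr (Q.ι a) = (GenMulticat.Named.unit PUnit.unit).cast (obj_eq a)

/-! ### Translating trees along a comparison -/

namespace Comparison

open GenMulticat

section

variable {Q : SymMulticat} {M : GenMulticat} (R : Comparison Q M)

/-- Under the comparison `ι a` becomes an identity, which `unit_bind` absorbs. Only the equality of
objects induced by `a` remains. -/
theorem arr_post {I : Type} [Finite I] {x : I → Q.Obj} {y z : Q.Obj} (f : Q.Hom I x y)
    (a : y ⟶ z) : R.arr (Q.post f a) = (R.arr f).cast (R.obj_eq a) := by
  have h : R.arr (Q.comp (Q.ι a) fun _ => f) =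
      ((R.arr f).map (Sigma.mk PUnit.unit) fun _ => rfl).cast (R.obj_eq a) := by
    rw [R.arr_comp, R.arr_ι, Named.cast_bind,
      Named.unit_bind (x := fun _ : PUnit => R.obj y) PUnit.unit]
  exact (R.arr_perm (punitSigma I) (x := x) _).trans
    (congrArg (Named.map (x' := fun i => R.obj (x i)) (punitSigma I) fun _ => rfl) h)

theorem arr_pre {I : Type} [Finite I] {x x' : I → Q.Obj} {y : Q.Obj} (a : ∀ i, x' i ⟶ x i)
    (f : Q.Hom I x y) :
    R.arr (Q.pre a f) = (R.arr f).map (fun i => i) fun i => R.obj_eq (a i) := by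
  have h : R.arr (Q.comp f fun i => Q.ι (a i)) = 
      (R.arr f).map (x' := fun p : Σ _ : I, PUnit.{1} => R.obj (x' p.1))
        (fun i => ⟨i, PUnit.unit⟩) fun i => R.obj_eq (a i) := by
    rw [R.arr_comp]
    refine Eq.trans (congrArg (R.arr f).bind (funext fun i => ?_))
      (Named.bind_unit_map (x' := fun p : Σ _ : I, PUnit => R.obj (x' p.1))
        (fun i => ⟨i, PUnit.unit⟩) (fun i => R.obj_eq (a i)) (R.arr f))
    rw [R.arr_ι]
  exact (R.arr_perm (sigmaPUnit I) (x := x') _).trans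
    (congrArg (Named.map (x' := fun i => R.obj (x' i)) (sigmaPUnit I) fun _ => rfl) h)

/-- The arrow of `M` corresponding to an object of the category of elements of `Q`. -/
def elt (g : Q.Elt) : M.Arr := (R.arr g.hom).arr

/-- The bijection between the sources of corresponding arrows. -/
noncomputable def source (g : Q.Elt) : Fin (M.ar (R.elt g)) ≃ Fin g.ar :=
  Equiv.ofBijective _ (R.name_bijective g.hom)

theorem src_elt (g : Q.Elt) (j : Fin (M.ar (R.elt g))) :
    M.src (R.elt g) j = R.obj (g.src (R.source g j)) :=
  (R.arr g.hom).src_eq j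

theorem tgt_elt (g : Q.Elt) : M.tgt (R.elt g) = R.obj g.tgt :=
  (R.arr g.hom).tgt_eq

/-- The tree over `M` corresponding to a tree over `Q`. -/
noncomputable def tree {I K : Type} {F : I → Q.Elt} {x : K → Q.Obj} :
    ∀ {z : Q.Obj}, Tree Q.sig F x z →
      Tree M.sig (fun i => R.elt (F i)) (fun k => Discrete.mk (R.obj (x k))) ⟨R.obj z⟩
  | _, Tree.leaf k a => Tree.leaf k (Discrete.eqToHom (R.obj_eq a))
  | _, Tree.node i a ch => Tree.node (S := M.sig) (F := fun i => R.elt (F i)) i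
      (Discrete.eqToHom ((R.tgt_elt (F i)).trans (R.obj_eq a)))
      -- The inputs are reordered: position `j` of the arrow of `M` corresponds to the source
      -- `R.source (F i) j` of `F i`.
      fun j => (tree (ch (R.source (F i) j))).post (Discrete.eqToHom (R.src_elt (F i) j).symm)

section

variable {I J K K' : Type} {F : I → Q.Elt} {x : K → Q.Obj} {x' : K' → Q.Obj} {z w : Q.Obj}

theorem tree_post (T : Tree Q.sig F x z) (a : z ⟶ w) :
    R.tree (T.post a) = (R.tree T).post (Discrete.eqToHom (R.obj_eq a)) := by
  cases T with
  | leaf k b => exact leaf_congr rfl _ _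
  | node i b ch => exact node_congr (F := fun i => R.elt (F i)) i _ _ fun _ => rfl

theorem tree_graft (t : ∀ k, Tree Q.sig F x' (x k)) (T : Tree Q.sig F x z) :
    R.tree (T.graft t) = (R.tree T).graft fun k => R.tree (t k) := by
  induction T with
  | leaf k a => exact R.tree_post _ _
  | node i a ch ih =>
    refine node_congr (F := fun i => R.elt (F i)) i _ _ fun j => ?_
    exact (congrArg (fun V => Tree.post V
      (Discrete.eqToHom (R.src_elt _ j).symm)) (ih _)).trans (Tree.graft_post (S := M.sig) _ _ _).symm

theorem tree_rename {G : J → Q.Elt} (m : I → J) (T : Tree Q.sig (fun i => G (m i)) x z) :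
    R.tree (Tree.rename (S := Q.sig) (G := G) m T) =
      Tree.rename (S := M.sig) (G := fun j => R.elt (G j)) m (R.tree T) := by
  induction T with
  | leaf k a => rfl
  | node i a ch ih =>
    refine node_congr (F := fun j => R.elt (G j)) (m i) _ _ fun j => ?_
    exact (congrArg (fun V => Tree.post V
      (Discrete.eqToHom (R.src_elt _ j).symm)) (ih _)).trans
      (Tree.rename_post (S := M.sig) (G := fun j => R.elt (G j)) m _ _).symm

theorem nodeSum_tree (T : Tree Q.sig F x z) (w : I → ℕ) :
    (R.tree T).nodeSum w = T.nodeSum w := by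
  induction T with
  | leaf k a => rfl
  | node i a ch ih =>
    refine congrArg (w i + ·) ?_
    refine Eq.trans (Finset.sum_congr rfl fun j _ => ?_)
      ((R.source (F i)).sum_comp fun j => (ch j).nodeSum w)
    exact (Tree.nodeSum_post (S := M.sig) _ _ _).trans (ih _)

/-- Nothing is lost in the translation: an object-morphism is determined by its ends, and every
child is reached because `R.source` is surjective. -/
theorem tree_injective {T T' : Tree Q.sig F x z} (h : R.tree T = R.tree T') : T = T' := by
  have := R.subsingleton_hom
  induction T with
  | leaf k a =>
    cases T' with
    | leaf k' a' =>
      simp only [tree] at h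
      injection h with h1 h2
      subst h2
      rw [Subsingleton.elim a a']
    | node => simp [tree] at h
  | node i a ch ih =>
    cases T' with
    | leaf => simp [tree] at h
    | node i' a' ch' =>
      simp only [tree] at h
      injection h with h1 h2 h3 h4
      subst h2
      rw [Subsingleton.elim a a']
      refine congrArg (Tree.node i a') (funext fun j => ?_)
      obtain ⟨j, rfl⟩ := (R.source (F i)).surjective j
      exact ih _ (post_injective _ (congrFun (eq_of_heq h4) j))

theorem exists_tree_eq (V : Tree M.sig (fun i => R.elt (F i))
    (fun k => Discrete.mk (R.obj (x k))) ⟨R.obj z⟩) : ∃ T : Tree Q.sig F x z, R.tree T = V := by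
  -- A child of a node ends at a source of `R.elt (F i)`, which is only propositionally of the form
  -- `R.obj _`. The induction therefore allows any root object `v` with a morphism to an object of
  -- this form.
  have key : ∀ {v : Discrete M.Obj} (V : Tree M.sig (fun i => R.elt (F i))
      (fun k => Discrete.mk (R.obj (x k))) v) (z : Q.Obj) (a : v ⟶ ⟨R.obj z⟩),
      ∃ T : Tree Q.sig F x z, R.tree T = V.post a := by
    intro v V
    induction V with
    | leaf k b =>
      intro z a
      obtain ⟨c⟩ := R.nonempty_hom (Discrete.eq_of_hom (b ≫ a))
      exact ⟨Tree.leaf k c, leaf_congr rfl _ _⟩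
    | node i b ch ih =>
      intro z a
      obtain ⟨c⟩ := R.nonempty_hom ((R.tgt_elt (F i)).symm.trans (Discrete.eq_of_hom (b ≫ a)))
      -- Children over `Q` are indexed by the sources of `F i`. Quantifying over the positions `j`
      -- above `k` avoids a transport along the inverse of `R.source`.
      have h : ∀ k : Fin (F i).ar, ∃ T : Tree Q.sig F x ((F i).src k),
          ∀ j, (hj : R.source (F i) j = k) → R.tree T = (ch j).post
            (Discrete.eqToHom ((R.src_elt (F i) j).trans (congrArg (fun k => R.obj ((F i).src k)) hj))) := by
        intro k
        obtain ⟨j, rfl⟩ := (R.source (F i)).surjective k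
        obtain ⟨T, hT⟩ := ih j _ (Discrete.eqToHom (R.src_elt (F i) j))
        refine ⟨T, fun j' hj => ?_⟩
        obtain rfl := (R.source (F i)).injective hj
        exact hT
      choose T hT using h
      refine ⟨Tree.node i c T, node_congr (F := fun i => R.elt (F i)) i _ _ fun j => ?_⟩
      rw [hT _ j rfl, Tree.post_post]
      exact (congrArg (ch j).post (Subsingleton.elim _ _)).trans (Tree.post_id _)
  obtain ⟨T, hT⟩ := key V z (𝟙 _)
  exact ⟨T, hT.trans (Tree.post_id V)⟩

/-- Name the leaves by the sources of the arrow of `M` corresponding to `g`. -/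
noncomputable def relocate {A : I → M.Arr} (g : Q.Elt)
    (V : Tree M.sig A (fun k => Discrete.mk (R.obj (g.src k))) ⟨R.obj g.tgt⟩) :
    Tree M.sig A (M.sig.src (R.elt g)) (M.sig.tgt (R.elt g)) :=
  (V.graft fun k => Tree.leaf (x := M.sig.src (R.elt g)) ((R.source g).symm k)
    (Discrete.eqToHom ((R.src_elt g _).trans
      (congrArg (fun k => R.obj (g.src k)) ((R.source g).apply_symm_apply k))))).post
    (Discrete.eqToHom (R.tgt_elt g).symm)

theorem tagged_relocate {A : I → M.Arr} (g : Q.Elt)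
    (V : Tree M.sig A (fun k => Discrete.mk (R.obj (g.src k))) ⟨R.obj g.tgt⟩) :
    tagged (R.relocate g V) = tagged V :=
  (tagged_post _ _).trans (tagged_graft_leaf (l' := M.sig.src (R.elt g)) _ _ V)

theorem relocate_subst {A : I → M.Arr} {B : J → M.Arr} (g : Q.Elt)
    (V : Tree M.sig A (fun k => Discrete.mk (R.obj (g.src k))) ⟨R.obj g.tgt⟩)
    (U : ∀ i, Tree M.sig B (M.sig.src (A i)) (M.sig.tgt (A i))) :
    (R.relocate g V).subst U = R.relocate g (V.subst U) := by
  unfold relocate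
  rw [Tree.subst_post, Tree.subst_graft]
  rfl

theorem eval_relocate {A : I → M.Arr} {g : Q.Elt}
    {V : Tree M.sig A (fun k => Discrete.mk (R.obj (g.src k))) ⟨R.obj g.tgt⟩}
    (h : eval V = R.arr g.hom) : eval (R.relocate g V) = Named.of (R.elt g) := by
  refine (eval_post _ _).trans ?_
  rw [eval_graft_leaf (x' := M.sig.src (R.elt g)), h]
  refine Named.ext' rfl fun p q hpq => ?_
  obtain rfl : p = q := Fin.ext hpq
  exact (R.source g).symm_apply_apply p

theorem relocate_graft {A : I → M.Arr} {l : K → Discrete M.Obj} (g : Q.Elt)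
    (V : Tree M.sig A (fun k => Discrete.mk (R.obj (g.src k))) ⟨R.obj g.tgt⟩)
    (t : ∀ j, Tree M.sig A l (M.sig.src (R.elt g) j)) :
    (R.relocate g V).graft t = (V.graft fun k => (t ((R.source g).symm k)).post
      (Discrete.eqToHom ((R.src_elt g _).trans
        (congrArg (fun k => R.obj (g.src k)) ((R.source g).apply_symm_apply k))))).post
      (Discrete.eqToHom (R.tgt_elt g).symm) := by
  unfold relocate
  rw [Tree.graft_post, Tree.graft_graft]
  rfl

/-- A tree substituted for a node over `M` needs leaves named by the sources of the arrow of `M`,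
while those of `R.tree (U i)` are named by the sources of `F i`; hence `relocate`. Its inverse of
`R.source` cancels the reordering of the inputs made by `tree`. -/
theorem tree_subst {G : J → Q.Elt} (U : ∀ i, Tree Q.sig G (F i).src (F i).tgt)
    (T : Tree Q.sig F x z) :
    R.tree (T.subst U) = (R.tree T).subst fun i => R.relocate (F i) (R.tree (U i)) := by
  induction T with
  | leaf k a => rfl
  | node i a ch ih =>
    refine (R.tree_post _ _).trans ?_
    simp only [tree, Tree.subst]
    rw [tree_graft, relocate_graft, Tree.post_post]
    refine congrArg₂ Tree.post (congrArg (fun t => Tree.graft t (R.tree (U i)))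
      (funext fun k => ?_)) (Subsingleton.elim _ _)
    rw [ih]
    -- Grafting reaches the child with index `R.source (F i) ((R.source (F i)).symm k)`, whose type
    -- differs from that of the child `k`. A variable index `k'` lets the equality be substituted.
    have key : ∀ (k' : Fin (F i).ar) (h : k' = k) (v : Discrete M.Obj)
        (e : ⟨R.obj ((F i).src k')⟩ ⟶ v) (e' : v ⟶ ⟨R.obj ((F i).src k)⟩),
        (R.tree (ch k)).subst (fun i => R.relocate (F i) (R.tree (U i))) =
          (((R.tree (ch k')).post e).subst fun i => R.relocate (F i) (R.tree (U i))).post e' := by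
      rintro _ rfl v e e'
      rw [Tree.subst_post, Tree.post_post, Subsingleton.elim (e ≫ e') (𝟙 _), Tree.post_id]
    exact key _ ((R.source (F i)).apply_symm_apply k) _ _ _

end

/-! ### Composition along trees -/

section

variable {I K : Type} {F : I → Q.Elt} {x : K → Q.Obj} {z : Q.Obj}

/-- Composition along a tree in `Q` and evaluation in `M` are built by the same recursion,
`arr_comp` turning a composite into a `bind`. They differ only in the order of the inputs of each
node and in the intermediate index sets. -/
theorem eval_tree {T : Tree Q.sig F x z} {L : Type} [Finite L] {lab : L → K}
    {f : Q.Hom L (fun p => x (lab p)) z} (h : Q.Composes T lab f) :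
    eval (R.tree T) = (R.arr f).map (x' := fun k => R.obj (x k)) lab fun _ => rfl := by
  induction h with
  | leaf k a =>
    rw [R.arr_ι]
    rfl
  | node i a ch lab f h ih =>
    rw [R.arr_post, R.arr_comp]
    -- The arrow `R.arr (F i).hom` is `Named.of (R.elt (F i))` with its sources renamed by `R.source
    -- (F i)`, so `bind_map` passes to the order of inputs used in `R.tree`.
    have h1 : ((R.arr (F i).hom).bind fun j =>
        (R.arr (f j)).map (x' := fun k => R.obj (x k)) (lab j) fun _ => rfl) =
        (((Named.of (R.elt (F i))).bind fun j => eval ((R.tree (ch (R.source (F i) j))).post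
          (Discrete.eqToHom (R.src_elt (F i) j).symm))).cast (R.tgt_elt (F i))) := by
      refine Eq.trans ?_ (Named.cast_bind _ _ _)
      refine (Named.bind_map (x := fun j => R.obj ((F i).src j)) (R.arr (F i).hom).name
        (fun j => (R.src_elt (F i) j).symm) ((Named.of (R.elt (F i))).cast (R.tgt_elt (F i)))
        _).trans ?_
      refine congrArg (Named.bind _) (funext fun j => ?_)
      rw [eval_post]
      exact congrArg (fun b => Named.cast b _) (ih _).symm
    have h2 := Named.map_bind (x'' := fun k => R.obj (x k)) (fun p : Σ j, _ => lab p.1 p.2)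
      (fun _ => rfl) (R.arr (F i).hom) (fun j => (R.arr (f j)).map
        (x' := fun p : Σ j, _ => R.obj (x (lab p.1 p.2))) (Sigma.mk j) fun _ => rfl)
    exact (congrArg (fun b => Named.cast b (R.obj_eq a)) (h2.trans h1)).symm
  | perm T e lab f h ih =>
    rw [R.arr_perm e (x := fun p => x (lab p))]
    exact ih

/-- The index set is assembled along the tree from its leaves. Different leaves may have the same
name, so `lab` need not be injective. -/
theorem exists_composes (T : Tree Q.sig F x z) : ∃ (L : Type) (_ : Finite L) (lab : L → K)
    (f : Q.Hom L (fun p => x (lab p)) z), Q.Composes T lab f := by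
  induction T with
  | leaf k a => exact ⟨PUnit, inferInstance, _, _, SymMulticat.Composes.leaf k a⟩
  | node i a ch ih =>
    choose L hL lab f h using ih
    exact ⟨_, inferInstance, _, _, SymMulticat.Composes.node i a ch lab f h⟩

/-- Conversely to `eval_tree`, any composite along `T` has, after renaming, the same image in `M` as
`f`, and arrows of `Q` are determined by their images. -/
theorem composes_iff (T : Tree Q.sig F x z) [Finite K] (f : Q.Hom K x z) :
    Q.Composes T (fun k => k) f ↔ eval (R.tree T) = R.arr f := by
  refine ⟨fun h => R.eval_tree h, fun h => ?_⟩
  obtain ⟨L, hL, lab, g, hg⟩ := exists_composes T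
  have h1 := (R.eval_tree hg).symm.trans h
  -- This composite names the sources in the same way as `R.arr f` does. As the naming of `R.arr g`
  -- is bijective too, `lab` must be a bijection, and `g` can be renamed along it.
  have h2 : Function.Bijective fun p => lab ((R.arr g).name p) := by
    have h3 : Function.Bijective ((R.arr g).map (x' := fun k => R.obj (x k)) lab
        fun _ => rfl).name := by
      rw [h1]
      exact R.name_bijective f
    exact h3
  have hlab : Function.Bijective lab :=
    (Function.Bijective.of_comp_iff lab (R.name_bijective g)).1 h2
  have h4 := SymMulticat.Composes.perm T (Equiv.ofBijective lab hlab) (fun k => k) g hg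
  obtain rfl : Q.perm (Equiv.ofBijective lab hlab) g = f :=
    R.arr_injective ((R.arr_perm (Equiv.ofBijective lab hlab) g).trans h1)
  exact h4

end

/-! ### The slice of a comparison: objects -/

/-- Object-morphisms become equalities in `M`, so a morphism of elements affects nothing but the
names of the sources. -/
theorem arr_eltHom {g g' : Q.Elt} (α : SymMulticat.EltHom g g') :
    R.arr g'.hom = ((R.arr g.hom).map (x' := fun j => R.obj (g'.src j)) α.σ
      fun i => R.obj_eq (α.srcMap i)).cast (R.obj_eq α.tgtMap) := by
  rw [← α.eq, R.arr_perm, R.arr_post, R.arr_pre]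

theorem elt_eq {g g' : Q.Elt} (α : SymMulticat.EltHom g g') : R.elt g = R.elt g' :=
  (congrArg (fun b => b.arr) (R.arr_eltHom α)).symm

/-- The permutation is forced: it matches the sources of `g` and `g'` at the same position of their
common arrow of `M`. -/
theorem eltHom_source {g g' : Q.Elt} (α : SymMulticat.EltHom g g') (p : Fin (M.ar (R.elt g))) :
    α.σ (R.source g p) = R.source g' (Fin.cast (congrArg M.ar (R.elt_eq α)) p) :=
  (Named.name_congr (R.arr_eltHom α) _ p rfl).symm

theorem subsingleton_eltHom (R : Comparison Q M) (g g' : Q.Elt) : Subsingleton (SymMulticat.EltHom g g') := by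
  have := R.subsingleton_hom
  refine ⟨fun α β => ?_⟩
  have h : α.σ = β.σ := Equiv.ext fun j => by
    obtain ⟨p, rfl⟩ := (R.source g).surjective j
    rw [eltHom_source, eltHom_source]
  obtain ⟨σ, s, t, e⟩ := α
  obtain ⟨σ', s', t', e'⟩ := β
  obtain rfl : σ = σ' := h
  obtain rfl : s = s' := funext fun i => Subsingleton.elim _ _
  obtain rfl : t = t' := Subsingleton.elim _ _
  rfl

theorem nonempty_eltHom {g g' : Q.Elt} (h : R.elt g = R.elt g') :
    Nonempty (SymMulticat.EltHom g g') := by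
  -- Neither side of `R.elt g = R.elt g'` is a variable that could be eliminated, so the statement
  -- about sources is made for arbitrary equal arrows.
  have hs : ∀ (f f' : M.Arr) (h : f = f') (p : Fin (M.ar f)),
      M.src f' (Fin.cast (congrArg M.ar h) p) = M.src f p := by
    rintro f _ rfl p
    rfl
  -- By `eltHom_source` this is the only possible permutation.
  let σ : Fin g.ar ≃ Fin g'.ar :=
    ((R.source g).symm.trans (finCongr (congrArg M.ar h))).trans (R.source g')
  have h1 : ∀ i, R.obj (g'.src (σ i)) = R.obj (g.src i) := fun i =>
    ((R.src_elt g' _).symm.trans (hs _ _ h ((R.source g).symm i))).trans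
      ((R.src_elt g _).trans
        (congrArg (fun k => R.obj (g.src k)) ((R.source g).apply_symm_apply i)))
  have h2 : R.obj g.tgt = R.obj g'.tgt :=
    (R.tgt_elt g).symm.trans ((congrArg M.tgt h).trans (R.tgt_elt g'))
  refine ⟨⟨σ, fun i => (R.nonempty_hom (h1 i)).some, (R.nonempty_hom h2).some, ?_⟩⟩
  refine R.arr_injective ?_
  rw [R.arr_perm, R.arr_post, R.arr_pre]
  refine Named.ext' h fun p q hpq => ?_
  have h3 : (R.source g).symm (R.source g p) = p := (R.source g).symm_apply_apply p
  refine (congrArg (fun r => R.source g' (Fin.cast (congrArg M.ar h) r)) h3).trans ?_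
  exact congrArg (R.source g') (Fin.ext hpq)

/-- Any arrow of `M` is bijectively named by its own sources, so it comes from `Q` once its sources
and target have been lifted to objects of `Q`. -/
theorem elt_surjective : Function.Surjective R.elt := by
  intro f
  choose x hx using fun j => R.obj_surjective (M.src f j)
  obtain ⟨y, hy⟩ := R.obj_surjective (M.tgt f)
  obtain ⟨g, hg⟩ := R.exists_arr_eq (x := x) (y := y)
    ⟨f, fun p => p, fun p => (hx p).symm, hy.symm⟩ Function.bijective_id
  exact ⟨⟨M.ar f, x, y, g⟩, congrArg (fun b => b.arr) hg⟩

/-! ### The slice of a comparison: arrows -/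

section

variable (ord : M.NodeOrder) {I : Type} {F : I → Q.Elt} {f : Q.Elt}

theorem eval_sliceHom (T : Q.SliceHom I F f) : eval (R.tree T.1) = R.arr f.hom :=
  (R.composes_iff T.1 f.hom).1 T.2.2

/-- The arrow of the slice of `M` corresponding to an arrow of the slice of `Q`. -/
noncomputable def sliceArr (T : Q.SliceHom I F f) :
    (M.slice ord).Named (fun i => R.elt (F i)) (R.elt f) :=
  decode ord (R.tree T.1) (congrArg (fun b => b.arr) (R.eval_sliceHom T))

theorem sliceTree_sliceArr (T : Q.SliceHom I F f) :
    sliceTree ord (R.sliceArr ord T) = tagged (R.tree T.1) :=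
  sliceTree_decode ord _ _

theorem encode_sliceArr (T : Q.SliceHom I F f) :
    encode ord (R.sliceArr ord T) = R.relocate f (R.tree T.1) :=
  encode_eq ord ((R.tagged_relocate f _).trans (R.sliceTree_sliceArr ord T).symm)
    (R.eval_relocate (R.eval_sliceHom T))

/-- Bijectivity of a naming only depends on how often each name occurs. Comparing weighted sums over
the names avoids an explicit bijection between the nodes of the trees. -/
theorem name_bijective_iff (a : (M.slice ord).Named (fun i => R.elt (F i)) (R.elt f))
    (T : Tree Q.sig F f.src f.tgt) (h : tagged (R.tree T) = sliceTree ord a) :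
    Function.Bijective a.name ↔ Function.Bijective T.nodeName := by
  classical
  have h1 : ∀ w : I → ℕ, ∑ p : Fin (Fintype.card a.arr.2.Nodes), w (a.name p) = T.nodeSum w := by
    intro w
    refine (sliceTree_nodeSum ord a fun c => w c.1).symm.trans ?_
    rw [← h, nodeSum_tagged, nodeSum_tree]
  rw [Tree.nodeName_bijective_iff]
  refine (Tree.bijective_iff_sum (A := Fin (Fintype.card a.arr.2.Nodes)) a.name).trans ?_
  exact forall_congr' fun i => by rw [← h1]

/-- Both trees evaluate to the arrow of `f`, so nothing is lost when `sliceArr` forgets the names of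
the leaves. -/
theorem sliceArr_injective {T T' : Q.SliceHom I F f} (h : R.sliceArr ord T = R.sliceArr ord T') :
    T = T' := by
  have h1 := congrArg (sliceTree ord) h
  rw [sliceTree_sliceArr, sliceTree_sliceArr] at h1
  exact Subtype.ext (R.tree_injective (eq_of_tagged_of_eval h1
    ((R.eval_sliceHom T).trans (R.eval_sliceHom T').symm)))

theorem exists_sliceArr_eq (a : (M.slice ord).Named (fun i => R.elt (F i)) (R.elt f))
    (ha : Function.Bijective a.name) : ∃ T : Q.SliceHom I F f, R.sliceArr ord T = a := by
  -- This undoes `relocate`: leaves named by the sources of `R.elt f` are renamed by the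
  -- corresponding sources of `f`.
  obtain ⟨T, hT⟩ := R.exists_tree_eq (x := f.src) (z := f.tgt)
    (((encode ord a).graft fun j => Tree.leaf (x := fun k => Discrete.mk (R.obj (f.src k)))
      (R.source f j) (Discrete.eqToHom (R.src_elt f j).symm)).post
      (Discrete.eqToHom (R.tgt_elt f)))
  have h1 : tagged (R.tree T) = sliceTree ord a := by
    rw [hT]
    refine (tagged_post _ _).trans ?_
    exact (tagged_graft_leaf (l' := fun k => Discrete.mk (R.obj (f.src k))) _ _ _).trans
      (tagged_encode ord a)
  have h2 : eval (R.tree T) = R.arr f.hom := by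
    rw [hT]
    refine (eval_post _ _).trans ?_
    rw [eval_graft_leaf (x' := fun k => Discrete.mk (R.obj (f.src k))), eval_encode]
    rfl
  refine ⟨⟨T, (R.name_bijective_iff ord a T h1).1 ha, (R.composes_iff T f.hom).2 h2⟩, ?_⟩
  exact sliceTree_injective ord ((R.sliceTree_sliceArr ord _).trans h1)

/-- Formulated for any arrow with the given underlying tree, so that the operations of `Q.slice` are
unfolded only when the comparison is assembled. The statements for composition and `ι` have the same
form. -/
theorem sliceArr_of_eq_rename {J : Type} {G : J → Q.Elt} (e : I → J)
    (T : Q.SliceHom I (fun i => G (e i)) f) (T' : Q.SliceHom J G f)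
    (h : T'.1 = Tree.rename (S := Q.sig) (G := G) e T.1) :
    R.sliceArr ord T' = GenMulticat.Named.map (M := M.slice ord) (x' := fun j => R.elt (G j)) e
      (fun _ => rfl) (R.sliceArr ord T) := by
  refine sliceTree_injective ord ?_
  rw [sliceTree_sliceArr, h, tree_rename]
  refine (tagged_rename (x := fun j => R.elt (G j)) e (R.tree T.1)).trans ?_
  rw [← R.sliceTree_sliceArr ord T]
  exact (sliceTree_map ord (y := fun j => R.elt (G j)) e (fun _ => rfl) _).symm

theorem relocate_rename {J : Type} {A : J → M.Arr} (m : I → J) (g : Q.Elt)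
    (V : Tree M.sig (fun i => A (m i)) (fun k => Discrete.mk (R.obj (g.src k))) ⟨R.obj g.tgt⟩) :
    Tree.rename (S := M.sig) (G := A) m (R.relocate g V) =
      R.relocate g (Tree.rename (S := M.sig) (G := A) m V) := by
  unfold relocate
  refine (Tree.rename_post (S := M.sig) (G := A) m _ _).trans ?_
  exact congrArg (fun V => Tree.post V _) (Tree.rename_graft (S := M.sig) (G := A) m _ V)

/-- Substitution over `Q` becomes substitution over `M` by `tree_subst`, and this is composition in
the slice of `M` by `encode_bind`. -/
theorem sliceArr_of_eq_subst {J : I → Type} {G : ∀ i, J i → Q.Elt} (T : Q.SliceHom I F f)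
    (U : ∀ i, Q.SliceHom (J i) (G i) (F i)) (V : Q.SliceHom (Σ i, J i) (fun p => G p.1 p.2) f)
    (h : V.1 = T.1.subst (G := fun p : Σ i, J i => G p.1 p.2)
      (fun i => (U i).1.rename (Sigma.mk i))) :
    R.sliceArr ord V = GenMulticat.Named.bind (M := M.slice ord) (R.sliceArr ord T) fun i =>
      GenMulticat.Named.map (M := M.slice ord) (x' := fun p : Σ i, J i => R.elt (G p.1 p.2))
        (Sigma.mk i) (fun _ => rfl) (R.sliceArr ord (U i)) := by
  refine sliceTree_injective ord ?_
  rw [sliceTree_sliceArr, h, tree_subst]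
  refine Eq.trans ?_ (tagged_encode ord _)
  -- Encoded arrows have leaves named by the sources of an arrow of `M`; relocating the leaves,
  -- which `tagged` does not see, brings the left side into the same form.
  refine (R.tagged_relocate f _).symm.trans (congrArg tagged ?_)
  rw [← relocate_subst, ← R.encode_sliceArr ord T]
  refine Eq.trans ?_ (encode_bind ord (R.sliceArr ord T) _).symm
  refine congrArg (fun V => Tree.subst V (encode ord (R.sliceArr ord T))) (funext fun i => ?_)
  refine Eq.trans ?_ (encode_map ord (y := fun p : Σ i, J i => R.elt (G p.1 p.2)) (Sigma.mk i)
    (R.sliceArr ord (U i))).symm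
  rw [R.encode_sliceArr ord (U i)]
  refine Eq.trans ?_ (R.relocate_rename (A := fun p : Σ i, J i => R.elt (G p.1 p.2))
    (Sigma.mk i) (F i) (R.tree (U i).1)).symm
  exact congrArg (R.relocate (F i))
    (R.tree_rename (G := fun p : Σ i, J i => G p.1 p.2) (Sigma.mk i) (U i).1)

theorem sliceArr_of_eq_tree {g g' : Q.Elt} (α : SymMulticat.EltHom g g')
    (T : Q.SliceHom PUnit (fun _ => g) g') (h : T.1 = α.tree) :
    R.sliceArr ord T = GenMulticat.Named.cast (M := M.slice ord)
      (GenMulticat.Named.unit (M := M.slice ord) (x := fun _ => R.elt g) PUnit.unit)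
        (R.elt_eq α) := by
  refine sliceTree_injective ord ?_
  rw [sliceTree_sliceArr, h]
  refine Eq.trans ?_ (sliceTree_unit ord (fun _ => R.elt g) PUnit.unit).symm
  refine Eq.trans ?_ (tagged_post _ (Discrete.eqToHom
    ((R.tgt_elt g).trans (R.obj_eq α.tgtMap)) : _ ⟶ ⟨R.obj g'.tgt⟩))
  refine congrArg (Sigma.mk _) (congrArg expand ?_)
  -- The permutation of `α` is visible only in the names of the leaves. Closing the tree replaces
  -- these by objects, and the objects agree.
  refine node_congr (F := fun _ => R.elt g) PUnit.unit _ _ fun j => leaf_congr ?_ _ _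
  exact (R.obj_eq (α.srcMap _)).trans (R.src_elt g j).symm

end

/-- The comparison of the slices. -/
noncomputable def slice (ord : M.NodeOrder) : Comparison Q.slice (M.slice ord) where
  obj := R.elt
  obj_surjective := R.elt_surjective
  obj_eq α := R.elt_eq α
  nonempty_hom h := R.nonempty_eltHom h
  subsingleton_hom g g' := R.subsingleton_eltHom g g'
  arr T := R.sliceArr ord T
  name_bijective T := (R.name_bijective_iff ord _ T.1 (R.sliceTree_sliceArr ord T).symm).2 T.2.1
  arr_injective h := R.sliceArr_injective ord h
  exists_arr_eq a ha := R.exists_sliceArr_eq ord a ha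
  arr_perm e _ _ T := R.sliceArr_of_eq_rename ord e T _ rfl
  arr_comp T U := R.sliceArr_of_eq_subst ord T U _ rfl
  arr_ι α := R.sliceArr_of_eq_tree ord α _ rfl

end

end Comparison

/-- The comparison of the initial multicategories. -/
def initialComparison : Comparison initialSym initialGen where
  obj _ := ⟨⟩
  obj_surjective _ := ⟨⟨⟨⟩⟩, rfl⟩
  obj_eq _ := rfl
  nonempty_hom {x y} _ := ⟨eqToHom (Subsingleton.elim (α := Discrete PUnit) x y)⟩
  subsingleton_hom x y := 
    (fun x y => inferInstance : ∀ x y : Discrete PUnit.{1}, Subsingleton (x ⟶ y)) x y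
  arr e := ⟨⟨⟩, fun _ => e.symm ⟨⟩, fun _ => rfl, rfl⟩
  name_bijective e := ⟨fun p q _ => Subsingleton.elim (α := Fin 1) p q, fun i => ⟨(0 : Fin 1), by
    exact (Equiv.symm_apply_eq e).2 rfl⟩⟩
  arr_injective _ := Subsingleton.elim (α := _ ≃ PUnit) _ _
  exists_arr_eq {I _ _ _} a ha := by
    have h : Subsingleton (Fin (initialGen.ar a.arr)) := inferInstanceAs (Subsingleton (Fin 1))
    have : Subsingleton I := ha.surjective.subsingleton
    refine ⟨⟨fun _ => ⟨⟩, fun _ => a.name (0 : Fin 1), fun _ => Subsingleton.elim _ _,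
      fun _ => rfl⟩, ?_⟩
    exact GenMulticat.Named.ext' rfl fun _ _ _ => Subsingleton.elim _ _
  arr_perm e _ _ f := rfl
  arr_comp {I _ J _ x y w} f g := by
    -- The composite in `I` identifies its index set with a one-element set, so all names of sources
    -- coincide.
    have : Subsingleton (Σ i, J i) :=
      ((Equiv.sigmaCongrRight g).trans ((sigmaPUnit I).trans f)).subsingleton
    exact GenMulticat.Named.ext' rfl fun _ _ _ => Subsingleton.elim _ _
  arr_ι a := rfl

/-! ### From comparisons to the equivalence and the isomorphism classes -/

namespace Comparison

section

variable {Q : SymMulticat} {M : GenMulticat} (R : Comparison Q M)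

/-- The equivalence of the categories of objects given by a comparison. -/
def functor : Q.Obj ⥤ Discrete M.Obj where
  obj x := ⟨R.obj x⟩
  map a := Discrete.eqToHom (R.obj_eq a)

/-- Uniqueness of object-morphisms, their existence, and surjectivity on objects are faithfulness,
fullness and essential surjectivity. -/
theorem isEquivalence_functor : R.functor.IsEquivalence where
  faithful := ⟨fun {x y} a b _ => (R.subsingleton_hom x y).elim a b⟩
  full := ⟨fun a => ⟨(R.nonempty_hom (Discrete.eq_of_hom a)).some, Subsingleton.elim _ _⟩⟩
  essSurj := ⟨fun x => by
    obtain ⟨y, hy⟩ := R.obj_surjective x.as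
    exact ⟨y, ⟨Discrete.eqToIso hy⟩⟩⟩

end

end Comparison

/-- The induction carries the whole comparison, since an equivalence of the object categories alone
says nothing about the arrows, which are the objects of the next slice. Each step works for any
order on the nodes. -/
theorem nonempty_comparison (ord : ∀ (_ : ℕ) (M : GenMulticat), M.NodeOrder) (k : ℕ) :
    Nonempty (Comparison (opetopeMulticat k) (multitopeMulticat ord k)) := by
  induction k with
  | zero => exact ⟨initialComparison⟩
  | succ k ih => exact ih.map fun R => R.slice (ord k _)

/-- An equivalence reflects isomorphisms between images, and isomorphic objects of a discrete
category are equal. The counit shows that every class is reached. -/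
theorem bijective_isoClass {C : Type} [Category.{0} C] {P : Type} (E : Discrete P ≌ C) :
    Function.Bijective fun p : P =>
      (Quotient.mk (isIsomorphicSetoid C) (E.functor.obj ⟨p⟩)) := by
  refine ⟨fun p q h => ?_, fun c => ?_⟩
  · obtain ⟨i⟩ := Quotient.exact h
    exact Discrete.eq_of_hom (E.functor.preimageIso i).hom
  · induction c using Quotient.inductionOn with
    | h c => exact ⟨(E.inverse.obj c).as, Quotient.sound ⟨E.counitIso.app c⟩⟩

end Opetopic

theorem mainTheorem8 (ord : ∀ (_ : ℕ) (M : Opetopic.GenMulticat), M.NodeOrder) (k : ℕ) :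
    ∃ E : Discrete (Opetopic.Multitope ord k) ≌ Opetopic.Opetope k,
      Function.Bijective (fun P : Opetopic.Multitope ord k =>
        (Quotient.mk (isIsomorphicSetoid (Opetopic.Opetope k)) (E.functor.obj ⟨P⟩))) := by
  obtain ⟨R⟩ := Opetopic.nonempty_comparison ord k
  have := R.isEquivalence_functor
  exact ⟨R.functor.asEquivalence.symm, Opetopic.bijective_isoClass _⟩
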